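/- **Setting.** Let $\Pi$ be a classical public-coin interactive proof system for a language $L$. On a common input $x$ with $|x|=\lambda$ (the security parameter) there are $k=k(\lambda)$ rounds; the prover (who may hold a private input $w$, e.g. a witness, admissible for $x$) sends messages $a_1,\dots,a_{k+1}\in\{0,1\}^{\ell(\lambda)}$ and the verifier sends uniformly random challenges $c_1,\dots,c_k\in\{0,1\}^{m(\lambda)}$, in the order $a_1,c_1,a_2,\dots,c_k,a_{k+1}$; $a_{i+1}$ is sampled from a distribution depending on $x$, $w$ and $a_1,c_1,\dots,a_i,c_i$. ($k=1$ gives $\Sigma$-protocols.) The functions $k,\ell,m$, and a further function $n$, are computable in polynomial time (in unary). "Polynomial time" for a family of quantum channels indexed by $x$ means: computed by circuits that a classical polynomial-time program writes out on input $x$. Two families of channels indexed by pairs $(x,w)$, $x\in L$, $w$ admissible for $x$, are *computationally* (resp. *statistically*) *indistinguishable* if every circuit of size $\mathrm{poly}(|x|)$ (resp. every quantum channel) with one measured output bit, given the output of the channel and a side register of $\mathrm{poly}(|x|)$ (resp. any number of) qubits, the channel's input and the side register being prepared in an arbitrary joint state, distinguishes them with advantage negligible in $|x|$. $\Pi$ is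 *special quantum honest-verifier computational (resp. statistical) zero-knowledge* if there is a polynomial-time simulator $\mathcal S(x,c_1,\dots,c_k)$ such that the channels that measure a query $(c_1,\dots,c_k)$ and answer with the measured output of $\mathcal S(x,c_1,\dots,c_k)$, respectively with the honest prover messages $(a_1,\dots,a_{k+1})$ when the challenges are fixed to $(c_1,\dots,c_k)$, are computationally (resp. statistically) indistinguishable. The two-message protocol $\mathsf{RR}[\Pi]$: the verifier sends registers $P_1C_1\cdots P_kC_k$, where $P_i$ holds, for each of the $\ell$ bits of $a_i$, $n(\lambda)$ qubits in uniformly random states among $|0\rangle,|1\rangle,|+\rangle,|-\rangle$, and $C_i$ holds a uniformly random $c_i\in\{0,1\}^m$. The prover draws $a_1$ and then, for $i=1,\dots,k$ in this order, commits to $a_i$ by measuring the qubits of $P_i$ belonging to its $j$-th bit in the computational basis if this bit is $0$ and in the Hadamard basis if it is $1$, with outcomes $z_i$; measures $C_i$ to get $c_i$; and draws $a_{i+1}$ as the prover of $\Pi$ would. It sends $(a_1,\dots,a_{k+1},z_1,\dots,z_k)$. The verifier accepts if the $z_i$ agree with the states it prepared wherever the bases agree and $(a_1,\dots,a_{k+1},c_1,\dots,c_k)$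 is accepting for $\Pi$. A malicious verifier $V^*$ is a pair of quantum channels: the first maps an auxiliary input register $E$ to its message and a private quantum memory of any size (no memory bound applies to it); the second maps the prover's message and this memory to an output register. A polynomial-time $V^*$ has channels computable in polynomial time, input and output registers of polynomially bounded size, and a private memory whose size is computable in polynomial time. The *interaction channel* maps $E$ to the output register. **Theorem.** 1. If $\Pi$ is special quantum honest-verifier computational zero-knowledge, then $\mathsf{RR}[\Pi]$ is computationally quantum zero-knowledge: for every polynomial-time $V^*$ there is a polynomial-time simulator, given $x$ and $E$, whose channel is computationally indistinguishable from the interaction channel of $V^*$ with the honest prover. 2. If $\Pi$ is special quantum honest-verifier statistical zero-knowledge, then $\mathsf{RR}[\Pi]$ is statistically quantum zero-knowledge: for every unbounded $V^*$ there is a polynomial-time channel from the verifier's message to the prover's message, not using $w$, such that the interaction channel of $V^*$ with it is statistically indistinguishable from the interaction channel of $V^*$ with the honest prover; and for every polynomial-time $V^*$ there is a polynomial-time simulator, given $x$ and $E$, whose channel is statistically indistinguishable from the interaction channel of $V^*$ with the honest prover. 3. In both cases the simulator can be taken on the prover's side: for every special honest-verifier simulator $\mathcal S$ of $\Pi$ of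 the respective type, the channel that first measures all of $C_1,\dots,C_k$, then runs $\mathcal S$ on the outcomes $c_1,\dots,c_k$ to get $a_1,\dots,a_{k+1}$, then measures $P_1,\dots,P_k$ as in commitments to $a_1,\dots,a_k$ with outcomes $z_1,\dots,z_k$, and returns $(a_1,\dots,a_{k+1},z_1,\dots,z_k)$, is polynomial time and is computationally (resp. statistically) indistinguishable from the channel of the honest prover of $\mathsf{RR}[\Pi]$. -/

import Mathlib

/-! ### Qubit registers, operators, channels -/

/-- Operators on the Hilbert space of a register whose qubits are indexed by `ι`
(matrices in the computational basis `ι → Bool`). -/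
abbrev Op (ι : Type) : Type := Matrix (ι → Bool) (ι → Bool) ℂ

open scoped ComplexOrder in
/-- Density operators. -/
def IsDensity {ι : Type} [Fintype ι] [DecidableEq ι] (ρ : Op ι) : Prop :=
  ρ.PosSemidef ∧ ρ.trace = 1

/-- Completely positive trace-preserving maps (Kraus form). -/
def IsCPTP {ι κ : Type} [Fintype ι] [DecidableEq ι] [Fintype κ] [DecidableEq κ]
    (Φ : Op ι → Op κ) : Prop :=
  ∃ (r : ℕ) (K : Fin r → Matrix (κ → Bool) (ι → Bool) ℂ),
    (∀ ρ, Φ ρ = ∑ j, K j * ρ * (K j).conjTranspose) ∧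
      ∑ j, (K j).conjTranspose * K j = 1

/-- `Φ ⊗ id_K`, acting on the first part of a bipartite register. -/
def onFirst {ι κ : Type} (K : Type) (Φ : Op ι → Op κ) (σ : Op (ι ⊕ K)) : Op (κ ⊕ K) :=
  Matrix.of fun x y =>
    Φ (Matrix.of fun a b => σ (Sum.elim a (x ∘ Sum.inr)) (Sum.elim b (y ∘ Sum.inr)))
      (x ∘ Sum.inl) (y ∘ Sum.inl)

open Classical in
/-- The classical state `|b⟩⟨b|`. -/
noncomputable def basisState {ι : Type} (b : ι → Bool) : Op ι :=
  Matrix.of fun x y => if x = b ∧ y = b then 1 else 0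

/-! ### Quantum circuits -/

/-- Elementary gates on wires `W`: Hadamard, the `π/8`-gate `T`, controlled-NOT and
controlled-Hadamard (control first). All wires other than the inputs start in `|0⟩`, and all
wires other than the outputs are traced out at the end. -/
inductive Gate (W : Type) : Type
  | had (w : W)
  | tee (w : W)
  | cnot (c t : W)
  | chad (c t : W)

/-- Relabelling the wires of a gate. -/
def Gate.map {W W' : Type} (f : W → W') : Gate W → Gate W'
  | .had w => .had (f w)
  | .tee w => .tee (f w)
  | .cnot c t => .cnot (f c) (f t)
  | .chad c t => .chad (f c) (f t)

/-- The wires that a gate touches. -/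
def Gate.wires {W : Type} : Gate W → List W
  | .had w => [w]
  | .tee w => [w]
  | .cnot c t => [c, t]
  | .chad c t => [c, t]

/-- The `(s, t)` entry of the Hadamard matrix. -/
noncomputable def hadEntry (s t : Bool) : ℂ :=
  if s && t then -((Real.sqrt 2 : ℝ) : ℂ)⁻¹ else ((Real.sqrt 2 : ℝ) : ℂ)⁻¹

/-- The `(s, t)` entry of `T = diag(1, e^{iπ/4})`. -/
noncomputable def teeEntry (s t : Bool) : ℂ :=
  if s = t then (if s then Complex.exp (Complex.I * (Real.pi / 4 : ℝ)) else 1) else 0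

/-- The `(s, t)` entry of the NOT matrix. -/
def notEntry (s t : Bool) : ℂ := if s = t then 0 else 1

open Classical in
/-- Matrix entry of the one-qubit operator `u` applied to wire `w`. -/
noncomputable def localEntry {W : Type} (u : Bool → Bool → ℂ) (w : W) (x y : W → Bool) : ℂ :=
  if ∀ v, v ≠ w → x v = y v then u (x w) (y w) else 0

open Classical in
/-- Matrix entry of `u` on the target `t`, controlled by `c`
(a controlled gate whose two wires coincide does nothing). -/
noncomputable def ctrlEntry {W : Type} (u : Bool → Bool → ℂ) (c t : W) (x y : W → Bool) : ℂ :=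
  if c ≠ t ∧ y c = true then localEntry u t x y else if x = y then 1 else 0

/-- Matrix entry of a gate between two computational basis configurations of the wires. -/
noncomputable def Gate.entry {W : Type} : Gate W → (W → Bool) → (W → Bool) → ℂ
  | .had w => localEntry hadEntry w
  | .tee w => localEntry teeEntry w
  | .cnot c t => ctrlEntry notEntry c t
  | .chad c t => ctrlEntry hadEntry c t

/-- A configuration of the wires in `F`, all other wires being `0`. -/
def extendZero {W : Type} [DecidableEq W] (F : Finset W) (x : F → Bool) (w : W) : Bool :=
  if h : w ∈ F then x ⟨w, h⟩ else false

/-- The unitary of a circuit on the finite wire set `F` (the head of the list is applied first). -/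
noncomputable def circuitUnitary {W : Type} [DecidableEq W] (F : Finset W) (G : List (Gate W)) :
    Op F :=
  G.foldl (fun U g => (Matrix.of fun x y => g.entry (extendZero F x) (extendZero F y)) * U) 1

open Classical in
/-- The isometry `|b⟩ ↦ |b⟩|0…0⟩` that puts the input register on the wires `inp`. -/
noncomputable def inputIsometry {W ι : Type} [DecidableEq W] (F : Finset W) (inp : ι → W) :
    Matrix (F → Bool) (ι → Bool) ℂ :=
  Matrix.of fun x b =>
    if (∀ i, extendZero F x (inp i) = b i) ∧
      ∀ w, w ∉ Set.range inp → extendZero F x w = false then 1 else 0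

open Classical in
/-- Partial trace over all wires of `F` that are not among the wires `out`. -/
noncomputable def traceOut {W κ : Type} [DecidableEq W] (F : Finset W) (out : κ → W)
    (M : Op F) : Op κ :=
  Matrix.of fun y y' => ∑ x : F → Bool, ∑ x' : F → Bool,
    if (∀ j, extendZero F x (out j) = y j) ∧ (∀ j, extendZero F x' (out j) = y' j) ∧
      (∀ w, w ∉ Set.range out → extendZero F x w = extendZero F x' w) then M x x' else 0

/-- The finite set of wires relevant for a circuit with given inputs and outputs. -/
def circuitWires {W ι κ : Type} [DecidableEq W] [Fintype ι] [Fintype κ]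
    (G : List (Gate W)) (inp : ι → W) (out : κ → W) : Finset W :=
  (G.flatMap Gate.wires).toFinset ∪ Finset.univ.image inp ∪ Finset.univ.image out

/-- The channel computed by a circuit, on a finite wire set `F` that contains the relevant ones. -/
noncomputable def circuitChannelOn {W ι κ : Type} [DecidableEq W] [Fintype ι] [DecidableEq ι]
    (F : Finset W) (G : List (Gate W)) (inp : ι → W) (out : κ → W) (ρ : Op ι) : Op κ :=
  traceOut F out ((circuitUnitary F G * inputIsometry F inp) * ρ *
    (circuitUnitary F G * inputIsometry F inp).conjTranspose)

/-- The channel computed by a circuit. -/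
noncomputable def circuitChannel {W ι κ : Type} [DecidableEq W] [Fintype ι] [DecidableEq ι]
    [Fintype κ] (G : List (Gate W)) (inp : ι → W) (out : κ → W) : Op ι → Op κ :=
  circuitChannelOn (circuitWires G inp out) G inp out

/-! ### Polynomial time: uniformly generated circuits -/

/-- Wires are array cells: a register name together with a list of indices. -/
abbrev Wire : Type := List ℕ × List ℕ

/-- Programs of a multi-stack machine (stacks of bits, named by `ℕ`) that write out a circuit.
`emit g` appends a gate; its wires are given by a register name and the list of the stacks whose
current heights are the indices of the array cell. -/
inductive Prog : Type
  | skip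
  | push (b : Bool) (v : ℕ)
  | pop (v : ℕ)
  | emit (g : Gate (List ℕ × List ℕ))
  | seq (p q : Prog)
  | ifTop (v : ℕ) (p q : Prog)
  | whileNonempty (v : ℕ) (p : Prog)

/-- The wire `name[v₁, …, v_r]` denoted by an address in the memory state `s`. -/
def resolve (s : ℕ → List Bool) (a : List ℕ × List ℕ) : Wire :=
  (a.1, a.2.map fun v => (s v).length)

/-- `Exec p s s' G t`: from memory `s` the program `p` halts in memory `s'` after `t` steps,
having written the circuit `G`. -/
inductive Exec : Prog → (ℕ → List Bool) → (ℕ → List Bool) → List (Gate Wire) → ℕ → Prop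
  | skip (s : ℕ → List Bool) : Exec .skip s s [] 1
  | push (b : Bool) (v : ℕ) (s : ℕ → List Bool) :
      Exec (.push b v) s (Function.update s v (b :: s v)) [] 1
  | pop (v : ℕ) (s : ℕ → List Bool) :
      Exec (.pop v) s (Function.update s v (s v).tail) [] 1
  | emit (g : Gate (List ℕ × List ℕ)) (s : ℕ → List Bool) :
      Exec (.emit g) s s [g.map (resolve s)] 1
  | seq {p q : Prog} {s₀ s₁ s₂ : ℕ → List Bool} {G₁ G₂ : List (Gate Wire)} {t₁ t₂ : ℕ} :
      Exec p s₀ s₁ G₁ t₁ → Exec q s₁ s₂ G₂ t₂ → Exec (.seq p q) s₀ s₂ (G₁ ++ G₂) (t₁ + t₂)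
  | ifTrue {v : ℕ} {p q : Prog} {s₀ s₁ : ℕ → List Bool} {G : List (Gate Wire)} {t : ℕ} :
      (s₀ v).head? = some true → Exec p s₀ s₁ G t → Exec (.ifTop v p q) s₀ s₁ G (t + 1)
  | ifFalse {v : ℕ} {p q : Prog} {s₀ s₁ : ℕ → List Bool} {G : List (Gate Wire)} {t : ℕ} :
      (s₀ v).head? ≠ some true → Exec q s₀ s₁ G t → Exec (.ifTop v p q) s₀ s₁ G (t + 1)
  | whileStop {v : ℕ} {p : Prog} {s : ℕ → List Bool} :
      s v = [] → Exec (.whileNonempty v p) s s [] 1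
  | whileStep {v : ℕ} {p : Prog} {s₀ s₁ s₂ : ℕ → List Bool} {G₁ G₂ : List (Gate Wire)}
      {t₁ t₂ : ℕ} :
      s₀ v ≠ [] → Exec p s₀ s₁ G₁ t₁ → Exec (.whileNonempty v p) s₁ s₂ G₂ t₂ →
        Exec (.whileNonempty v p) s₀ s₂ (G₁ ++ G₂) (t₁ + t₂ + 1)

/-- Initial memory: the input string on stack `0`, all other stacks empty. -/
def initMem (x : List Bool) : ℕ → List Bool := fun v => if v = 0 then x else []

/-- Length functions computable in polynomial time (hence polynomially bounded): some program
run on `x` halts in `poly(|x|)` steps with a stack of height `f |x|`. -/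
def PolyTimeLength (f : ℕ → ℕ) : Prop :=
  ∃ (p : Prog) (b : Polynomial ℕ), ∀ x : List Bool, ∃ s G t,
    Exec p (initMem x) s G t ∧ t ≤ b.eval x.length ∧ (s 1).length = f x.length

/-- A family of qubit registers, one for each value of the security parameter, together with
names for the qubits. -/
structure Register where
  Idx : ℕ → Type
  fin : ∀ n, Fintype (Idx n)
  dec : ∀ n, DecidableEq (Idx n)
  label : ∀ n, Idx n → Wire
  label_inj : ∀ n, Function.Injective (label n)

attribute [instance] Register.fin Register.dec

/-- Put a tag in front of the register name of a wire. -/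
def tagWire (r : ℕ) (w : Wire) : Wire := (r :: w.1, w.2)

theorem tagWire_inj {r r' : ℕ} {w w' : Wire} (h : tagWire r w = tagWire r' w') :
    r = r' ∧ w = w' := by
  obtain ⟨a, b⟩ := w
  obtain ⟨a', b'⟩ := w'
  simp only [tagWire, Prod.mk.injEq, List.cons.injEq] at h
  exact ⟨h.1.1, Prod.ext h.1.2 h.2⟩

/-- A register of `e n` qubits. -/
def Register.ofSize (e : ℕ → ℕ) : Register where
  Idx n := Fin (e n)
  fin n := inferInstance
  dec n := inferInstance
  label n j := ([], [j.val])
  label_inj n i j h := by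
    simp only [Prod.mk.injEq, List.cons.injEq] at h
    exact Fin.ext h.2.1

/-- The joint register of two registers. -/
def Register.sum (A B : Register) : Register where
  Idx n := A.Idx n ⊕ B.Idx n
  fin n := inferInstance
  dec n := inferInstance
  label n := Sum.elim (fun i => tagWire 0 (A.label n i)) (fun i => tagWire 1 (B.label n i))
  label_inj n i j h := by
    rcases i with i | i <;> rcases j with j | j <;> simp only [Sum.elim_inl, Sum.elim_inr] at h
    · exact congrArg _ (A.label_inj n (tagWire_inj h).2)
    · exact absurd (tagWire_inj h).1 (by decide)
    · exact absurd (tagWire_inj h).1 (by decide)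
    · exact congrArg _ (B.label_inj n (tagWire_inj h).2)

/-- A family of channels indexed by strings `x` is polynomial time if a classical program, run on
`x`, writes in `poly(|x|)` steps a quantum circuit that computes the channel. The input wires are
tagged `0`, the output wires `1`. -/
def PolyTime (A B : Register)
    (Φ : ∀ x : List Bool, Op (A.Idx x.length) → Op (B.Idx x.length)) : Prop :=
  ∃ (p : Prog) (b : Polynomial ℕ), ∀ x : List Bool, ∃ s G t,
    Exec p (initMem x) s G t ∧ t ≤ b.eval x.length ∧
      Φ x = circuitChannel G (fun i => tagWire 0 (A.label x.length i))
        (fun j => tagWire 1 (B.label x.length j))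

/-- Polynomially bounded functions. -/
def PolyBounded (e : ℕ → ℕ) : Prop := ∃ b : Polynomial ℕ, ∀ n, e n ≤ b.eval n

/-! ### Indistinguishability of channel families -/

/-- Negligible functions. -/
def Negligible (ε : ℕ → ℝ) : Prop :=
  Asymptotics.SuperpolynomialDecay Filter.atTop (fun n : ℕ => (n : ℝ)) ε

/-- A (non-uniform) measurement circuit on a register `ι`, with one output qubit. -/
structure MeasCircuit (ι : Type) where
  gates : List (Gate Wire)
  input : ι → Wire
  input_inj : Function.Injective input
  output : Wire

/-- The probability that the measurement circuit outputs `1` on `ρ`. -/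
noncomputable def MeasCircuit.prob {ι : Type} [Fintype ι] [DecidableEq ι]
    (D : MeasCircuit ι) (ρ : Op ι) : ℝ :=
  (circuitChannel D.gates D.input (fun _ : Unit => D.output) ρ
    (fun _ => true) (fun _ => true)).re

/-- Families of channels, indexed by a common input `x` and a private input `w` of the prover. -/
abbrev ChannelFamily (A B : Register) : Type :=
  ∀ x _w : List Bool, Op (A.Idx x.length) → Op (B.Idx x.length)

/-- Computational indistinguishability over the index set `J`: polynomial-size circuits, with an
arbitrary state on the input register and a side register of polynomial size, have negligible
advantage in `|x|`. -/
def CompIndist {A B : Register} (J : Set (List Bool × List Bool))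
    (Φ Ψ : ChannelFamily A B) : Prop :=
  ∀ b : Polynomial ℕ, ∃ ε : ℕ → ℝ, Negligible ε ∧ ∀ x w : List Bool, (x, w) ∈ J →
    ∀ (K : Type) [Fintype K] [DecidableEq K], Fintype.card K ≤ b.eval x.length →
    ∀ D : MeasCircuit (B.Idx x.length ⊕ K), D.gates.length ≤ b.eval x.length →
    ∀ σ : Op (A.Idx x.length ⊕ K), IsDensity σ →
      |D.prob (onFirst K (Φ x w) σ) - D.prob (onFirst K (Ψ x w) σ)| ≤ ε x.length

/-- Statistical indistinguishability: the same for arbitrary side registers and arbitrary channels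
with a one-qubit output, which is then measured. -/
def StatIndist {A B : Register} (J : Set (List Bool × List Bool))
    (Φ Ψ : ChannelFamily A B) : Prop :=
  ∃ ε : ℕ → ℝ, Negligible ε ∧ ∀ x w : List Bool, (x, w) ∈ J →
    ∀ (K : Type) [Fintype K] [DecidableEq K],
    ∀ D : Op (B.Idx x.length ⊕ K) → Op Unit, IsCPTP D →
    ∀ σ : Op (A.Idx x.length ⊕ K), IsDensity σ →
      |(D (onFirst K (Φ x w) σ) (fun _ => true) (fun _ => true)).re
        - (D (onFirst K (Ψ x w) σ) (fun _ => true) (fun _ => true)).re| ≤ ε x.length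

/-! ### Classical public-coin interactive proofs and special honest-verifier zero-knowledge -/

/-- A classical public-coin interactive proof system for a language: on a common input of length
`n` there are `rounds n` uniformly random challenges of `chalLen n` bits and `rounds n + 1` prover
messages of `msgLen n` bits; the prover sends the first and the last message.
`next x w [(a₁, c₁), …, (aᵢ, cᵢ)]` is the distribution of the prover's message `aᵢ₊₁`, where `w` is
the prover's private input; `wit x w` says that `w` is admissible for `x` (e.g. a witness). -/
structure PublicCoinProof where
  lang : Set (List Bool)
  wit : List Bool → List Bool → Prop
  wit_exists : ∀ x ∈ lang, ∃ w, wit x w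
  rounds : ℕ → ℕ
  msgLen : ℕ → ℕ
  chalLen : ℕ → ℕ
  rounds_polyTime : PolyTimeLength rounds
  msgLen_polyTime : PolyTimeLength msgLen
  chalLen_polyTime : PolyTimeLength chalLen
  next : ∀ x _w : List Bool,
    List ((Fin (msgLen x.length) → Bool) × (Fin (chalLen x.length) → Bool)) →
      PMF (Fin (msgLen x.length) → Bool)
  accept : ∀ x : List Bool,
    (Fin (rounds x.length + 1) × Fin (msgLen x.length) → Bool) →
      (Fin (rounds x.length) × Fin (chalLen x.length) → Bool) → Prop

namespace PublicCoinProof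

variable (I : PublicCoinProof)

/-- The instances: `x` in the language with an admissible private input of the prover. -/
def instances : Set (List Bool × List Bool) := {q | q.1 ∈ I.lang ∧ I.wit q.1 q.2}

/-- The register of all challenges `c₁, …, c_k`. -/
def chalReg : Register where
  Idx n := Fin (I.rounds n) × Fin (I.chalLen n)
  fin n := inferInstance
  dec n := inferInstance
  label n q := ([], [q.1.val, q.2.val])
  label_inj n p q h := by
    simp only [Prod.mk.injEq, List.cons.injEq] at h
    exact Prod.ext (Fin.ext h.2.1) (Fin.ext h.2.2.1)

/-- The register of all prover messages `a₁, …, a_{k+1}`. -/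
def ansReg : Register where
  Idx n := Fin (I.rounds n + 1) × Fin (I.msgLen n)
  fin n := inferInstance
  dec n := inferInstance
  label n q := ([], [q.1.val, q.2.val])
  label_inj n p q h := by
    simp only [Prod.mk.injEq, List.cons.injEq] at h
    exact Prod.ext (Fin.ext h.2.1) (Fin.ext h.2.2.1)

/-- The first `i` pairs (prover message, challenge). -/
def history {n : ℕ} (a : (I.ansReg.Idx n) → Bool) (c : (I.chalReg.Idx n) → Bool)
    (i : Fin (I.rounds n + 1)) : List ((Fin (I.msgLen n) → Bool) × (Fin (I.chalLen n) → Bool)) :=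
  List.ofFn fun j : Fin i.val =>
    ((fun q => a (⟨j.val, by omega⟩, q)), (fun q => c (⟨j.val, by omega⟩, q)))

/-- The probability that the prover's message number `i` (counted from `0`) is the one in `a`,
given the transcript so far. -/
noncomputable def nextProb (x w : List Bool) (a : I.ansReg.Idx x.length → Bool)
    (c : I.chalReg.Idx x.length → Bool) (i : Fin (I.rounds x.length + 1)) : ℝ :=
  (I.next x w (I.history a c i) (fun q => a (i, q))).toReal

/-- The probability of the prover messages `a` when the challenges are fixed to `c`. -/
noncomputable def transcriptProb (x w : List Bool) (a : I.ansReg.Idx x.length → Bool)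
    (c : I.chalReg.Idx x.length → Bool) : ℝ :=
  ∏ i, I.nextProb x w a c i

/-- The oracle that measures a query `c` and answers with the prover messages of an honest
execution in which the challenges are fixed to `c`. -/
noncomputable def realOracle : ChannelFamily I.chalReg I.ansReg := fun x w ρ =>
  Matrix.diagonal fun a => ∑ c, ρ c c * (I.transcriptProb x w a c : ℂ)

/-- The probability that a simulator outputs `a` on the challenges `c`. -/
noncomputable def simProb
    (S : ∀ x : List Bool, Op (I.chalReg.Idx x.length) → Op (I.ansReg.Idx x.length))
    (x : List Bool) (a : I.ansReg.Idx x.length → Bool) (c : I.chalReg.Idx x.length → Bool) : ℂ :=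
  S x (basisState c) a a

/-- The oracle that measures a query `c` and answers with the (measured) output of `S` on `c`. -/
noncomputable def simOracle
    (S : ∀ x : List Bool, Op (I.chalReg.Idx x.length) → Op (I.ansReg.Idx x.length)) :
    ChannelFamily I.chalReg I.ansReg := fun x _ ρ =>
  Matrix.diagonal fun a => ∑ c, ρ c c * I.simProb S x a c

/-- `S` is a simulator witnessing computational special honest-verifier zero-knowledge. -/
def IsSpecialCompSimulator
    (S : ∀ x : List Bool, Op (I.chalReg.Idx x.length) → Op (I.ansReg.Idx x.length)) : Prop :=
  PolyTime I.chalReg I.ansReg S ∧ CompIndist I.instances (I.simOracle S) I.realOracle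

/-- `S` is a simulator witnessing statistical special honest-verifier zero-knowledge. -/
def IsSpecialStatSimulator
    (S : ∀ x : List Bool, Op (I.chalReg.Idx x.length) → Op (I.ansReg.Idx x.length)) : Prop :=
  PolyTime I.chalReg I.ansReg S ∧ StatIndist I.instances (I.simOracle S) I.realOracle

/-- Special quantum honest-verifier computational zero-knowledge. -/
def IsSpecialHVCZK : Prop := ∃ S, I.IsSpecialCompSimulator S

/-- Special quantum honest-verifier statistical zero-knowledge. -/
def IsSpecialHVSZK : Prop := ∃ S, I.IsSpecialStatSimulator S

end PublicCoinProof

/-! ### Two-message quantum proofs and quantum zero-knowledge -/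

/-- A two-message quantum interactive proof: the verifier draws uniform coins and sends a quantum
message, the prover answers by a channel, and the verifier decides from its coins and the
(classical) answer. -/
structure TwoMessageProof where
  lang : Set (List Bool)
  wit : List Bool → List Bool → Prop
  fromVerifier : Register
  fromProver : Register
  prover : ChannelFamily fromVerifier fromProver
  Coins : ℕ → Type
  coins_fin : ∀ n, Fintype (Coins n)
  coins_nonempty : ∀ n, Nonempty (Coins n)
  message : ∀ x : List Bool, Coins x.length → Op (fromVerifier.Idx x.length)
  accept : ∀ x : List Bool, Coins x.length → (fromProver.Idx x.length → Bool) → Prop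

namespace TwoMessageProof

variable (T : TwoMessageProof)

/-- The instances: `x` in the language with an admissible private input of the prover. -/
def instances : Set (List Bool × List Bool) := {q | q.1 ∈ T.lang ∧ T.wit q.1 q.2}

/-- A possibly malicious verifier with auxiliary input register of size `e`, private memory of
size `e'` kept between the two messages (of any size, there is no memory bound), and output
register of size `o`. -/
structure Verifier (e e' o : ℕ → ℕ) where
  first : ∀ x : List Bool, Op ((Register.ofSize e).Idx x.length) →
    Op ((T.fromVerifier.sum (Register.ofSize e')).Idx x.length)
  second : ∀ x : List Bool, Op ((T.fromProver.sum (Register.ofSize e')).Idx x.length) →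
    Op ((Register.ofSize o).Idx x.length)

/-- Both actions of the verifier are polynomial time. -/
def Verifier.IsPolyTime {T : TwoMessageProof} {e e' o : ℕ → ℕ} (V : T.Verifier e e' o) : Prop :=
  PolyTime (Register.ofSize e) (T.fromVerifier.sum (Register.ofSize e')) V.first ∧
    PolyTime (T.fromProver.sum (Register.ofSize e')) (Register.ofSize o) V.second

/-- Both actions of the verifier are quantum channels (otherwise arbitrary). -/
def Verifier.IsChannel {T : TwoMessageProof} {e e' o : ℕ → ℕ} (V : T.Verifier e e' o) : Prop :=
  ∀ x, IsCPTP (V.first x) ∧ IsCPTP (V.second x)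

/-- The channel from the verifier's auxiliary input to its output that is induced by the
interaction of the verifier with a party answering its message by the channel `P`. -/
def Verifier.interact {T : TwoMessageProof} {e e' o : ℕ → ℕ} (V : T.Verifier e e' o)
    (P : ChannelFamily T.fromVerifier T.fromProver) :
    ChannelFamily (Register.ofSize e) (Register.ofSize o) := fun x w ρ =>
  V.second x (onFirst (Fin (e' x.length)) (P x w) (V.first x ρ))

/-- Computational quantum zero-knowledge: for every polynomial-time verifier there is a
polynomial-time simulator computing a computationally indistinguishable channel. The verifier's
input and output registers have polynomially bounded size; the size of its private memory, which
is part of its algorithm, is computable in polynomial time (otherwise it could encode advice). -/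
def IsCompQZK : Prop :=
  ∀ e e' o : ℕ → ℕ, PolyBounded e → PolyTimeLength e' → PolyBounded o →
    ∀ V : T.Verifier e e' o, V.IsPolyTime →
      ∃ S : ∀ x : List Bool, Op ((Register.ofSize e).Idx x.length) →
          Op ((Register.ofSize o).Idx x.length),
        PolyTime (Register.ofSize e) (Register.ofSize o) S ∧
          CompIndist T.instances (V.interact T.prover) (fun x _ => S x)

/-- Statistical quantum zero-knowledge. For an unbounded verifier the simulator is polynomial time
relative to the verifier: it runs the verifier once, as a black box, and answers its message by a
polynomial-time channel `S`. If the verifier is polynomial time, so is the whole simulator. -/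
def IsStatQZK : Prop :=
  (∀ (e e' o : ℕ → ℕ) (V : T.Verifier e e' o), V.IsChannel →
    ∃ S : ∀ x : List Bool, Op (T.fromVerifier.Idx x.length) → Op (T.fromProver.Idx x.length),
      PolyTime T.fromVerifier T.fromProver S ∧
        StatIndist T.instances (V.interact T.prover) (V.interact fun x _ => S x)) ∧
  ∀ e e' o : ℕ → ℕ, PolyBounded e → PolyTimeLength e' → PolyBounded o →
    ∀ V : T.Verifier e e' o, V.IsPolyTime →
      ∃ S : ∀ x : List Bool, Op ((Register.ofSize e).Idx x.length) →
          Op ((Register.ofSize o).Idx x.length),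
        PolyTime (Register.ofSize e) (Register.ofSize o) S ∧
          StatIndist T.instances (V.interact T.prover) (fun x _ => S x)

end TwoMessageProof

/-! ### The round-compression transform -/

/-- The amplitudes of the state `|s⟩` in the computational basis (`θ = false`) or in the Hadamard
basis (`θ = true`). -/
noncomputable def conjugateCoding (θ s : Bool) (y : Bool) : ℂ :=
  if θ then hadEntry y s else if y = s then 1 else 0

namespace PublicCoinProof

variable (I : PublicCoinProof) (N : ℕ → ℕ)

/-- The commitment registers `P₁, …, P_k`: `N n` qubits for each bit of each of the first `k`
prover messages. The same shape holds the opening strings `z₁, …, z_k`. -/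
def commitReg : Register where
  Idx n := Fin (I.rounds n) × Fin (I.msgLen n) × Fin (N n)
  fin n := inferInstance
  dec n := inferInstance
  label n q := ([], [q.1.val, q.2.1.val, q.2.2.val])
  label_inj n p q h := by
    simp only [Prod.mk.injEq, List.cons.injEq] at h
    exact Prod.ext (Fin.ext h.2.1) (Prod.ext (Fin.ext h.2.2.1) (Fin.ext h.2.2.2.1))

/-- The verifier's message: all registers `Pᵢ` and `Cᵢ`. -/
def rrQuery : Register := (I.commitReg N).sum I.chalReg

/-- The prover's message: `a₁, …, a_{k+1}` and `z₁, …, z_k`. -/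
def rrReply : Register := I.ansReg.sum (I.commitReg N)

open Classical in
/-- The projector for outcome `zᵢ` when register `Pᵢ` is measured as in a commitment to `aᵢ`:
the qubits that belong to bit `j` of `aᵢ` are measured in the computational basis if this bit is
`0` and in the Hadamard basis if it is `1`. -/
noncomputable def commitProj {n : ℕ} (a : I.ansReg.Idx n → Bool) (z : (I.commitReg N).Idx n → Bool)
    (i : Fin (I.rounds n)) : Op ((I.rrQuery N).Idx n) :=
  Matrix.of fun x y =>
    if (∀ q : (I.commitReg N).Idx n, q.1 ≠ i → x (Sum.inl q) = y (Sum.inl q)) ∧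
        (∀ q : I.chalReg.Idx n, x (Sum.inr q) = y (Sum.inr q)) then
      ∏ j : Fin (I.msgLen n), ∏ t : Fin (N n),
        conjugateCoding (a (i.castSucc, j)) (z (i, j, t)) (x (Sum.inl (i, j, t))) *
          star (conjugateCoding (a (i.castSucc, j)) (z (i, j, t)) (y (Sum.inl (i, j, t))))
    else 0

open Classical in
/-- The projector for outcome `cᵢ` when register `Cᵢ` is measured in the computational basis. -/
noncomputable def chalProj {n : ℕ} (c : I.chalReg.Idx n → Bool) (i : Fin (I.rounds n)) :
    Op ((I.rrQuery N).Idx n) :=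
  Matrix.of fun x y =>
    if x = y ∧ ∀ j : Fin (I.chalLen n), x (Sum.inr (i, j)) = c (i, j) then 1 else 0

/-- The unnormalised state on the branch `(a, z, c)` of the honest prover's execution. First `a₁`
is drawn; then, for `i = 1, …, k` in this order, `Pᵢ` is measured as a commitment to `aᵢ` with
outcome `zᵢ`, then `Cᵢ` is measured with outcome `cᵢ`, and `aᵢ₊₁` is drawn. -/
noncomputable def rrBranch (x w : List Bool) (a : I.ansReg.Idx x.length → Bool)
    (z : (I.commitReg N).Idx x.length → Bool) (c : I.chalReg.Idx x.length → Bool)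
    (ρ : Op ((I.rrQuery N).Idx x.length)) : Op ((I.rrQuery N).Idx x.length) :=
  (List.finRange (I.rounds x.length)).foldl
    (fun ρ i =>
      (I.nextProb x w a c i.succ : ℂ) •
        (I.chalProj N c i * (I.commitProj N a z i * ρ * I.commitProj N a z i) * I.chalProj N c i))
    ((I.nextProb x w a c 0 : ℂ) • ρ)

/-- The channel of the honest prover of the compressed protocol. -/
noncomputable def rrProver : ChannelFamily (I.rrQuery N) (I.rrReply N) := fun x w ρ =>
  Matrix.diagonal fun r => ∑ c,
    (I.rrBranch N x w (r ∘ Sum.inl) (r ∘ Sum.inr) c ρ).trace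

/-- The round compression `RR[I]`, with `N n` qubits per committed bit. The verifier's coins are
the bases, the encoded bits and the challenges. -/
noncomputable def RR : TwoMessageProof where
  lang := I.lang
  wit := I.wit
  fromVerifier := I.rrQuery N
  fromProver := I.rrReply N
  prover := I.rrProver N
  Coins n := ((I.commitReg N).Idx n → Bool) × ((I.commitReg N).Idx n → Bool) ×
    (I.chalReg.Idx n → Bool)
  coins_fin _ := inferInstance
  coins_nonempty _ := inferInstance
  message x r :=
    let ψ : ((I.rrQuery N).Idx x.length → Bool) → ℂ := fun y =>
      (∏ q, conjugateCoding (r.1 q) (r.2.1 q) (y (Sum.inl q))) *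
        ∏ q, conjugateCoding false (r.2.2 q) (y (Sum.inr q))
    Matrix.vecMulVec ψ (star ψ)
  accept x r y :=
    (∀ q : (I.commitReg N).Idx x.length,
      r.1 q = y (Sum.inl (q.1.castSucc, q.2.1)) → y (Sum.inr q) = r.2.1 q) ∧
      I.accept x (y ∘ Sum.inl) r.2.2

/-- The unnormalised state on a branch of the prover-side simulator: all registers `Cᵢ` are
measured first, then `S` is run on the outcomes `c`, and then every `Pᵢ` is measured as a
commitment to the message `aᵢ` output by `S`. -/
noncomputable def rrSimBranch
    (S : ∀ x : List Bool, Op (I.chalReg.Idx x.length) → Op (I.ansReg.Idx x.length))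
    (x : List Bool) (a : I.ansReg.Idx x.length → Bool)
    (z : (I.commitReg N).Idx x.length → Bool) (c : I.chalReg.Idx x.length → Bool)
    (ρ : Op ((I.rrQuery N).Idx x.length)) : Op ((I.rrQuery N).Idx x.length) :=
  (List.finRange (I.rounds x.length)).foldl
    (fun ρ i => I.commitProj N a z i * ρ * I.commitProj N a z i)
    (I.simProb S x a c •
      (List.finRange (I.rounds x.length)).foldl
        (fun ρ i => I.chalProj N c i * ρ * I.chalProj N c i) ρ)

/-- The prover-side simulator for `RR[I]` built from a simulator `S` for `I`. -/
noncomputable def rrSimulator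
    (S : ∀ x : List Bool, Op (I.chalReg.Idx x.length) → Op (I.ansReg.Idx x.length))
    (x : List Bool) (ρ : Op ((I.rrQuery N).Idx x.length)) : Op ((I.rrReply N).Idx x.length) :=
  Matrix.diagonal fun r => ∑ c,
    (I.rrSimBranch N S x (r ∘ Sum.inl) (r ∘ Sum.inr) c ρ).trace

end PublicCoinProof

/-! ### Pulling observables back through circuits -/

/-! The honest prover measures `P₁, C₁, P₂, C₂, …` alternately, with bases that depend on what has
been drawn so far, whereas the simulator measures all challenges first. On a fixed branch `(a, z,
c)` this makes no difference. Every measurement becomes a projector on its own block of qubits, the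
blocks are disjoint and exhaust the verifier's message, and so in either order the product is the
rank-one projector onto the encoding of `z` in the bases given by `a`, tensored with `c`. What
remains of the prover's randomness is the product of the conditional probabilities of the messages,
which is the transcript probability with the challenges fixed to `c`; for the simulator it is the
probability that `S` outputs `a` on `c` (`trace_rrBranch`, `trace_rrSimBranch`).

Hence both parties are one construction, `answerAndCommit`, applied to two oracles: swap the
registers, let an oracle answer the challenge register, then measure the commitment register in the
bases dictated by the answer (`rrProver_eq`, `rrSimulator_eq`). The special honest-verifier property
says that the two oracles are indistinguishable on arbitrary joint states, so the rest is stability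
of indistinguishability. A register on which nothing happens joins the distinguisher's side register
(`CompIndist.onFirst`), a channel applied beforehand only changes the joint state
(`CompIndist.precomp`), and an efficient channel applied afterwards joins the distinguisher's
circuit (`CompIndist.postcomp`); the statistical versions need no efficiency. The same three rules,
with the verifier's private memory as the idle register, pass from the prover's channel to the
interaction with a malicious verifier. The simulator is straight-line: it runs the verifier once and
never rewinds.

Most of the length is the proof that these channels are polynomial time. The semantics of circuits
is handled in the Heisenberg picture: `pull` transports the kernel of a measurement back through the
gates on the full, possibly infinite, set of wires, so that circuits can be renamed, concatenated
and extended by idle wires without reference to the finite wire set of the definition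
(`circuitChannel_apply`, `circuitChannel_map`, `circuitChannel_append`, `circuitChannel_sumElim`).
On the program side, two programs run on interleaved memories (`Exec.both`) and nested loops write
one gate template per array cell (`PolyCircuit.loop`). Together these give closure under composition
(`PolyTime.comp`) and under adjoining an idle register (`PolyTime.onFirst`). -/

/-- The wire on which a gate acts (for a controlled gate, its target). -/
def Gate.target {W : Type} : Gate W → W
  | .had w => w
  | .tee w => w
  | .cnot _ t => t
  | .chad _ t => t

open Classical in
/-- The one-qubit matrix that a gate applies to its target in the configuration `y`. -/
noncomputable def Gate.mat {W : Type} : Gate W → (W → Bool) → Bool → Bool → ℂ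
  | .had _, _ => hadEntry
  | .tee _, _ => teeEntry
  | .cnot c t, y => if c ≠ t ∧ y c = true then notEntry else fun s s' => if s = s' then 1 else 0
  | .chad c t, y => if c ≠ t ∧ y c = true then hadEntry else fun s s' => if s = s' then 1 else 0

theorem Gate.target_mem_wires {W : Type} (g : Gate W) : g.target ∈ g.wires := by
  cases g <;> simp [Gate.target, Gate.wires]

theorem Gate.target_map {W W' : Type} (f : W → W') (g : Gate W) :
    (g.map f).target = f g.target := by
  cases g <;> rfl

theorem Gate.wires_map {W W' : Type} (f : W → W') (g : Gate W) :
    (g.map f).wires = g.wires.map f := by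
  cases g <;> rfl

theorem Gate.map_map {W W' W'' : Type} (f : W → W') (f' : W' → W'') (g : Gate W) :
    (g.map f).map f' = g.map (f' ∘ f) := by
  cases g <;> rfl

theorem Gate.map_id {W : Type} (g : Gate W) : g.map id = g := by
  cases g <;> rfl

open Classical in
theorem ctrlEntry_eq {W : Type} (u : Bool → Bool → ℂ) (c t : W) (x y : W → Bool) :
    ctrlEntry u c t x y = if ∀ v, v ≠ t → x v = y v then
      (if c ≠ t ∧ y c = true then u else fun s s' => if s = s' then 1 else 0) (x t) (y t)
      else 0 := by
  unfold ctrlEntry localEntry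
  split_ifs with h1 h2 h3 h4 <;> try rfl
  · subst h3; simp
  · exact absurd (fun v _ => congrFun h3 v) h4
  · rename_i h5
    simp only
    rw [if_neg]
    intro h6
    apply h3
    funext v
    by_cases hv : v = t
    · rw [hv, h6]
    · exact h5 v hv

open Classical in
theorem Gate.entry_eq {W : Type} (g : Gate W) (x y : W → Bool) :
    g.entry x y = if ∀ v, v ≠ g.target → x v = y v then
      g.mat y (x g.target) (y g.target) else 0 := by
  cases g with
  | had w => rfl
  | tee w => rfl
  | cnot c t => exact ctrlEntry_eq _ _ _ _ _
  | chad c t => exact ctrlEntry_eq _ _ _ _ _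

theorem Gate.mat_map {W W' : Type} (f : W → W') (V : Set W) (hf : Set.InjOn f V) (g : Gate W)
    (hg : ∀ w ∈ g.wires, w ∈ V) {X : W' → Bool} {Y : W → Bool} (h : ∀ v ∈ V, X (f v) = Y v) :
    (g.map f).mat X = g.mat Y := by
  cases g with
  | had w => rfl
  | tee w => rfl
  | cnot c t =>
    have hc : c ∈ V := hg c (by simp [Gate.wires])
    have ht : t ∈ V := hg t (by simp [Gate.wires])
    have e : (f c ≠ f t ∧ X (f c) = true) = (c ≠ t ∧ Y c = true) := by
      rw [h c hc, ne_eq, ne_eq, hf.eq_iff hc ht]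
    by_cases hh : c ≠ t ∧ Y c = true
    · exact (if_pos (e ▸ hh)).trans (if_pos hh).symm
    · exact (if_neg (e ▸ hh)).trans (if_neg hh).symm
  | chad c t =>
    have hc : c ∈ V := hg c (by simp [Gate.wires])
    have ht : t ∈ V := hg t (by simp [Gate.wires])
    have e : (f c ≠ f t ∧ X (f c) = true) = (c ≠ t ∧ Y c = true) := by
      rw [h c hc, ne_eq, ne_eq, hf.eq_iff hc ht]
    by_cases hh : c ≠ t ∧ Y c = true
    · exact (if_pos (e ▸ hh)).trans (if_pos hh).symm
    · exact (if_neg (e ▸ hh)).trans (if_neg hh).symm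

/-- The matrix is chosen by the control bit alone, and the control differs from the target unless
the gate is trivial. -/
theorem Gate.mat_update {W : Type} [DecidableEq W] (g : Gate W) (y : W → Bool) (s : Bool) :
    g.mat (Function.update y g.target s) = g.mat y := by
  cases g with
  | had w => rfl
  | tee w => rfl
  | cnot c t =>
    by_cases h : c = t
    · simp [Gate.mat, h]
    · simp [Gate.mat, Gate.target, h]
  | chad c t =>
    by_cases h : c = t
    · simp [Gate.mat, h]
    · simp [Gate.mat, Gate.target, h]

/-- The kernel `Q` on pairs of configurations, pulled back through a circuit. -/
noncomputable def pull {W : Type} [DecidableEq W] :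
    List (Gate W) → ((W → Bool) → (W → Bool) → ℂ) → (W → Bool) → (W → Bool) → ℂ
  | [], Q => Q
  | g :: G, Q => fun x x' => ∑ s : Bool, ∑ s' : Bool,
      g.mat x s (x g.target) * star (g.mat x' s' (x' g.target)) *
        pull G Q (Function.update x g.target s) (Function.update x' g.target s')

theorem pull_append {W : Type} [DecidableEq W] (G G' : List (Gate W))
    (Q : (W → Bool) → (W → Bool) → ℂ) : pull (G ++ G') Q = pull G (pull G' Q) := by
  induction G with
  | nil => rfl
  | cons g G ih => simp only [List.cons_append, pull, ih]

/-- Pulling back reads and changes configurations only on the wires that the gates touch. So the two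
kernels need to be compared only on configurations that correspond along `f` on `V` and have kept
their initial values elsewhere. The factor `c` carries what is decided outside `V`: an indicator for
idle side wires, or `0` when the kernel must vanish. -/
theorem pull_map_congr {W W' : Type} [DecidableEq W] [DecidableEq W'] (f : W → W') (V : Set W)
    (hf : Set.InjOn f V) (c : ℂ) (Q : (W' → Bool) → (W' → Bool) → ℂ)
    (Q' : (W → Bool) → (W → Bool) → ℂ) (G : List (Gate W))
    (hG : ∀ g ∈ G, ∀ w ∈ g.wires, w ∈ V) :
    ∀ (X X' : W' → Bool) (Y Y' : W → Bool), (∀ v ∈ V, X (f v) = Y v) →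
    (∀ v ∈ V, X' (f v) = Y' v) →
    (∀ (Z Z' : W' → Bool) (R R' : W → Bool), (∀ w, w ∉ f '' V → Z w = X w) →
      (∀ w, w ∉ f '' V → Z' w = X' w) → (∀ w, w ∉ V → R w = Y w) → (∀ w, w ∉ V → R' w = Y' w) →
      (∀ v ∈ V, Z (f v) = R v) → (∀ v ∈ V, Z' (f v) = R' v) → Q Z Z' = c * Q' R R') →
    pull (G.map (Gate.map f)) Q X X' = c * pull G Q' Y Y' := by
  induction G with
  | nil =>
    intro X X' Y Y' h h' hQ
    exact hQ X X' Y Y' (fun _ _ => rfl) (fun _ _ => rfl) (fun _ _ => rfl) (fun _ _ => rfl) h h'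
  | cons g G ih =>
    intro X X' Y Y' h h' hQ
    have hg : ∀ w ∈ g.wires, w ∈ V := hG g (by simp)
    have ht : g.target ∈ V := hg _ g.target_mem_wires
    have key : ∀ {X : W' → Bool} {Y : W → Bool}, (∀ v ∈ V, X (f v) = Y v) → ∀ s, ∀ v ∈ V,
        Function.update X (f g.target) s (f v) = Function.update Y g.target s v := by
      intro X Y h s v hv
      by_cases e : v = g.target
      · subst e; simp
      · rw [Function.update_of_ne e, Function.update_of_ne (fun e' => e (hf hv ht e')), h v hv]
    simp only [List.map_cons, pull, Gate.target_map, Finset.mul_sum]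
    refine Finset.sum_congr rfl fun s _ => Finset.sum_congr rfl fun s' _ => ?_
    rw [Gate.mat_map f V hf g hg h, Gate.mat_map f V hf g hg h', h _ ht, h' _ ht,
      ih (fun g hg => hG g (by simp [hg])) _ _ (Function.update Y g.target s)
        (Function.update Y' g.target s') (key h s) (key h' s')]
    · ring
    · intro Z Z' R R' h1 h2 h3 h4 h5 h6
      refine hQ Z Z' R R' ?_ ?_ ?_ ?_ h5 h6
      · intro w hw
        rw [h1 w hw, Function.update_of_ne]
        rintro rfl
        exact hw ⟨_, ht, rfl⟩
      · intro w hw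
        rw [h2 w hw, Function.update_of_ne]
        rintro rfl
        exact hw ⟨_, ht, rfl⟩
      · intro w hw
        rw [h3 w hw, Function.update_of_ne]
        rintro rfl
        exact hw ht
      · intro w hw
        rw [h4 w hw, Function.update_of_ne]
        rintro rfl
        exact hw ht

theorem pull_congr {W : Type} [DecidableEq W] (V : Set W) (c : ℂ)
    (Q Q' : (W → Bool) → (W → Bool) → ℂ) (G : List (Gate W))
    (hG : ∀ g ∈ G, ∀ w ∈ g.wires, w ∈ V) (X X' Y Y' : W → Bool) (h : ∀ v ∈ V, X v = Y v)
    (h' : ∀ v ∈ V, X' v = Y' v)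
    (hQ : ∀ Z Z' R R' : W → Bool, (∀ w, w ∉ V → Z w = X w) →
      (∀ w, w ∉ V → Z' w = X' w) → (∀ w, w ∉ V → R w = Y w) → (∀ w, w ∉ V → R' w = Y' w) →
      (∀ v ∈ V, Z v = R v) → (∀ v ∈ V, Z' v = R' v) → Q Z Z' = c * Q' R R') :
    pull G Q X X' = c * pull G Q' Y Y' := by
  have := pull_map_congr id V (Function.injective_id.injOn) c Q Q' G hG X X' Y Y' h h'
    (by simpa using hQ)
  rwa [show Gate.map (id : W → W) = id from funext Gate.map_id, List.map_id] at this

theorem pull_sum {W J : Type} [DecidableEq W] (s : Finset J) (c : J → ℂ)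
    (Q : J → (W → Bool) → (W → Bool) → ℂ) (G : List (Gate W)) (X X' : W → Bool) :
    pull G (fun Z Z' => ∑ j ∈ s, Q j Z Z' * c j) X X' = ∑ j ∈ s, pull G (Q j) X X' * c j := by
  induction G generalizing X X' with
  | nil => rfl
  | cons g G ih =>
    simp only [pull, ih, Finset.mul_sum, Finset.sum_mul]
    symm
    rw [Finset.sum_comm]
    refine Finset.sum_congr rfl fun b _ => ?_
    rw [Finset.sum_comm]
    refine Finset.sum_congr rfl fun b _ => ?_
    exact Finset.sum_congr rfl fun j _ => by ring

/-! ### The kernel of the channel computed by a circuit -/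

/-- The configuration with the bits `b` on the wires `inp` and zeros elsewhere. -/
noncomputable def inputConfig {W ι : Type} (inp : ι → W) (b : ι → Bool) : W → Bool :=
  Function.extend inp b fun _ => false

theorem inputConfig_apply {W ι : Type} {inp : ι → W} (h : Function.Injective inp)
    (b : ι → Bool) (i : ι) : inputConfig inp b (inp i) = b i :=
  h.extend_apply _ _ _

theorem inputConfig_of_notMem {W ι : Type} {inp : ι → W} (b : ι → Bool) {w : W}
    (h : w ∉ Set.range inp) : inputConfig inp b w = false :=
  Function.extend_apply' _ _ _ h

theorem eq_inputConfig {W ι : Type} {inp : ι → W} (h : Function.Injective inp)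
    {b : ι → Bool} {X : W → Bool} (h1 : ∀ i, X (inp i) = b i)
    (h2 : ∀ w, w ∉ Set.range inp → X w = false) : X = inputConfig inp b := by
  funext w
  by_cases hw : w ∈ Set.range inp
  · obtain ⟨i, rfl⟩ := hw
    rw [h1, inputConfig_apply h]
  · rw [h2 w hw, inputConfig_of_notMem b hw]

open Classical in
/-- The kernel that selects the outcome pair `(y, y')` on the wires `out` and traces out all other
wires. -/
noncomputable def selectKernel {W κ : Type} (out : κ → W) (y y' : κ → Bool)
    (Z Z' : W → Bool) : ℂ :=
  if (∀ j, Z (out j) = y j) ∧ (∀ j, Z' (out j) = y' j) ∧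
    ∀ w, w ∉ Set.range out → Z w = Z' w then 1 else 0

theorem extendZero_update {W : Type} [DecidableEq W] (F : Finset W) (x : F → Bool) (t : W)
    (ht : t ∈ F) (s : Bool) :
    extendZero F (Function.update x ⟨t, ht⟩ s) = Function.update (extendZero F x) t s := by
  funext w
  by_cases h : w = t
  · subst h; simp [extendZero, ht]
  · rw [Function.update_of_ne h]
    unfold extendZero
    split_ifs with h'
    · rw [Function.update_of_ne]
      exact fun e => h (congrArg Subtype.val e)
    · rfl

theorem extendZero_of_mem {W : Type} [DecidableEq W] {F : Finset W} (x : F → Bool) {w : W}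
    (h : w ∈ F) : extendZero F x w = x ⟨w, h⟩ := by
  simp [extendZero, h]

theorem extendZero_injective {W : Type} [DecidableEq W] (F : Finset W) :
    Function.Injective (extendZero F) := fun x y h => by
  funext w
  have := congrFun h w.1
  rwa [extendZero_of_mem x w.2, extendZero_of_mem y w.2] at this

theorem extendZero_restrict {W : Type} [DecidableEq W] {F : Finset W} {X : W → Bool}
    (h : ∀ w, w ∉ F → X w = false) : extendZero F (fun w => X w) = X := by
  funext w
  unfold extendZero
  split_ifs with hw
  · rfl
  · exact (h w hw).symm

/-- The matrix of a gate on the finite wire set `F`. -/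
noncomputable def gateMatrix {W : Type} [DecidableEq W] (F : Finset W) (g : Gate W) : Op F :=
  Matrix.of fun x y => g.entry (extendZero F x) (extendZero F y)

/-- A column of a gate matrix is supported on the two configurations that differ from `y` at most in
the target bit. -/
theorem sum_gateMatrix {W : Type} [DecidableEq W] {F : Finset W} (g : Gate W)
    (ht : g.target ∈ F) (y : F → Bool) (φ : (F → Bool) → ℂ) :
    ∑ z, gateMatrix F g z y * φ z = ∑ s : Bool, g.mat (extendZero F y) s
      (extendZero F y g.target) * φ (Function.update y ⟨g.target, ht⟩ s) := by
  have hinj : Function.Injective fun s : Bool => Function.update y ⟨g.target, ht⟩ s :=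
    fun s s' h => by simpa using congrFun h ⟨g.target, ht⟩
  rw [← Finset.sum_subset (Finset.subset_univ (Finset.univ.map ⟨_, hinj⟩)), Finset.sum_map]
  · refine Finset.sum_congr rfl fun s _ => ?_
    simp only [gateMatrix, Matrix.of_apply, Function.Embedding.coeFn_mk, extendZero_update]
    rw [Gate.entry_eq, if_pos]
    · simp
    · intro v hv
      rw [Function.update_of_ne hv]
  · intro z _ hz
    simp only [gateMatrix, Matrix.of_apply]
    rw [Gate.entry_eq, if_neg, zero_mul]
    intro h
    apply hz
    simp only [Finset.mem_map, Finset.mem_univ, true_and, Function.Embedding.coeFn_mk]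
    refine ⟨z ⟨g.target, ht⟩, ?_⟩
    funext w
    by_cases hw : w = ⟨g.target, ht⟩
    · subst hw; simp
    · rw [Function.update_of_ne hw]
      have := h w.1 (fun e => hw (Subtype.ext e))
      rw [extendZero_of_mem _ w.2, extendZero_of_mem _ w.2] at this
      exact this.symm

theorem circuitUnitary_nil {W : Type} [DecidableEq W] (F : Finset W) :
    circuitUnitary F ([] : List (Gate W)) = 1 := rfl

theorem circuitUnitary_cons {W : Type} [DecidableEq W] (F : Finset W) (g : Gate W)
    (G : List (Gate W)) :
    circuitUnitary F (g :: G) = circuitUnitary F G * gateMatrix F g := by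
  -- The accumulator factors out on the right. This turns the left fold into a recursion on the
  -- first gate, which is how `pull` recurses.
  have key : ∀ (G : List (Gate W)) (U : Op F),
      G.foldl (fun U g => (Matrix.of fun x y => g.entry (extendZero F x) (extendZero F y)) * U) U
        = circuitUnitary F G * U := by
    intro G
    induction G with
    | nil => intro U; simp [circuitUnitary]
    | cons g G ih =>
      intro U
      unfold circuitUnitary
      rw [List.foldl_cons, List.foldl_cons, ih, ih, mul_one, Matrix.mul_assoc]
  rw [circuitUnitary, List.foldl_cons, key, mul_one]
  rfl

/-- This links the Schrödinger picture of the definition with the Heisenberg picture: the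
expectation of `Q` after the circuit is the expectation of the pulled-back kernel before it. -/
theorem sum_circuitUnitary {W : Type} [DecidableEq W] {F : Finset W}
    (Q : (W → Bool) → (W → Bool) → ℂ) (G : List (Gate W)) (hG : ∀ g ∈ G, ∀ w ∈ g.wires, w ∈ F)
    (y y' : F → Bool) :
    ∑ x, ∑ x', circuitUnitary F G x y * star (circuitUnitary F G x' y') *
      Q (extendZero F x) (extendZero F x') = pull G Q (extendZero F y) (extendZero F y') := by
  induction G generalizing y y' with
  | nil =>
    simp only [circuitUnitary_nil, pull, Matrix.one_apply]
    simp
  | cons g G ih =>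
    have ht : g.target ∈ F := hG g (by simp) _ g.target_mem_wires
    have hG' : ∀ g ∈ G, ∀ w ∈ g.wires, w ∈ F := fun g hg => hG g (by simp [hg])
    simp only [circuitUnitary_cons, Matrix.mul_apply, pull, ← extendZero_update F _ _ ht,
      ← ih hG']
    -- The conjugated sum is rewritten as the `star` of a sum with the gate entry as left factor, so
    -- that `sum_gateMatrix` contracts both copies of the gate.
    have e1 : ∀ x x', (∑ z, circuitUnitary F G x z * gateMatrix F g z y) *
        star (∑ z', circuitUnitary F G x' z' * gateMatrix F g z' y') *
          Q (extendZero F x) (extendZero F x') =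
        ∑ z, gateMatrix F g z y * (circuitUnitary F G x z * star (∑ z', gateMatrix F g z' y' *
          (circuitUnitary F G x' z' * star (Q (extendZero F x) (extendZero F x'))))) := by
      intro x x'
      simp only [star_sum, Finset.sum_mul, Finset.mul_sum, star_mul', star_star]
      rw [Finset.sum_comm]
      exact Finset.sum_congr rfl fun z _ => Finset.sum_congr rfl fun z' _ => by ring
    simp only [e1, sum_gateMatrix g ht]
    rw [Finset.sum_congr rfl fun x _ => Finset.sum_comm, Finset.sum_comm]
    refine Finset.sum_congr rfl fun s _ => ?_
    simp only [star_sum, Finset.mul_sum, star_mul', star_star]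
    rw [Finset.sum_congr rfl fun x _ => Finset.sum_comm, Finset.sum_comm]
    exact Finset.sum_congr rfl fun s' _ => Finset.sum_congr rfl fun x _ =>
      Finset.sum_congr rfl fun x' _ => by ring

theorem traceOut_apply {W κ : Type} [DecidableEq W] (F : Finset W) (out : κ → W)
    (M : Op F) (y y' : κ → Bool) :
    traceOut F out M y y' = ∑ x : F → Bool, ∑ x' : F → Bool,
      M x x' * selectKernel out y y' (extendZero F x) (extendZero F x') := by
  simp only [traceOut, Matrix.of_apply, selectKernel]
  refine Finset.sum_congr rfl fun x _ => Finset.sum_congr rfl fun x' _ => ?_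
  split_ifs <;> simp

theorem inputIsometry_apply {W ι : Type} [DecidableEq W] {F : Finset W} {inp : ι → W}
    (h : Function.Injective inp) (hF : ∀ i, inp i ∈ F) (x : F → Bool) (b : ι → Bool) :
    inputIsometry F inp x b = if x = (fun w : F => inputConfig inp b w) then 1 else 0 := by
  classical
  simp only [inputIsometry, Matrix.of_apply]
  refine if_congr ?_ rfl rfl
  have e : extendZero F (fun w : F => inputConfig inp b w) = inputConfig inp b :=
    extendZero_restrict fun w hw => inputConfig_of_notMem b fun ⟨i, hi⟩ => hw (hi ▸ hF i)
  rw [← (extendZero_injective F).eq_iff, e]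
  constructor
  · rintro ⟨h1, h2⟩
    exact eq_inputConfig h h1 h2
  · intro h'
    rw [h']
    exact ⟨inputConfig_apply h b, fun w => inputConfig_of_notMem b⟩

theorem mem_circuitWires_of_gate {W ι κ : Type} [DecidableEq W] [Fintype ι] [Fintype κ]
    {G : List (Gate W)} {inp : ι → W} {out : κ → W} {g : Gate W} (hg : g ∈ G) {w : W}
    (hw : w ∈ g.wires) : w ∈ circuitWires G inp out := by
  simp only [circuitWires, Finset.mem_union, List.mem_toFinset, List.mem_flatMap]
  exact Or.inl (Or.inl ⟨g, hg, hw⟩)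

theorem inp_mem_circuitWires {W ι κ : Type} [DecidableEq W] [Fintype ι] [Fintype κ]
    (G : List (Gate W)) (inp : ι → W) (out : κ → W) (i : ι) :
    inp i ∈ circuitWires G inp out := by
  simp [circuitWires]

/-- The right-hand side no longer mentions `F`, since the input configurations live on all wires.
All later composition rules start from this formula. -/
theorem circuitChannelOn_apply {W ι κ : Type} [DecidableEq W] [Fintype ι] [DecidableEq ι]
    {F : Finset W} {G : List (Gate W)} (hG : ∀ g ∈ G, ∀ w ∈ g.wires, w ∈ F) {inp : ι → W}
    (hinp : Function.Injective inp) (hin : ∀ i, inp i ∈ F) (out : κ → W)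
    (ρ : Op ι) (y y' : κ → Bool) :
    circuitChannelOn F G inp out ρ y y' = ∑ b, ∑ b', ρ b b' *
      pull G (selectKernel out y y') (inputConfig inp b) (inputConfig inp b') := by
  have hM : ∀ x b, (circuitUnitary F G * inputIsometry F inp) x b =
      circuitUnitary F G x fun w : F => inputConfig inp b w := by
    intro x b
    simp only [Matrix.mul_apply, inputIsometry_apply hinp hin]
    simp
  have e : ∀ b, extendZero F (fun w : F => inputConfig inp b w) = inputConfig inp b := fun b =>
    extendZero_restrict fun w hw => inputConfig_of_notMem b fun ⟨i, hi⟩ => hw (hi ▸ hin i)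
  have e2 : ∀ b b', pull G (selectKernel out y y') (inputConfig inp b) (inputConfig inp b') =
      ∑ x, ∑ x', circuitUnitary F G x (fun w : F => inputConfig inp b w) *
        star (circuitUnitary F G x' fun w : F => inputConfig inp b' w) *
      selectKernel out y y' (extendZero F x) (extendZero F x') := by
    intro b b'
    rw [sum_circuitUnitary _ _ hG, e, e]
  have e3 : ∀ x x' : F → Bool, ((circuitUnitary F G * inputIsometry F inp) * ρ *
        (circuitUnitary F G * inputIsometry F inp).conjTranspose) x x' =
      ∑ b, ∑ b', ρ b b' * (circuitUnitary F G x (fun w : F => inputConfig inp b w) *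
        star (circuitUnitary F G x' fun w : F => inputConfig inp b' w)) := by
    intro x x'
    rw [Matrix.mul_apply]
    simp only [Matrix.mul_apply (M := circuitUnitary F G * inputIsometry F inp) (N := ρ),
      Matrix.conjTranspose_apply, hM, Finset.sum_mul]
    rw [Finset.sum_comm]
    exact Finset.sum_congr rfl fun b _ => Finset.sum_congr rfl fun b' _ => by ring
  rw [circuitChannelOn, traceOut_apply]
  simp only [e3, e2, Finset.mul_sum, Finset.sum_mul]
  simp_rw [Finset.sum_comm (s := (Finset.univ : Finset (F → Bool)))
    (t := (Finset.univ : Finset (ι → Bool)))]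
  refine Finset.sum_congr rfl fun b _ => Finset.sum_congr rfl fun b' _ =>
    Finset.sum_congr rfl fun x _ => Finset.sum_congr rfl fun x' _ => by ring

theorem circuitChannel_apply {W ι κ : Type} [DecidableEq W] [Fintype ι] [DecidableEq ι]
    [Fintype κ] (G : List (Gate W)) {inp : ι → W} (hinp : Function.Injective inp) (out : κ → W)
    (ρ : Op ι) (y y' : κ → Bool) :
    circuitChannel G inp out ρ y y' = ∑ b, ∑ b', ρ b b' *
      pull G (selectKernel out y y') (inputConfig inp b) (inputConfig inp b') :=
  circuitChannelOn_apply (fun _ hg _ => mem_circuitWires_of_gate hg) hinp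
    (inp_mem_circuitWires G inp out) out ρ y y'

/-! ### Composition rules for circuits -/

theorem selectKernel_eq_ite {W κ : Type} {out : κ → W} {y y' : κ → Bool} {Z Z' : W → Bool}
    {P : Prop} [Decidable P] (h : ((∀ j, Z (out j) = y j) ∧ (∀ j, Z' (out j) = y' j) ∧
      ∀ w, w ∉ Set.range out → Z w = Z' w) ↔ P) :
    selectKernel out y y' Z Z' = if P then 1 else 0 := by
  simp only [selectKernel, h]

theorem selectKernel_congr {W W' κ κ' : Type} {out : κ → W} {out' : κ' → W'} {y y' : κ → Bool}
    {u u' : κ' → Bool} {Z Z' : W → Bool} {R R' : W' → Bool}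
    (h : ((∀ j, Z (out j) = y j) ∧ (∀ j, Z' (out j) = y' j) ∧
      ∀ w, w ∉ Set.range out → Z w = Z' w) ↔ ((∀ j, R (out' j) = u j) ∧ (∀ j, R' (out' j) = u' j) ∧
      ∀ w, w ∉ Set.range out' → R w = R' w)) :
    selectKernel out y y' Z Z' = selectKernel out' u u' R R' := by
  classical
  exact (selectKernel_eq_ite h).trans (selectKernel_eq_ite Iff.rfl).symm

theorem inputConfig_comp {W W' ι : Type} {f : W → W'} (hf : Function.Injective f) {inp : ι → W}
    (hinp : Function.Injective inp) (b : ι → Bool) (w : W) :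
    inputConfig (f ∘ inp) b (f w) = inputConfig inp b w := by
  by_cases hw : w ∈ Set.range inp
  · obtain ⟨i, rfl⟩ := hw
    rw [inputConfig_apply hinp]
    exact inputConfig_apply (hf.comp hinp) b i
  · rw [inputConfig_of_notMem b hw, inputConfig_of_notMem]
    rintro ⟨i, hi⟩
    exact hw ⟨i, hf hi⟩

/-- Renaming the wires does not change the channel. -/
theorem circuitChannel_map {W W' ι κ : Type} [DecidableEq W] [DecidableEq W'] [Fintype ι]
    [DecidableEq ι] [Fintype κ] {f : W → W'} (hf : Function.Injective f) (G : List (Gate W))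
    {inp : ι → W} (hinp : Function.Injective inp) (out : κ → W) :
    circuitChannel (G.map (Gate.map f)) (f ∘ inp) (f ∘ out) = circuitChannel G inp out := by
  funext ρ
  ext y y'
  rw [circuitChannel_apply _ (hf.comp hinp), circuitChannel_apply _ hinp]
  refine Finset.sum_congr rfl fun b _ => Finset.sum_congr rfl fun b' _ => congrArg _ ?_
  rw [← one_mul (pull G _ _ _)]
  refine pull_map_congr f Set.univ hf.injOn 1 _ _ G (fun _ _ _ _ => Set.mem_univ _) _ _ _ _
    (fun v _ => inputConfig_comp hf hinp b v) (fun v _ => inputConfig_comp hf hinp b' v) ?_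
  intro Z Z' R R' h1 h2 _ _ h5 h6
  rw [one_mul]
  have h5' : ∀ v, Z (f v) = R v := fun v => h5 v trivial
  have h6' : ∀ v, Z' (f v) = R' v := fun v => h6 v trivial
  refine selectKernel_congr ?_
  simp only [Function.comp_apply, h5', h6']
  refine and_congr_right fun _ => and_congr_right fun _ => ⟨?_, ?_⟩
  · intro h w hw
    rw [← h5', ← h6']
    apply h
    rintro ⟨j, hj⟩
    exact hw ⟨j, hf hj⟩
  · intro h w hw
    by_cases hr : w ∈ Set.range f
    · obtain ⟨v, rfl⟩ := hr
      rw [h5', h6']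
      apply h
      rintro ⟨j, rfl⟩
      exact hw ⟨j, rfl⟩
    -- A wire outside the range of `f` is neither an input nor touched by a gate, so it carries `0`
    -- in both configurations.
    · have hr' : w ∉ f '' Set.univ := by rwa [Set.image_univ]
      have hr2 : ∀ b, inputConfig (f ∘ inp) b w = false := fun b => inputConfig_of_notMem b
        (by rintro ⟨i, rfl⟩; exact hr ⟨_, rfl⟩)
      rw [h1 w hr', h2 w hr', hr2, hr2]

theorem selectKernel_eq {W κ : Type} (out : κ → W) [DecidableEq (κ → Bool)] (y y' : κ → Bool)
    (Z Z' : W → Bool) (h : ∀ w, w ∉ Set.range out → Z w = Z' w) :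
    selectKernel out y y' Z Z' = if y = Z ∘ out ∧ y' = Z' ∘ out then 1 else 0 := by
  refine selectKernel_eq_ite ?_
  constructor
  · rintro ⟨h1, h2, -⟩
    exact ⟨funext fun j => (h1 j).symm, funext fun j => (h2 j).symm⟩
  · rintro ⟨rfl, rfl⟩
    exact ⟨fun _ => rfl, fun _ => rfl, h⟩

/-- Sequential composition of circuits that share only the intermediate register. -/
theorem circuitChannel_append {W ι μ κ : Type} [DecidableEq W] [Fintype ι] [DecidableEq ι]
    [Fintype μ] [DecidableEq μ] [Fintype κ] (G₁ G₂ : List (Gate W)) {inp : ι → W} {mid : μ → W}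
    {out : κ → W} (hinp : Function.Injective inp) (hmid : Function.Injective mid)
    (V₁ V₂ : Set W) (hG₁ : ∀ g ∈ G₁, ∀ w ∈ g.wires, w ∈ V₁) (hG₂ : ∀ g ∈ G₂, ∀ w ∈ g.wires, w ∈ V₂)
    (hinp₁ : ∀ i, inp i ∈ V₁) (hmid₂ : ∀ i, mid i ∈ V₂)
    (hout₂ : ∀ i, out i ∈ V₂) (hV : ∀ w ∈ V₁, w ∈ V₂ → w ∈ Set.range mid) (ρ : Op ι) :
    circuitChannel (G₁ ++ G₂) inp out ρ =
      circuitChannel G₂ mid out (circuitChannel G₁ inp mid ρ) := by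
  ext y y'
  rw [circuitChannel_apply _ hinp, circuitChannel_apply _ hmid]
  simp only [circuitChannel_apply _ hinp]
  -- A resolution of the identity is inserted between the two circuits: the sum runs over the pairs
  -- of values that the intermediate register can take.
  have key : ∀ b b', pull (G₁ ++ G₂) (selectKernel out y y') (inputConfig inp b)
      (inputConfig inp b') = ∑ u : (μ → Bool) × (μ → Bool),
        pull G₁ (selectKernel mid u.1 u.2) (inputConfig inp b) (inputConfig inp b') *
        pull G₂ (selectKernel out y y') (inputConfig mid u.1) (inputConfig mid u.2) := by
    intro b b'
    rw [pull_append, ← pull_sum, ← one_mul (pull G₁ (fun Z Z' => ∑ _, _) _ _)]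
    refine pull_congr V₁ 1 _ _ G₁ hG₁ _ _ _ _ (fun _ _ => rfl) (fun _ _ => rfl) ?_
    intro Z Z' R R' h1 h2 h3 h4 h5 h6
    have hR : R = Z := funext fun w => by
      by_cases hw : w ∈ V₁
      · exact (h5 w hw).symm
      · rw [h1 w hw, h3 w hw]
    have hR' : R' = Z' := funext fun w => by
      by_cases hw : w ∈ V₁
      · exact (h6 w hw).symm
      · rw [h2 w hw, h4 w hw]
    subst hR hR'
    rw [one_mul]
    -- The ancillas of the second circuit are fresh: the first circuit cannot reach them, so they
    -- are still `0`.
    have hz : ∀ w ∈ V₂, w ∉ Set.range mid → R w = false ∧ R' w = false := by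
      intro w hw hw'
      have hw1 : w ∉ V₁ := fun h => hw' (hV w h hw)
      rw [h3 w hw1, h4 w hw1, inputConfig_of_notMem, inputConfig_of_notMem]
      · exact ⟨rfl, rfl⟩
      · rintro ⟨i, rfl⟩; exact hw1 (hinp₁ i)
      · rintro ⟨i, rfl⟩; exact hw1 (hinp₁ i)
    have hv : ∀ {R : W → Bool}, (∀ w ∈ V₂, w ∉ Set.range mid → R w = false) →
        ∀ v ∈ V₂, R v = inputConfig mid (R ∘ mid) v := by
      intro R h v hv
      by_cases hm : v ∈ Set.range mid
      · obtain ⟨i, rfl⟩ := hm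
        rw [inputConfig_apply hmid]
        rfl
      · rw [inputConfig_of_notMem _ hm, h v hv hm]
    classical
    by_cases hRR : ∀ w, w ∉ Set.range mid → R w = R' w
    · simp only [selectKernel_eq mid _ _ _ _ hRR]
      rw [Finset.sum_eq_single ((R ∘ mid, R' ∘ mid) : (μ → Bool) × (μ → Bool))]
      · rw [if_pos ⟨rfl, rfl⟩]
        refine pull_congr V₂ 1 _ _ G₂ hG₂ _ _ _ _ (hv fun w h h' => (hz w h h').1)
          (hv fun w h h' => (hz w h h').2) ?_
        intro A A' B B' a1 a2 a3 a4 a5 a6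
        rw [one_mul]
        refine selectKernel_congr ?_
        have o1 : ∀ j, A (out j) = B (out j) := fun j => a5 _ (hout₂ j)
        have o2 : ∀ j, A' (out j) = B' (out j) := fun j => a6 _ (hout₂ j)
        simp only [o1, o2]
        refine and_congr_right fun _ => and_congr_right fun _ => ?_
        refine forall_congr' fun w => imp_congr_right fun hw => ?_
        by_cases hw2 : w ∈ V₂
        · rw [a5 w hw2, a6 w hw2]
        · have hw3 : w ∉ Set.range mid := by rintro ⟨i, rfl⟩; exact hw2 (hmid₂ i)
          rw [a1 w hw2, a2 w hw2, a3 w hw2, a4 w hw2, inputConfig_of_notMem _ hw3,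
            inputConfig_of_notMem _ hw3, hRR w hw3]
          simp
      · rintro ⟨u, u'⟩ - hu
        rw [if_neg, zero_mul]
        rintro ⟨rfl, rfl⟩
        exact hu rfl
      · intro h
        exact absurd (Finset.mem_univ _) h
    -- If the two configurations differ on a wire outside `mid`, then that wire is outside `V₂`. The
    -- second circuit neither changes nor outputs it, so tracing it out kills the term on both
    -- sides.
    · have h0 : ∀ u u', selectKernel mid u u' R R' = 0 := fun u u' =>
        if_neg fun h => hRR h.2.2
      simp only [h0, zero_mul, Finset.sum_const_zero]
      -- With the factor `0`, the comparison lemma says that the pulled-back kernel vanishes.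
      have := pull_congr V₂ 0 (selectKernel out y y') (selectKernel out y y') G₂ hG₂ R R' R R'
        (fun _ _ => rfl) (fun _ _ => rfl) ?_
      · rw [this, zero_mul]
      · intro A A' B B' a1 a2 _ _ _ _
        rw [zero_mul]
        refine if_neg fun h => hRR fun w hw => ?_
        by_cases hw2 : w ∈ V₂
        · rw [(hz w hw2 hw).1, (hz w hw2 hw).2]
        · rw [← a1 w hw2, ← a2 w hw2]
          apply h.2.2
          rintro ⟨j, rfl⟩
          exact hw2 (hout₂ j)
  simp only [key, Finset.mul_sum, Finset.sum_mul]
  rw [← Fintype.sum_prod_type' (f := fun b b' => ∑ u : (μ → Bool) × (μ → Bool), ρ b b' *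
    (pull G₁ (selectKernel mid u.1 u.2) (inputConfig inp b) (inputConfig inp b') *
        pull G₂ (selectKernel out y y') (inputConfig mid u.1) (inputConfig mid u.2))),
    Finset.sum_comm, Fintype.sum_prod_type]
  refine Finset.sum_congr rfl fun u _ => Finset.sum_congr rfl fun u' _ => ?_
  rw [Fintype.sum_prod_type]
  exact Finset.sum_congr rfl fun b _ => Finset.sum_congr rfl fun b' _ => by ring

/-- A circuit acts trivially on side wires that it does not touch. -/
theorem circuitChannel_sumElim {W ι κ K : Type} [DecidableEq W] [Fintype ι] [DecidableEq ι]
    [Fintype κ] [Fintype K] [DecidableEq K] (G : List (Gate W)) {inp : ι → W} {out : κ → W}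
    {side : K → W} (hinp : Function.Injective inp) (hside : Function.Injective side)
    (V : Set W) (hG : ∀ g ∈ G, ∀ w ∈ g.wires, w ∈ V) (hinpV : ∀ i, inp i ∈ V)
    (houtV : ∀ i, out i ∈ V) (hsideV : ∀ k, side k ∉ V) (σ : Op (ι ⊕ K)) :
    circuitChannel G (Sum.elim inp side) (Sum.elim out side) σ =
      onFirst K (circuitChannel G inp out) σ := by
  classical
  have hs : Function.Injective (Sum.elim inp side) :=
    Function.Injective.sumElim hinp hside fun i k h => hsideV k (h ▸ hinpV i)
  ext y y'
  rw [circuitChannel_apply _ hs]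
  simp only [onFirst, Matrix.of_apply, circuitChannel_apply _ hinp]
  -- The side bits pass through unchanged, so the kernel splits into an indicator that they equal
  -- the requested outputs and the kernel on the remaining wires.
  have key : ∀ b b', pull G (selectKernel (Sum.elim out side) y y')
      (inputConfig (Sum.elim inp side) b) (inputConfig (Sum.elim inp side) b') =
      (if b ∘ Sum.inr = y ∘ Sum.inr ∧ b' ∘ Sum.inr = y' ∘ Sum.inr then 1 else 0) *
      pull G (selectKernel out (y ∘ Sum.inl) (y' ∘ Sum.inl)) (inputConfig inp (b ∘ Sum.inl))
        (inputConfig inp (b' ∘ Sum.inl)) := by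
    intro b b'
    have hv : ∀ b : ι ⊕ K → Bool, ∀ v ∈ V, inputConfig (Sum.elim inp side) b v =
        inputConfig inp (b ∘ Sum.inl) v := by
      intro b v hv
      by_cases hi : v ∈ Set.range inp
      · obtain ⟨i, rfl⟩ := hi
        rw [inputConfig_apply hinp]
        exact inputConfig_apply hs b (Sum.inl i)
      · rw [inputConfig_of_notMem _ hi, inputConfig_of_notMem]
        rintro ⟨i | k, h⟩
        · exact hi ⟨i, h⟩
        · exact hsideV k (by subst h; exact hv)
    refine pull_congr V _ _ _ G hG _ _ _ _ (hv b) (hv b') ?_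
    intro Z Z' R R' h1 h2 h3 h4 h5 h6
    have c1 : ∀ k, Z (side k) = b (Sum.inr k) := fun k => by
      rw [h1 _ (hsideV k)]; exact inputConfig_apply hs b (Sum.inr k)
    have c2 : ∀ k, Z' (side k) = b' (Sum.inr k) := fun k => by
      rw [h2 _ (hsideV k)]; exact inputConfig_apply hs b' (Sum.inr k)
    have c3 : ∀ k, Z (out k) = R (out k) := fun k => h5 _ (houtV k)
    have c4 : ∀ k, Z' (out k) = R' (out k) := fun k => h6 _ (houtV k)
    rw [selectKernel_eq_ite (out := out) Iff.rfl, ite_zero_mul_ite_zero, one_mul]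
    refine selectKernel_eq_ite ?_
    simp only [Sum.forall, Sum.elim_inl, Sum.elim_inr, c1, c2, c3, c4, funext_iff,
      Function.comp_apply]
    constructor
    · rintro ⟨⟨a1, a2⟩, ⟨a3, a4⟩, a5⟩
      refine ⟨⟨a2, a4⟩, a1, a3, fun w hw => ?_⟩
      by_cases hV : w ∈ V
      · rw [← h5 w hV, ← h6 w hV]
        apply a5
        rintro ⟨j | k, h⟩
        · exact hw ⟨j, h⟩
        · exact hsideV k (by subst h; exact hV)
      · have hw' : w ∉ Set.range inp := by rintro ⟨i, rfl⟩; exact hV (hinpV i)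
        rw [h3 w hV, h4 w hV, inputConfig_of_notMem _ hw', inputConfig_of_notMem _ hw']
    · rintro ⟨⟨a2, a4⟩, a1, a3, a5⟩
      refine ⟨⟨a1, a2⟩, ⟨a3, a4⟩, fun w hw => ?_⟩
      by_cases hV : w ∈ V
      · rw [h5 w hV, h6 w hV]
        apply a5
        rintro ⟨j, rfl⟩
        exact hw ⟨Sum.inl j, rfl⟩
      · have hw' : w ∉ Set.range (Sum.elim inp side) := by
          rintro ⟨i | k, rfl⟩
          · exact hV (hinpV i)
          · exact hw ⟨Sum.inr k, rfl⟩
        rw [h1 w hV, h2 w hV, inputConfig_of_notMem _ hw', inputConfig_of_notMem _ hw']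
  simp only [key]
  rw [← (Equiv.sumArrowEquivProdArrow ι K Bool).symm.sum_comp]
  have e2 : ∀ (b1 : ι → Bool) (b2 : K → Bool), (Equiv.sumArrowEquivProdArrow ι K Bool).symm (b1, b2)
      = Sum.elim b1 b2 := fun _ _ => rfl
  rw [Fintype.sum_prod_type]
  refine Finset.sum_congr rfl fun b1 _ => ?_
  rw [Finset.sum_eq_single (y ∘ Sum.inr)]
  · rw [← (Equiv.sumArrowEquivProdArrow ι K Bool).symm.sum_comp, Fintype.sum_prod_type]
    refine Finset.sum_congr rfl fun b1' _ => ?_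
    rw [Finset.sum_eq_single (y' ∘ Sum.inr)]
    · simp [e2]
    · intro b2 _ hb
      simp [e2, hb]
    · intro h
      exact absurd (Finset.mem_univ _) h
  · intro b2 _ hb
    refine Finset.sum_eq_zero fun b' _ => ?_
    simp [e2, hb]
  · intro h
    exact absurd (Finset.mem_univ _) h

/-- Relabelling the qubits of a register along a bijection. -/
def relabel {ι κ : Type} (e : κ ≃ ι) (ρ : Op ι) : Op κ :=
  ρ.submatrix (fun b => b ∘ e.symm) (fun b => b ∘ e.symm)

theorem relabel_apply {ι κ : Type} (e : κ ≃ ι) (ρ : Op ι) (b b' : κ → Bool) :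
    relabel e ρ b b' = ρ (b ∘ e.symm) (b' ∘ e.symm) := rfl

theorem circuitChannel_comp_equiv {W ι ι' κ : Type} [DecidableEq W] [Fintype ι] [DecidableEq ι]
    [Fintype ι'] [DecidableEq ι'] [Fintype κ] (G : List (Gate W)) {inp : ι → W}
    (hinp : Function.Injective inp) (out : κ → W) (e : ι' ≃ ι) (ρ : Op ι') :
    circuitChannel G (inp ∘ e) out ρ = circuitChannel G inp out (relabel e.symm ρ) := by
  ext y y'
  rw [circuitChannel_apply _ (hinp.comp e.injective), circuitChannel_apply _ hinp]
  have h : ∀ b : ι' → Bool, inputConfig (inp ∘ e) b = inputConfig inp (b ∘ e.symm) := by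
    intro b
    refine eq_inputConfig hinp (fun i => ?_) fun w hw => inputConfig_of_notMem _ ?_
    · have := inputConfig_apply (hinp.comp e.injective) b (e.symm i)
      simpa using this
    · rintro ⟨i, rfl⟩
      exact hw ⟨_, rfl⟩
  rw [← (e.arrowCongr (Equiv.refl Bool)).sum_comp]
  refine Finset.sum_congr rfl fun b _ => ?_
  rw [← (e.arrowCongr (Equiv.refl Bool)).sum_comp]
  refine Finset.sum_congr rfl fun b' _ => ?_
  rw [relabel_apply, h, h]
  simp [Equiv.arrowCongr, Function.comp_def]

/-! ### Moving and copying qubits -/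

/-- The classical action of a controlled-NOT gate. -/
def cnotConfig {W : Type} [DecidableEq W] (c t : W) (X : W → Bool) : W → Bool :=
  Function.update X t (xor (X t) (X c))

theorem pull_cnot {W : Type} [DecidableEq W] {c t : W} (h : c ≠ t) (G : List (Gate W))
    (Q : (W → Bool) → (W → Bool) → ℂ) (X X' : W → Bool) :
    pull (.cnot c t :: G) Q X X' = pull G Q (cnotConfig c t X) (cnotConfig c t X') := by
  simp only [pull, Gate.target, Gate.mat, cnotConfig]
  cases hx : X c <;> cases hx' : X' c <;> cases ht : X t <;> cases ht' : X' t <;>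
    simp_all [notEntry]

/-- The gates that move the qubits `i ∈ l` from the wires `src i` to the fresh wires `dst i`. -/
def moveGates {ι W : Type} (src dst : ι → W) (l : List ι) : List (Gate W) :=
  l.flatMap fun i => [.cnot (src i) (dst i), .cnot (dst i) (src i)]

/-- The first controlled-NOT copies the bit onto a wire in state `0` and the second one clears the
source. The induction changes the placement of the register instead of its content: once `i` has
been moved, the rest is the same statement with `src i` replaced by `dst i`. -/
theorem pull_moveGates {ι W : Type} [DecidableEq W] [DecidableEq ι] (Q : (W → Bool) → (W → Bool) → ℂ)
    (b b' : ι → Bool) (l : List ι) (hl : l.Nodup) : ∀ {src dst : ι → W},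
    Function.Injective src → (∀ i ∈ l, ∀ j ∈ l, dst i = dst j → i = j) →
    (∀ i ∈ l, ∀ j, dst i ≠ src j) →
    pull (moveGates src dst l) Q (inputConfig src b) (inputConfig src b') =
      Q (inputConfig (fun i => if i ∈ l then dst i else src i) b)
        (inputConfig (fun i => if i ∈ l then dst i else src i) b') := by
  induction l with
  | nil => intro src dst _ _ _; simp [moveGates, pull]
  | cons i l ih =>
    intro src dst hsrc hdst hdisj
    obtain ⟨hil, hl'⟩ := List.nodup_cons.mp hl
    have hi : ∀ j, dst i ≠ src j := hdisj i (by simp)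
    set src' := Function.update src i (dst i) with hsrc'
    have hinj' : Function.Injective src' := by
      intro j k h
      by_cases hj : j = i <;> by_cases hk : k = i
      · rw [hj, hk]
      · subst hj; rw [hsrc', Function.update_self, Function.update_of_ne hk] at h
        exact absurd h (hi k)
      · subst hk; rw [hsrc', Function.update_self, Function.update_of_ne hj] at h
        exact absurd h.symm (hi j)
      · rw [hsrc', Function.update_of_ne hj, Function.update_of_ne hk] at h
        exact hsrc h
    have step : ∀ b : ι → Bool, cnotConfig (dst i) (src i) (cnotConfig (src i) (dst i)
        (inputConfig src b)) = inputConfig src' b := by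
      intro b
      have hb : inputConfig src b (src i) = b i := inputConfig_apply hsrc b i
      have hd : inputConfig src b (dst i) = false :=
        inputConfig_of_notMem b fun ⟨j, hj⟩ => hi j hj.symm
      refine eq_inputConfig hinj' (fun j => ?_) fun w hw => ?_
      · by_cases hj : j = i
        · subst hj
          simp [hsrc', cnotConfig, hi, hb, hd]
        · rw [hsrc', Function.update_of_ne hj]
          simp only [cnotConfig]
          rw [Function.update_of_ne (fun h => hj (hsrc h)), Function.update_of_ne (hi j).symm,
            inputConfig_apply hsrc]
      · have hw1 : w ≠ dst i := fun h => hw ⟨i, by simp [hsrc', h]⟩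
        by_cases hw2 : w = src i
        · subst hw2
          simp [cnotConfig, (hi i).symm, hb, hd]
        · simp only [cnotConfig]
          rw [Function.update_of_ne hw2, Function.update_of_ne hw1]
          refine inputConfig_of_notMem b ?_
          rintro ⟨j, rfl⟩
          have hj : j ≠ i := fun h => hw2 (by rw [h])
          exact hw ⟨j, by rw [hsrc', Function.update_of_ne hj]⟩
    have e1 : moveGates src dst (i :: l) = .cnot (src i) (dst i) :: .cnot (dst i) (src i) ::
        moveGates src' dst l := by
      simp only [moveGates, List.flatMap_cons, List.cons_append, List.nil_append, List.cons.injEq,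
        true_and]
      refine List.flatMap_congr fun j hj => ?_
      have : j ≠ i := fun h => hil (h ▸ hj)
      rw [hsrc', Function.update_of_ne this]
    rw [e1, pull_cnot (hi i).symm, pull_cnot (hi i), step, step, ih hl' hinj']
    · have e2 : (fun j => if j ∈ l then dst j else src' j) =
          fun j => if j ∈ i :: l then dst j else src j := by
        funext j
        by_cases hj : j = i
        · subst hj; simp [hil, hsrc']
        · simp [hj, hsrc']
      rw [e2]
    · exact fun j hj k hk => hdst j (by simp [hj]) k (by simp [hk])
    · intro j hj k
      by_cases hk : k = i
      · subst hk
        rw [hsrc', Function.update_self]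
        intro h
        exact hil (hdst j (by simp [hj]) k (by simp) h ▸ hj)
      · rw [hsrc', Function.update_of_ne hk]
        exact hdisj j (by simp [hj]) k

/-- Qubits outside `l` must already be in place. This allows moving only the idle part of a joint
register. -/
theorem circuitChannel_moveGates {ι W : Type} [DecidableEq W] [Fintype ι] [DecidableEq ι]
    (l : List ι) (hl : l.Nodup) {src dst : ι → W} (hsrc : Function.Injective src)
    (hdst : Function.Injective dst) (hdisj : ∀ i ∈ l, ∀ j, dst i ≠ src j)
    (hrest : ∀ i, i ∉ l → dst i = src i) (ρ : Op ι) :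
    circuitChannel (moveGates src dst l) src dst ρ = ρ := by
  ext y y'
  have e : (fun i => if i ∈ l then dst i else src i) = dst := by
    funext i
    split_ifs with h
    · rfl
    · exact (hrest i h).symm
  rw [circuitChannel_apply _ hsrc]
  simp only [pull_moveGates _ _ _ l hl hsrc (fun i _ j _ h => hdst h) hdisj, e]
  have hk : ∀ b b', selectKernel dst y y' (inputConfig dst b) (inputConfig dst b') =
      if y = b ∧ y' = b' then 1 else 0 := by
    intro b b'
    rw [selectKernel_eq]
    · have h : ∀ b, inputConfig dst b ∘ dst = b := fun b => funext (inputConfig_apply hdst b)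
      rw [h, h]
    · intro w hw
      rw [inputConfig_of_notMem _ hw, inputConfig_of_notMem _ hw]
  simp only [hk]
  rw [Finset.sum_eq_single y, Finset.sum_eq_single y']
  · simp
  · intro b' _ h; simp [Ne.symm h]
  · simp
  · intro b _ h; simp [Ne.symm h]
  · simp

/-- The gates that copy the qubits `i ∈ l` in the computational basis. -/
def copyGates {ι W : Type} (src dst : ι → W) (l : List ι) : List (Gate W) :=
  l.map fun i => .cnot (src i) (dst i)

/-- Arbitrary initial contents `d`, `d'` of the copies are needed for the induction, because the
gates already processed have filled in some of them. -/
theorem pull_copyGates {ι W : Type} [DecidableEq W] [DecidableEq ι]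
    (Q : (W → Bool) → (W → Bool) → ℂ) {src dst : ι → W} (hsd : Function.Injective (Sum.elim src dst))
    (b b' : ι → Bool) (l : List ι) (hl : l.Nodup) :
    ∀ d d' : ι → Bool, pull (copyGates src dst l) Q
        (inputConfig (Sum.elim src dst) (Sum.elim b d))
        (inputConfig (Sum.elim src dst) (Sum.elim b' d')) =
      Q (inputConfig (Sum.elim src dst) (Sum.elim b fun i => if i ∈ l then xor (d i) (b i) else d i))
        (inputConfig (Sum.elim src dst)
          (Sum.elim b' fun i => if i ∈ l then xor (d' i) (b' i) else d' i)) := by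
  induction l with
  | nil => intro d d'; simp [copyGates, pull]
  | cons i l ih =>
    intro d d'
    obtain ⟨hil, hl'⟩ := List.nodup_cons.mp hl
    have hne : src i ≠ dst i := fun h => by simpa using @hsd (Sum.inl i) (Sum.inr i) h
    have step : ∀ b d : ι → Bool, cnotConfig (src i) (dst i)
        (inputConfig (Sum.elim src dst) (Sum.elim b d)) = inputConfig (Sum.elim src dst)
          (Sum.elim b (Function.update d i (xor (d i) (b i)))) := by
      intro b d
      have h1 := inputConfig_apply hsd (Sum.elim b d) (Sum.inl i)
      have h2 := inputConfig_apply hsd (Sum.elim b d) (Sum.inr i)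
      simp only [Sum.elim_inl, Sum.elim_inr] at h1 h2
      refine eq_inputConfig hsd (fun j => ?_) fun w hw => ?_
      · simp only [cnotConfig, h1, h2]
        by_cases hj : j = Sum.inr i
        · subst hj; simp
        · rw [show dst i = Sum.elim src dst (Sum.inr i) from rfl,
            Function.update_of_ne (fun h => hj (hsd h)), inputConfig_apply hsd]
          rcases j with j | j
          · rfl
          · have : j ≠ i := fun h => hj (by rw [h])
            simp [this]
      · simp only [cnotConfig]
        rw [Function.update_of_ne, inputConfig_of_notMem _ hw]
        rintro rfl
        exact hw ⟨Sum.inr i, rfl⟩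
    have e : ∀ b d : ι → Bool, (fun j => if j ∈ l then
        xor (Function.update d i (xor (d i) (b i)) j) (b j) else
          Function.update d i (xor (d i) (b i)) j) =
        fun j => if j ∈ i :: l then xor (d j) (b j) else d j := by
      intro b d
      funext j
      by_cases hj : j = i
      · subst hj; simp [hil]
      · simp [hj]
    rw [copyGates, List.map_cons, pull_cnot hne, step, step]
    exact (ih hl' _ _).trans (by rw [e, e])

/-- Measurement of all qubits in the computational basis. -/
def dephase {ι : Type} [DecidableEq ι] [Fintype ι] (ρ : Op ι) : Op ι := Matrix.diagonal fun b => ρ b b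

/-- Copying a register in the computational basis and discarding the original measures it. -/
theorem circuitChannel_copyGates {ι W : Type} [DecidableEq W] [Fintype ι] [DecidableEq ι]
    (l : List ι) (hl : l.Nodup) (hmem : ∀ i, i ∈ l) {src dst : ι → W}
    (hsd : Function.Injective (Sum.elim src dst)) (ρ : Op ι) :
    circuitChannel (copyGates src dst l) src dst ρ = dephase ρ := by
  have hsrc : Function.Injective src := fun i j h => Sum.inl_injective (@hsd (.inl i) (.inl j) h)
  have h0 : ∀ b, inputConfig src b = inputConfig (Sum.elim src dst) (Sum.elim b fun _ => false) := by
    intro b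
    symm
    refine eq_inputConfig hsrc (fun i => inputConfig_apply hsd _ (Sum.inl i)) fun w hw => ?_
    by_cases hd : w ∈ Set.range dst
    · obtain ⟨i, rfl⟩ := hd
      exact inputConfig_apply hsd _ (Sum.inr i)
    · refine inputConfig_of_notMem _ ?_
      rintro ⟨i | i, h⟩
      · exact hw ⟨i, h⟩
      · exact hd ⟨i, h⟩
  ext y y'
  rw [circuitChannel_apply _ hsrc]
  have hk : ∀ b b', pull (copyGates src dst l) (selectKernel dst y y') (inputConfig src b)
      (inputConfig src b') = if y = b ∧ y' = b' ∧ y = y' then 1 else 0 := by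
    intro b b'
    rw [h0, h0, pull_copyGates _ hsd _ _ l hl]
    refine selectKernel_eq_ite ?_
    have c : ∀ (b : ι → Bool) j, inputConfig (Sum.elim src dst)
        (Sum.elim b fun i => if i ∈ l then xor false (b i) else false) (dst j) = b j := by
      intro b j
      refine (inputConfig_apply hsd _ (Sum.inr j)).trans ?_
      simp [hmem]
    have c' : ∀ (b : ι → Bool) j, inputConfig (Sum.elim src dst)
        (Sum.elim b fun i => if i ∈ l then xor false (b i) else false) (src j) = b j :=
      fun b j => inputConfig_apply hsd _ (Sum.inl j)
    simp only [c]
    constructor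
    · rintro ⟨h1, h2, h3⟩
      have hy : y = b := funext fun j => (h1 j).symm
      have hy' : y' = b' := funext fun j => (h2 j).symm
      refine ⟨hy, hy', hy.trans (Eq.trans ?_ hy'.symm)⟩
      funext j
      -- The originals are traced out while still carrying `b` and `b'`; this is what forces the
      -- outcome to be diagonal.
      have := h3 (src j) (by rintro ⟨i, hi⟩; simpa using @hsd (.inl j) (.inr i) hi.symm)
      rwa [c', c'] at this
    · rintro ⟨rfl, rfl, rfl⟩
      exact ⟨fun _ => rfl, fun _ => rfl, fun _ _ => rfl⟩
  simp only [hk, dephase, Matrix.diagonal_apply]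
  rw [Finset.sum_eq_single y, Finset.sum_eq_single y']
  · by_cases h : y = y'
    · subst h; simp
    · simp [h]
  · intro b' _ h; simp [Ne.symm h]
  · simp
  · intro b _ h; simp [Ne.symm h]
  · simp

/-! ### Channels -/

/-- Channels given by Kraus operators with an arbitrary finite index set. -/
theorem isCPTP_of_kraus {ι κ J : Type} [Fintype ι] [DecidableEq ι] [Fintype κ] [DecidableEq κ]
    [Fintype J] (K : J → Matrix (κ → Bool) (ι → Bool) ℂ) {Φ : Op ι → Op κ}
    (h : ∀ ρ, Φ ρ = ∑ j, K j * ρ * (K j).conjTranspose)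
    (h1 : ∑ j, (K j).conjTranspose * K j = 1) : IsCPTP Φ := by
  refine ⟨Fintype.card J, fun i => K ((Fintype.equivFin J).symm i), fun ρ => ?_, ?_⟩
  · rw [h, ← (Fintype.equivFin J).symm.sum_comp]
  · rw [← h1, ← (Fintype.equivFin J).symm.sum_comp]

theorem IsCPTP.comp {ι κ μ : Type} [Fintype ι] [DecidableEq ι] [Fintype κ] [DecidableEq κ]
    [Fintype μ] [DecidableEq μ] {Φ : Op ι → Op κ} {Ψ : Op κ → Op μ} (hΨ : IsCPTP Ψ)
    (hΦ : IsCPTP Φ) : IsCPTP fun ρ => Ψ (Φ ρ) := by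
  obtain ⟨r, K, hK, hK1⟩ := hΦ
  obtain ⟨s, L, hL, hL1⟩ := hΨ
  refine isCPTP_of_kraus (fun p : Fin s × Fin r => L p.1 * K p.2) (fun ρ => ?_) ?_
  · rw [hL, hK, Fintype.sum_prod_type]
    refine Finset.sum_congr rfl fun i _ => ?_
    rw [Matrix.mul_sum, Matrix.sum_mul]
    refine Finset.sum_congr rfl fun j _ => ?_
    simp only [Matrix.conjTranspose_mul, Matrix.mul_assoc]
  · rw [Fintype.sum_prod_type, Finset.sum_comm, ← hK1]
    refine Finset.sum_congr rfl fun j _ => ?_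
    have e : ∀ i, (L i * K j).conjTranspose * (L i * K j) =
        (K j).conjTranspose * ((L i).conjTranspose * L i) * K j := fun i => by
      simp only [Matrix.conjTranspose_mul, Matrix.mul_assoc]
    simp only [e]
    rw [← Matrix.sum_mul, ← Matrix.mul_sum, hL1, Matrix.mul_one]

open scoped ComplexOrder in
theorem IsCPTP.isDensity {ι κ : Type} [Fintype ι] [DecidableEq ι] [Fintype κ] [DecidableEq κ]
    {Φ : Op ι → Op κ} (hΦ : IsCPTP Φ) {ρ : Op ι} (hρ : IsDensity ρ) : IsDensity (Φ ρ) := by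
  obtain ⟨r, K, hK, hK1⟩ := hΦ
  refine ⟨?_, ?_⟩
  · rw [hK]
    exact Matrix.posSemidef_sum _ fun j _ => hρ.1.mul_mul_conjTranspose_same (K j)
  · rw [hK, Matrix.trace_sum]
    have e : ∀ j, (K j * ρ * (K j).conjTranspose).trace =
        (((K j).conjTranspose * K j) * ρ).trace := fun j => by
      rw [Matrix.trace_mul_comm, ← Matrix.mul_assoc]
    simp only [e]
    rw [← Matrix.trace_sum, ← Matrix.sum_mul, hK1, one_mul, hρ.2]

/-- The operator `M ⊗ 1`. -/
def onFirstMatrix {ι κ : Type} (K : Type) [DecidableEq K] [Fintype K]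
    (M : Matrix (κ → Bool) (ι → Bool) ℂ) :
    Matrix (κ ⊕ K → Bool) (ι ⊕ K → Bool) ℂ :=
  Matrix.of fun x y => if x ∘ Sum.inr = y ∘ Sum.inr then M (x ∘ Sum.inl) (y ∘ Sum.inl) else 0

theorem sum_sumArrow {ι K : Type} [Fintype ι] [DecidableEq ι] [Fintype K] [DecidableEq K]
    {M : Type} [AddCommMonoid M] (f : (ι ⊕ K → Bool) → M) :
    ∑ b, f b = ∑ b₁ : ι → Bool, ∑ b₂ : K → Bool, f (Sum.elim b₁ b₂) := by
  rw [← (Equiv.sumArrowEquivProdArrow ι K Bool).symm.sum_comp, Fintype.sum_prod_type]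
  rfl

theorem onFirst_kraus {ι κ : Type} (K : Type) [Fintype ι] [DecidableEq ι] [Fintype κ]
    [DecidableEq κ] [Fintype K] [DecidableEq K] (M : Matrix (κ → Bool) (ι → Bool) ℂ)
    (σ : Op (ι ⊕ K)) :
    onFirstMatrix K M * σ * (onFirstMatrix K M).conjTranspose =
      onFirst K (fun ρ => M * ρ * M.conjTranspose) σ := by
  ext x y
  simp only [Matrix.mul_apply, onFirst, Matrix.of_apply, Matrix.conjTranspose_apply, onFirstMatrix,
    sum_sumArrow]
  refine Finset.sum_congr rfl fun b _ => ?_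
  rw [Finset.sum_eq_single (y ∘ Sum.inr)]
  · congr 1
    · refine Finset.sum_congr rfl fun b' _ => ?_
      rw [Finset.sum_eq_single (x ∘ Sum.inr)]
      · simp
      · intro c _ h; simp [Ne.symm h]
      · simp
    · simp
  · intro c _ h; simp [Ne.symm h]
  · simp

theorem onFirstMatrix_mul {ι κ μ : Type} (K : Type) [Fintype ι] [DecidableEq ι] [Fintype κ]
    [DecidableEq κ] [Fintype K] [DecidableEq K] (M : Matrix (κ → Bool) (ι → Bool) ℂ)
    (L : Matrix (μ → Bool) (κ → Bool) ℂ) :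
    onFirstMatrix K L * onFirstMatrix K M = onFirstMatrix K (L * M) := by
  ext x y
  simp only [Matrix.mul_apply, Matrix.of_apply, onFirstMatrix, sum_sumArrow]
  rw [Finset.sum_comm, Finset.sum_eq_single (x ∘ Sum.inr)]
  · by_cases h : x ∘ Sum.inr = y ∘ Sum.inr <;> simp [h]
  · intro c _ h; simp [Ne.symm h]
  · simp

theorem onFirstMatrix_conjTranspose {ι κ : Type} (K : Type) [Fintype K] [DecidableEq K]
    (M : Matrix (κ → Bool) (ι → Bool) ℂ) :
    (onFirstMatrix K M).conjTranspose = onFirstMatrix K M.conjTranspose := by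
  ext x y
  simp only [Matrix.conjTranspose_apply, onFirstMatrix, Matrix.of_apply, eq_comm (a := y ∘ Sum.inr)]
  split_ifs <;> simp

theorem onFirstMatrix_one {ι : Type} (K : Type) [Fintype ι] [DecidableEq ι] [Fintype K]
    [DecidableEq K] : onFirstMatrix K (1 : Op ι) = 1 := by
  ext x y
  simp only [onFirstMatrix, Matrix.of_apply, Matrix.one_apply, ← ite_and]
  refine if_congr ?_ rfl rfl
  constructor
  · rintro ⟨h1, h2⟩
    funext i
    rcases i with i | i
    · exact congrFun h2 i
    · exact congrFun h1 i
  · rintro rfl; exact ⟨rfl, rfl⟩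

theorem onFirstMatrix_sum {ι κ J : Type} (K : Type) [Fintype K] [DecidableEq K] (s : Finset J)
    (M : J → Matrix (κ → Bool) (ι → Bool) ℂ) :
    onFirstMatrix K (∑ j ∈ s, M j) = ∑ j ∈ s, onFirstMatrix K (M j) := by
  ext x y
  simp only [onFirstMatrix, Matrix.of_apply, Matrix.sum_apply]
  split_ifs <;> simp

theorem IsCPTP.onFirst {ι κ : Type} (K : Type) [Fintype ι] [DecidableEq ι] [Fintype κ]
    [DecidableEq κ] [Fintype K] [DecidableEq K] {Φ : Op ι → Op κ} (hΦ : IsCPTP Φ) :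
    IsCPTP (onFirst K Φ) := by
  obtain ⟨r, M, hM, hM1⟩ := hΦ
  refine ⟨r, fun j => onFirstMatrix K (M j), fun σ => ?_, ?_⟩
  · simp only [onFirst_kraus]
    ext x y
    simp only [_root_.onFirst, Matrix.of_apply, hM, Matrix.sum_apply]
  · simp only [onFirstMatrix_conjTranspose, onFirstMatrix_mul, ← onFirstMatrix_sum, hM1,
      onFirstMatrix_one]

theorem isCPTP_relabel {ι κ : Type} [Fintype ι] [DecidableEq ι] [Fintype κ] [DecidableEq κ]
    (e : κ ≃ ι) : IsCPTP (relabel e) := by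
  refine isCPTP_of_kraus (J := Unit)
    (fun _ => Matrix.of fun x y => if y = x ∘ e.symm then 1 else 0) (fun ρ => ?_) ?_
  · ext x y
    simp [Matrix.mul_apply, relabel_apply]
  · ext x y
    have h : ∀ b : κ → Bool, x = b ∘ e.symm ↔ b = x ∘ e := fun b =>
      ⟨fun h => by rw [h]; funext; simp, fun h => by rw [h]; funext; simp⟩
    have h' : y = (x ∘ e) ∘ e.symm ↔ x = y := by
      have : (x ∘ e) ∘ e.symm = x := by funext; simp
      rw [this, eq_comm]
    simp only [Finset.univ_unique, Finset.sum_singleton, Matrix.mul_apply,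
      Matrix.conjTranspose_apply, Matrix.of_apply, h, Matrix.one_apply]
    rw [Finset.sum_eq_single (x ∘ e)]
    · simp [h']
    · intro b _ hb; simp [hb]
    · simp

/-! ### Circuits compute channels -/

theorem Gate.sum_star_mat_mul_mat {W : Type} (g : Gate W) (y : W → Bool) (s s' : Bool) :
    ∑ t, star (g.mat y t s) * g.mat y t s' = if s = s' then 1 else 0 := by
  have h2 : ((Real.sqrt 2 : ℝ) : ℂ)⁻¹ * ((Real.sqrt 2 : ℝ) : ℂ)⁻¹ = 1 / 2 := by
    rw [← mul_inv, ← Complex.ofReal_mul, Real.mul_self_sqrt (by norm_num)]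
    norm_num
  have hH : ∀ s s', ∑ t, star (hadEntry t s) * hadEntry t s' = if s = s' then 1 else 0 := by
    intro s s'
    cases s <;> cases s' <;> (simp [hadEntry, h2]; try norm_num)
  have hN : ∀ s s', ∑ t, star (notEntry t s) * notEntry t s' = if s = s' then 1 else 0 := by
    intro s s'
    cases s <;> cases s' <;> simp [notEntry]
  have h1 : ∀ s s' : Bool, ∑ t : Bool, star ((if t = s then 1 else 0 : ℂ)) *
      (if t = s' then 1 else 0) = if s = s' then 1 else 0 := by
    intro s s'
    cases s <;> cases s' <;> simp
  cases g with
  | had w => exact hH s s'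
  | tee w =>
    have e : (starRingEnd ℂ) (Complex.exp (Complex.I * (Real.pi / 4 : ℝ))) *
        Complex.exp (Complex.I * (Real.pi / 4 : ℝ)) = 1 := by
      rw [← Complex.exp_conj, ← Complex.exp_add, map_mul, Complex.conj_I, Complex.conj_ofReal,
        neg_mul, neg_add_cancel, Complex.exp_zero]
    cases s <;> cases s' <;> simp [Gate.mat, teeEntry]
    simpa using e
  | cnot c t =>
    by_cases h : c ≠ t ∧ y c = true
    · rw [show (Gate.cnot c t).mat y = notEntry from if_pos h]
      exact hN s s'
    · rw [show (Gate.cnot c t).mat y = fun s s' => if s = s' then 1 else 0 from if_neg h]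
      exact h1 s s'
  | chad c t =>
    by_cases h : c ≠ t ∧ y c = true
    · rw [show (Gate.chad c t).mat y = hadEntry from if_pos h]
      exact hH s s'
    · rw [show (Gate.chad c t).mat y = fun s s' => if s = s' then 1 else 0 from if_neg h]
      exact h1 s s'

/-- Columns whose configurations differ off the target have disjoint supports. Columns that agree
there are governed by the same one-qubit matrix, by `Gate.mat_update`, and its columns are
orthonormal. -/
theorem gateMatrix_conjTranspose_mul_self {W : Type} [DecidableEq W] {F : Finset W} (g : Gate W)
    (ht : g.target ∈ F) : (gateMatrix F g).conjTranspose * gateMatrix F g = 1 := by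
  ext x y
  rw [Matrix.mul_apply]
  simp only [Matrix.conjTranspose_apply]
  simp_rw [mul_comm (star _)]
  rw [sum_gateMatrix g ht]
  classical
  have e : ∀ s, gateMatrix F g (Function.update y ⟨g.target, ht⟩ s) x =
      if ∀ v, v ≠ g.target → extendZero F y v = extendZero F x v then
        g.mat (extendZero F x) s (extendZero F x g.target) else 0 := by
    intro s
    simp only [gateMatrix, Matrix.of_apply, extendZero_update, Gate.entry_eq, Function.update_self]
    congr 1
    refine propext (forall_congr' fun v => imp_congr_right fun hv => ?_)
    rw [Function.update_of_ne hv]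
  simp only [e]
  by_cases h : ∀ v, v ≠ g.target → extendZero F y v = extendZero F x v
  · simp only [if_pos h]
    have hm : g.mat (extendZero F y) = g.mat (extendZero F x) := by
      have : extendZero F y = Function.update (extendZero F x) g.target
          (extendZero F y g.target) := by
        funext v
        by_cases hv : v = g.target
        · subst hv; simp
        · rw [Function.update_of_ne hv, h v hv]
      rw [this, Gate.mat_update]
    simp_rw [hm, mul_comm (g.mat _ _ _)]
    rw [Gate.sum_star_mat_mul_mat, Matrix.one_apply]
    refine if_congr ?_ rfl rfl
    rw [← (extendZero_injective F).eq_iff]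
    constructor
    · intro h'
      funext v
      by_cases hv : v = g.target
      · rw [hv, h']
      · exact (h v hv).symm
    · intro h'; rw [h']
  · have hxy : x ≠ y := by rintro rfl; exact h fun _ _ => rfl
    simp [h, hxy]

theorem circuitUnitary_conjTranspose_mul_self {W : Type} [DecidableEq W] {F : Finset W}
    (G : List (Gate W)) (hG : ∀ g ∈ G, ∀ w ∈ g.wires, w ∈ F) :
    (circuitUnitary F G).conjTranspose * circuitUnitary F G = 1 := by
  induction G with
  | nil => simp [circuitUnitary_nil]
  | cons g G ih =>
    rw [circuitUnitary_cons, Matrix.conjTranspose_mul, Matrix.mul_assoc,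
      ← Matrix.mul_assoc (circuitUnitary F G).conjTranspose, ih fun g hg => hG g (by simp [hg]),
      one_mul, gateMatrix_conjTranspose_mul_self g (hG g (by simp) _ g.target_mem_wires)]

/-- There is one Kraus operator for each content `g` of the discarded wires. Completeness holds
because a configuration is determined by its outputs together with `g`, and for this `out` need not
be injective. -/
theorem isCPTP_traceOut {W κ : Type} [DecidableEq W] [Fintype κ] [DecidableEq κ] (F : Finset W)
    (out : κ → W) : IsCPTP (traceOut F out) := by
  classical
  let J := {w : F // w.1 ∉ Set.range out}
  have hJ : ∀ x x' : F → Bool, (∀ w, w ∉ Set.range out → extendZero F x w = extendZero F x' w) ↔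
      (fun w : J => x w.1) = fun w : J => x' w.1 := by
    intro x x'
    constructor
    · intro h
      funext w
      have := h w.1.1 w.2
      rwa [extendZero_of_mem _ w.1.2, extendZero_of_mem _ w.1.2] at this
    · intro h w hw
      by_cases hF : w ∈ F
      · rw [extendZero_of_mem _ hF, extendZero_of_mem _ hF]
        exact congrFun h ⟨⟨w, hF⟩, hw⟩
      · simp [extendZero, hF]
  have hsel : ∀ y y' (x x' : F → Bool), selectKernel out y y' (extendZero F x) (extendZero F x') =
      ∑ g : J → Bool, (if y = extendZero F x ∘ out ∧ g = fun w : J => x w.1 then 1 else 0) *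
        (if y' = extendZero F x' ∘ out ∧ g = fun w : J => x' w.1 then 1 else 0) := by
    intro y y' x x'
    rw [Finset.sum_eq_single fun w : J => x w.1]
    · rw [ite_zero_mul_ite_zero, one_mul]
      refine selectKernel_eq_ite ?_
      rw [hJ]
      simp only [funext_iff (f := y), funext_iff (f := y'), Function.comp_apply, and_true,
        eq_comm (a := y _), eq_comm (a := y' _)]
    · intro g _ hg
      simp [hg]
    · simp
  refine isCPTP_of_kraus (J := J → Bool) (fun g => Matrix.of fun y x =>
    if y = extendZero F x ∘ out ∧ g = fun w : J => x w.1 then 1 else 0) (fun ρ => ?_) ?_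
  · ext y y'
    rw [traceOut_apply, Matrix.sum_apply]
    simp only [hsel, Matrix.mul_apply, Matrix.conjTranspose_apply, Matrix.of_apply, Finset.mul_sum,
      Finset.sum_mul]
    symm
    rw [Finset.sum_comm]
    simp_rw [Finset.sum_comm (s := (Finset.univ : Finset (J → Bool)))]
    rw [Finset.sum_comm]
    refine Finset.sum_congr rfl fun x _ => Finset.sum_congr rfl fun x' _ =>
      Finset.sum_congr rfl fun g _ => ?_
    split_ifs <;> simp
  · ext x x'
    rw [Matrix.sum_apply]
    simp only [Matrix.mul_apply, Matrix.conjTranspose_apply, Matrix.of_apply]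
    have e : ∀ (g : J → Bool) (y : κ → Bool),
        star (if y = extendZero F x ∘ out ∧ g = fun w : J => x w.1 then 1 else 0 : ℂ) *
        (if y = extendZero F x' ∘ out ∧ g = fun w : J => x' w.1 then 1 else 0) =
        if g = fun w : J => x w.1 then (if y = extendZero F x ∘ out then
          (if x = x' then 1 else 0) else 0) else 0 := by
      intro g y
      by_cases h1 : g = fun w : J => x w.1
      · by_cases h2 : y = extendZero F x ∘ out
        · by_cases h3 : x = x'
          · subst h3; simp [h1, h2]
          · rw [if_neg (c := y = extendZero F x' ∘ out ∧ _), if_pos h1, if_pos h2, if_neg h3,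
              mul_zero]
            rintro ⟨a1, a2⟩
            apply h3
            funext w
            by_cases hw : w.1 ∈ Set.range out
            · obtain ⟨j, hj⟩ := hw
              have := congrFun (h2.symm.trans a1) j
              simp only [Function.comp_apply, hj] at this
              rwa [extendZero_of_mem _ w.2, extendZero_of_mem _ w.2] at this
            · exact congrFun (h1.symm.trans a2) ⟨w, hw⟩
        · simp [h2]
      · simp [h1]
    simp only [e]
    rw [Finset.sum_eq_single fun w : J => x w.1, Finset.sum_eq_single (extendZero F x ∘ out)]
    · simp [Matrix.one_apply]
    · intro y _ hy; simp [hy]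
    · simp
    · intro g _ hg; simp [hg]
    · simp

theorem isCPTP_circuitChannel {W ι κ : Type} [DecidableEq W] [Fintype ι] [DecidableEq ι]
    [Fintype κ] [DecidableEq κ] (G : List (Gate W)) {inp : ι → W} (hinp : Function.Injective inp)
    (out : κ → W) : IsCPTP (circuitChannel G inp out) := by
  refine (isCPTP_traceOut _ out).comp
    (isCPTP_of_kraus (J := Unit) (fun _ => _) (fun ρ => by
      rw [Finset.univ_unique, Finset.sum_singleton]) ?_)
  rw [Finset.univ_unique, Finset.sum_singleton, Matrix.conjTranspose_mul, Matrix.mul_assoc,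
    ← Matrix.mul_assoc (circuitUnitary _ G).conjTranspose,
    circuitUnitary_conjTranspose_mul_self _ fun _ hg _ => mem_circuitWires_of_gate hg,
    Matrix.one_mul]
  ext b b'
  simp only [Matrix.mul_apply, Matrix.conjTranspose_apply,
    inputIsometry_apply hinp (inp_mem_circuitWires G inp out), Matrix.one_apply]
  rw [Finset.sum_eq_single fun w => inputConfig inp b w.1]
  · have : ((fun w : circuitWires G inp out => inputConfig inp b w.1) =
        fun w => inputConfig inp b' w.1) ↔ b = b' := by
      constructor
      · intro h
        funext i
        have := congrFun h ⟨inp i, inp_mem_circuitWires G inp out i⟩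
        simpa only [inputConfig_apply hinp] using this
      · rintro rfl; rfl
    simp [this]
  · intro x _ hx
    simp [hx]
  · simp

/-! ### Programs -/

/-- Renaming the stacks of a program by `r` and the wire names that it emits by `f`. -/
def Prog.relocate (r : ℕ → ℕ) (f : List ℕ → List ℕ) : Prog → Prog
  | .skip => .skip
  | .push b v => .push b (r v)
  | .pop v => .pop (r v)
  | .emit g => .emit (g.map fun a => (f a.1, a.2.map r))
  | .seq p q => .seq (p.relocate r f) (q.relocate r f)
  | .ifTop v p q => .ifTop (r v) (p.relocate r f) (q.relocate r f)
  | .whileNonempty v p => .whileNonempty (r v) (p.relocate r f)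

theorem Exec.congr {p : Prog} {s s' s'' : ℕ → List Bool} {G G' : List (Gate Wire)} {t t' : ℕ}
    (h : Exec p s s' G t) (hs : s' = s'') (hG : G = G') (ht : t = t') : Exec p s s'' G' t' :=
  hs ▸ hG ▸ ht ▸ h

/-- The program that emits nothing and otherwise does the same. -/
def Prog.mute : Prog → Prog
  | .emit _ => .skip
  | .seq p q => .seq p.mute q.mute
  | .ifTop v p q => .ifTop v p.mute q.mute
  | .whileNonempty v p => .whileNonempty v p.mute
  | p => p

/-- Control flow never depends on the circuit written so far. This is used to compute a length
without leaving gates behind. -/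
theorem Exec.mute {p : Prog} {s s' : ℕ → List Bool} {G : List (Gate Wire)} {t : ℕ}
    (h : Exec p s s' G t) : Exec p.mute s s' [] t := by
  induction h with
  | skip s => exact .skip s
  | push b v s => exact .push b v s
  | pop v s => exact .pop v s
  | emit g s => exact .skip s
  | seq _ _ ih₁ ih₂ => exact .seq ih₁ ih₂
  | ifTrue h _ ih => exact .ifTrue h ih
  | ifFalse h _ ih => exact .ifFalse h ih
  | whileStop h => exact .whileStop h
  | whileStep h _ _ ih₁ ih₂ => exact .whileStep h ih₁ ih₂

/-- Renaming the register names of wires. -/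
def renameWire (f : List ℕ → List ℕ) (w : Wire) : Wire := (f w.1, w.2)

/-- An injective renaming makes the stacks in its range a faithful copy of the memory, and the run
cannot see or alter any other stack. Programs can therefore be placed side by side in one memory. -/
theorem Exec.relocate {r : ℕ → ℕ} (hr : Function.Injective r) (f : List ℕ → List ℕ) {p : Prog}
    {s s' : ℕ → List Bool} {G : List (Gate Wire)} {t : ℕ} (h : Exec p s s' G t) :
    ∀ S : ℕ → List Bool, S ∘ r = s → ∃ S', S' ∘ r = s' ∧ (∀ v, v ∉ Set.range r → S' v = S v) ∧
      Exec (p.relocate r f) S S' (G.map (Gate.map (renameWire f))) t := by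
  have hup : ∀ (S : ℕ → List Bool) (v : ℕ) (a : List Bool),
      Function.update S (r v) a ∘ r = Function.update (S ∘ r) v a ∧
      ∀ w, w ∉ Set.range r → Function.update S (r v) a w = S w := by
    intro S v a
    refine ⟨Function.update_comp_eq_of_injective S hr v a, fun w hw => ?_⟩
    exact Function.update_of_ne (fun h => hw ⟨v, h.symm⟩) _ _
  induction h with
  | skip s => exact fun S hS => ⟨S, hS, fun _ _ => rfl, .skip S⟩
  | push b v s =>
    rintro S rfl
    exact ⟨_, (hup S v _).1, (hup S v _).2, .push b (r v) S⟩
  | pop v s =>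
    rintro S rfl
    exact ⟨_, (hup S v _).1, (hup S v _).2, .pop (r v) S⟩
  | emit g s =>
    rintro S rfl
    refine ⟨S, rfl, fun _ _ => rfl, ?_⟩
    have := Exec.emit (g.map fun a => (f a.1, a.2.map r)) S
    rw [Gate.map_map] at this
    simp only [List.map_cons, List.map_nil, Gate.map_map]
    have e : (renameWire f ∘ resolve (S ∘ r)) =
        resolve S ∘ fun a : List ℕ × List ℕ => (f a.1, a.2.map r) := by
      funext a
      simp [renameWire, resolve]
    rw [e]
    exact this
  | seq _ _ ih₁ ih₂ =>
    intro S hS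
    obtain ⟨S₁, h1, h2, h3⟩ := ih₁ S hS
    obtain ⟨S₂, h4, h5, h6⟩ := ih₂ S₁ h1
    refine ⟨S₂, h4, fun v hv => (h5 v hv).trans (h2 v hv), ?_⟩
    rw [List.map_append]
    exact .seq h3 h6
  | ifTrue h _ ih =>
    rintro S rfl
    obtain ⟨S₁, h1, h2, h3⟩ := ih S rfl
    exact ⟨S₁, h1, h2, .ifTrue h h3⟩
  | ifFalse h _ ih =>
    rintro S rfl
    obtain ⟨S₁, h1, h2, h3⟩ := ih S rfl
    exact ⟨S₁, h1, h2, .ifFalse h h3⟩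
  | whileStop h =>
    rintro S rfl
    exact ⟨S, rfl, fun _ _ => rfl, .whileStop h⟩
  | whileStep h _ _ ih₁ ih₂ =>
    rintro S rfl
    obtain ⟨S₁, h1, h2, h3⟩ := ih₁ S rfl
    obtain ⟨S₂, h4, h5, h6⟩ := ih₂ S₁ h1
    refine ⟨S₂, h4, fun v hv => (h5 v hv).trans (h2 v hv), ?_⟩
    rw [List.map_append]
    exact .whileStep h h3 h6

/-- Each step emits at most one gate and raises a stack by at most one, so running time bounds both
the circuit size and every computed length. -/
theorem Exec.length_le {p : Prog} {s s' : ℕ → List Bool} {G : List (Gate Wire)} {t : ℕ}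
    (h : Exec p s s' G t) : G.length ≤ t ∧ ∀ v, (s' v).length ≤ (s v).length + t := by
  induction h with
  | skip s => simp
  | push b v s =>
    refine ⟨by simp, fun w => ?_⟩
    by_cases hw : w = v
    · subst hw; simp
    · simp [Function.update_of_ne hw]
  | pop v s =>
    refine ⟨by simp, fun w => ?_⟩
    by_cases hw : w = v
    · subst hw; simp; omega
    · simp [Function.update_of_ne hw]
  | emit g s => simp
  | seq _ _ ih₁ ih₂ =>
    refine ⟨by simpa using Nat.add_le_add ih₁.1 ih₂.1, fun v => ?_⟩
    have := ih₁.2 v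
    have := ih₂.2 v
    omega
  | ifTrue h _ ih => exact ⟨by omega, fun v => by have := ih.2 v; omega⟩
  | ifFalse h _ ih => exact ⟨by omega, fun v => by have := ih.2 v; omega⟩
  | whileStop h => simp
  | whileStep h _ _ ih₁ ih₂ =>
    refine ⟨?_, fun v => ?_⟩
    · rw [List.length_append]
      omega
    · have := ih₁.2 v
      have := ih₂.2 v
      omega

/-- Families of circuits that are written out in polynomial time. -/
def PolyCircuit (G : List Bool → List (Gate Wire)) : Prop :=
  ∃ (p : Prog) (b : Polynomial ℕ), ∀ x : List Bool, ∃ s t,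
    Exec p (initMem x) s (G x) t ∧ t ≤ b.eval x.length

theorem polyTime_iff {A B : Register}
    {Φ : ∀ x : List Bool, Op (A.Idx x.length) → Op (B.Idx x.length)} :
    PolyTime A B Φ ↔ ∃ G, PolyCircuit G ∧ ∀ x, Φ x = circuitChannel (G x)
      (fun i => tagWire 0 (A.label x.length i)) (fun j => tagWire 1 (B.label x.length j)) := by
  constructor
  · rintro ⟨p, b, h⟩
    choose s G t h1 h2 h3 using h
    exact ⟨G, ⟨p, b, fun x => ⟨s x, t x, h1 x, h2 x⟩⟩, h3⟩
  · rintro ⟨G, ⟨p, b, h⟩, h3⟩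
    refine ⟨p, b, fun x => ?_⟩
    obtain ⟨s, t, h1, h2⟩ := h x
    exact ⟨s, G x, t, h1, h2, h3 x⟩

theorem PolyCircuit.length_le {G : List Bool → List (Gate Wire)} (h : PolyCircuit G) :
    ∃ b : Polynomial ℕ, ∀ x, (G x).length ≤ b.eval x.length := by
  obtain ⟨p, b, h⟩ := h
  refine ⟨b, fun x => ?_⟩
  obtain ⟨s, t, h1, h2⟩ := h x
  exact h1.length_le.1.trans h2

theorem PolyTimeLength.polyBounded {f : ℕ → ℕ} (h : PolyTimeLength f) : PolyBounded f := by
  obtain ⟨p, b, h⟩ := h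
  refine ⟨b, fun n => ?_⟩
  obtain ⟨s, G, t, h1, h2, h3⟩ := h (List.replicate n true)
  rw [List.length_replicate] at h2 h3
  have := h1.length_le.2 1
  simp only [initMem, one_ne_zero, if_false, List.length_nil, zero_add] at this
  omega

theorem PolyCircuit.rename {G : List Bool → List (Gate Wire)} (h : PolyCircuit G)
    (f : List ℕ → List ℕ) : PolyCircuit fun x => (G x).map (Gate.map (renameWire f)) := by
  obtain ⟨p, b, h⟩ := h
  refine ⟨p.relocate id f, b, fun x => ?_⟩
  obtain ⟨s, t, h1, h2⟩ := h x
  obtain ⟨S', -, -, h3⟩ := h1.relocate Function.injective_id f (initMem x) rfl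
  exact ⟨S', t, h3, h2⟩

/-! ### Running two programs on the same input -/

/-- Reverse stack `0` onto stack `3`. -/
def Prog.unload : Prog :=
  .whileNonempty 0 (.seq (.ifTop 0 (.push true 3) (.push false 3)) (.pop 0))

/-- Reverse stack `3` onto the stacks `1` and `2`. -/
def Prog.reload : Prog :=
  .whileNonempty 3 (.seq (.ifTop 3 (.seq (.push true 1) (.push true 2))
    (.seq (.push false 1) (.push false 2))) (.pop 3))

theorem exec_unload (x : List Bool) : ∀ s : ℕ → List Bool, s 0 = x →
    Exec .unload s (fun v => if v = 0 then [] else if v = 3 then x.reverse ++ s 3 else s v) []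
      (4 * x.length + 1) := by
  induction x with
  | nil =>
    intro s hs
    have e : (fun v => if v = 0 then [] else if v = 3 then ([] : List Bool).reverse ++ s 3
        else s v) = s := by
      funext v
      split_ifs with h1 h2
      · rw [h1, hs]
      · rw [h2]; rfl
      · rfl
    rw [e]
    exact .whileStop hs
  | cons b x ih =>
    intro s hs
    have h1 : Exec (.ifTop 0 (.push true 3) (.push false 3)) s
        (Function.update s 3 (b :: s 3)) [] 2 := by
      cases b
      · exact .ifFalse (by simp [hs]) (.push false 3 s)
      · exact .ifTrue (by simp [hs]) (.push true 3 s)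
    have h2 := Exec.whileStep (by simp [hs]) (h1.seq (.pop 0 _)) (ih (Function.update
      (Function.update s 3 (b :: s 3)) 0 (Function.update s 3 (b :: s 3) 0).tail) (by simp [hs]))
    refine h2.congr ?_ rfl ?_
    · funext v
      by_cases h0 : v = 0
      · simp [h0]
      · by_cases h3 : v = 3
        · simp [h3]
        · simp [h0, h3]
    · simp only [List.length_cons]; ring

theorem exec_reload (x : List Bool) : ∀ s : ℕ → List Bool, s 3 = x →
    Exec .reload s (fun v => if v = 3 then [] else if v = 1 ∨ v = 2 then x.reverse ++ s v else s v)
      [] (5 * x.length + 1) := by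
  induction x with
  | nil =>
    intro s hs
    have e : (fun v => if v = 3 then [] else if v = 1 ∨ v = 2 then ([] : List Bool).reverse ++ s v
        else s v) = s := by
      funext v
      split_ifs with h1 h2
      · rw [h1, hs]
      · rfl
      · rfl
    rw [e]
    exact .whileStop hs
  | cons b x ih =>
    intro s hs
    have h1 : Exec (.ifTop 3 (.seq (.push true 1) (.push true 2))
        (.seq (.push false 1) (.push false 2))) s
        (Function.update (Function.update s 1 (b :: s 1)) 2 (b :: s 2)) [] 3 := by
      cases b
      · exact .ifFalse (by simp [hs]) (.seq (.push false 1 s) (.push false 2 _))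
      · exact .ifTrue (by simp [hs]) (.seq (.push true 1 s) (.push true 2 _))
    have h2 := Exec.whileStep (by simp [hs]) (h1.seq (.pop 3 _)) (ih _ (by simp [hs]))
    refine h2.congr ?_ rfl ?_
    · funext v
      by_cases h0 : v = 3
      · simp [h0]
      · by_cases h1 : v = 1
        · simp [h1]
        · by_cases h2 : v = 2
          · simp [h2]
          · simp [h0, h1, h2]
    · simp only [List.length_cons]; ring

/-- Running two programs one after the other, on separate memories and the same input. -/
def Prog.both (p q : Prog) : Prog :=
  .seq (.seq .unload .reload)
    (.seq (p.relocate (fun v => 2 * v + 1) id) (q.relocate (fun v => 2 * v + 2) id))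

/-- Two reversals restore the order of the input and duplicate it on the stacks `1 = 2 * 0 + 1` and
`2 = 2 * 0 + 2`, which are the input stacks of the two relocated programs. The auxiliary stack `3`
is empty again by then, as it must be, being stack `1` of the first program. The copying costs `4 *
|x| + 1` and `5 * |x| + 1` steps. -/
theorem Exec.both {p q : Prog} {x : List Bool} {s₁ s₂ : ℕ → List Bool} {G₁ G₂ : List (Gate Wire)}
    {t₁ t₂ : ℕ} (h₁ : Exec p (initMem x) s₁ G₁ t₁) (h₂ : Exec q (initMem x) s₂ G₂ t₂) :
    ∃ s, (∀ v, s (2 * v + 1) = s₁ v) ∧ (∀ v, s (2 * v + 2) = s₂ v) ∧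
      Exec (p.both q) (initMem x) s (G₁ ++ G₂) (9 * x.length + 2 + t₁ + t₂) := by
  have hu := exec_unload x (initMem x) rfl
  set s₀ : ℕ → List Bool := fun v => if v = 0 then [] else if v = 3 then
    x.reverse ++ initMem x 3 else initMem x v with hs₀
  have hl := exec_reload x.reverse s₀ (by simp [hs₀, initMem])
  set S : ℕ → List Bool := fun v => if v = 3 then [] else if v = 1 ∨ v = 2 then
    x.reverse.reverse ++ s₀ v else s₀ v with hS
  have e1 : S ∘ (fun v => 2 * v + 1) = initMem x := by
    funext v
    rcases v with _ | _ | v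
    · simp [hS, hs₀, initMem]
    · simp [hS, hs₀, initMem]
    · simp [hS, hs₀, initMem]
  have e2 : S ∘ (fun v => 2 * v + 2) = initMem x := by
    funext v
    rcases v with _ | v
    · simp [hS, hs₀, initMem]
    · have : ¬ 2 * (v + 1) + 2 = 3 := by omega
      simp [hS, hs₀, initMem, this]
  have hid : renameWire id = id := rfl
  have hmap : (Gate.map (id : Wire → Wire)) = id := funext Gate.map_id
  obtain ⟨S₁, a1, a2, a3⟩ := h₁.relocate (r := fun v => 2 * v + 1) (fun a b h => by
    simp only at h; omega) id S e1
  have e3 : S₁ ∘ (fun v => 2 * v + 2) = initMem x := by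
    rw [← e2]
    funext v
    exact a2 _ (by rintro ⟨w, hw⟩; simp only at hw; omega)
  obtain ⟨S₂, b1, b2, b3⟩ := h₂.relocate (r := fun v => 2 * v + 2) (fun a b h => by
    simp only at h; omega) id S₁ e3
  rw [hid, hmap, List.map_id] at a3 b3
  refine ⟨S₂, fun v => ?_, fun v => congrFun b1 v, ?_⟩
  · rw [b2 _ (by rintro ⟨w, hw⟩; simp only at hw; omega), ← a1]
    rfl
  · have := (hu.seq hl).seq (a3.seq b3)
    refine this.congr rfl rfl ?_
    simp only [List.length_reverse]; ring

theorem PolyCircuit.append {G G' : List Bool → List (Gate Wire)} (h : PolyCircuit G)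
    (h' : PolyCircuit G') : PolyCircuit fun x => G x ++ G' x := by
  obtain ⟨p, b, h⟩ := h
  obtain ⟨q, b', h'⟩ := h'
  refine ⟨p.both q, 9 * Polynomial.X + 2 + b + b', fun x => ?_⟩
  obtain ⟨s, t, h1, h2⟩ := h x
  obtain ⟨s', t', h1', h2'⟩ := h' x
  obtain ⟨S, -, -, h3⟩ := h1.both h1'
  refine ⟨S, _, h3, ?_⟩
  simp only [Polynomial.eval_add, Polynomial.eval_mul, Polynomial.eval_X, Polynomial.eval_ofNat]
  omega

/-! ### Loops -/

/-- Executions that depend on the memory only through the heights of the stacks. -/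
def HeightExec (p : Prog) (h h' : ℕ → ℕ) (G : List (Gate Wire)) (t : ℕ) : Prop :=
  ∀ s : ℕ → List Bool, (∀ v, (s v).length = h v) → ∃ s', (∀ v, (s' v).length = h' v) ∧
    Exec p s s' G t

theorem HeightExec.seq {p q : Prog} {h h' h'' : ℕ → ℕ} {G G' : List (Gate Wire)} {t t' : ℕ}
    (h₁ : HeightExec p h h' G t) (h₂ : HeightExec q h' h'' G' t') :
    HeightExec (.seq p q) h h'' (G ++ G') (t + t') := by
  intro s hs
  obtain ⟨s', hs', e⟩ := h₁ s hs
  obtain ⟨s'', hs'', e'⟩ := h₂ s' hs'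
  exact ⟨s'', hs'', e.seq e'⟩

theorem heightExec_push (b : Bool) (v : ℕ) (h : ℕ → ℕ) :
    HeightExec (.push b v) h (Function.update h v (h v + 1)) [] 1 := by
  intro s hs
  refine ⟨_, fun w => ?_, .push b v s⟩
  by_cases hw : w = v
  · subst hw; simp [hs]
  · simp [Function.update_of_ne hw, hs]

theorem heightExec_pop (v : ℕ) (h : ℕ → ℕ) :
    HeightExec (.pop v) h (Function.update h v (h v - 1)) [] 1 := by
  intro s hs
  refine ⟨_, fun w => ?_, .pop v s⟩
  by_cases hw : w = v
  · subst hw; simp [hs]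
  · simp [Function.update_of_ne hw, hs]

/-- Executing `p` once for each height of the counter `c`, from `h c - 1` down to `0`. -/
def Prog.loop (c : ℕ) (p : Prog) : Prog := .whileNonempty c (.seq (.pop c) p)

/-- `H i` is the profile of stack heights when the counter stands at `i`. The counter is popped
before the body runs, so the body starts from `H (i + 1)` with the counter already lowered to `i`,
and the indices occur in descending order. Per round, the `2` beyond `T` pays for the pop and the
loop test. -/
theorem heightExec_loop {p : Prog} {c : ℕ} (H : ℕ → ℕ → ℕ) (hH : ∀ i, H i c = i)
    (G : ℕ → List (Gate Wire)) (T n : ℕ)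
    (hp : ∀ i < n, ∃ t ≤ T, HeightExec p (Function.update (H (i + 1)) c i) (H i) (G i) t) :
    ∃ t ≤ n * (T + 2) + 1, HeightExec (.loop c p) (H n) (H 0)
      ((List.range n).reverse.flatMap G) t := by
  induction n with
  | zero =>
    refine ⟨1, by omega, fun s hs => ⟨s, hs, .whileStop ?_⟩⟩
    have := hs c
    rw [hH] at this
    exact List.length_eq_zero_iff.mp this
  | succ n ih =>
    obtain ⟨t, ht, e⟩ := ih fun i hi => hp i (by omega)
    obtain ⟨t', ht', e'⟩ := hp n (by omega)
    refine ⟨1 + t' + t + 1, by rw [Nat.add_mul]; omega, fun s hs => ?_⟩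
    have e0 := heightExec_pop c (H (n + 1))
    rw [hH, Nat.add_sub_cancel] at e0
    obtain ⟨s', hs', a⟩ := (e0.seq e') s hs
    obtain ⟨s'', hs'', a'⟩ := e s' hs'
    refine ⟨s'', hs'', ?_⟩
    rw [List.range_succ, List.reverse_append]
    simp only [List.reverse_cons, List.reverse_nil, List.nil_append, List.cons_append,
      List.flatMap_cons]
    refine .whileStep ?_ a a'
    intro h0
    have := hs c
    rw [hH, h0] at this
    simp at this

/-- Executing `p` once for each height of the counter `c`, which is first set to the height of `a`
with the help of the stack `u`. -/
def Prog.forLoop (a c u : ℕ) (p : Prog) : Prog :=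
  .seq (.seq (.loop a (.seq (.push true u) (.push true c))) (.loop u (.push true a))) (.loop c p)

/-- The bound on `a` is poured into `u` and `c` and then restored from `u`, so only the copy in `c`
is consumed and the profile returns to `h`. The loop can therefore be the body of another one. The
three loops cost `4`, `3` and `T + 2` steps per unit of `h a`, plus one final test each. -/
theorem heightExec_forLoop {p : Prog} {a c u : ℕ} (hac : a ≠ c) (hau : a ≠ u) (hcu : c ≠ u)
    (h : ℕ → ℕ) (hc : h c = 0) (hu : h u = 0) (G : ℕ → List (Gate Wire)) (T : ℕ)
    (hp : ∀ i < h a, ∃ t ≤ T, HeightExec p (Function.update h c i) (Function.update h c i) (G i) t) :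
    ∃ t ≤ h a * (T + 9) + 3, HeightExec (.forLoop a c u p) h h
      ((List.range (h a)).reverse.flatMap G) t := by
  obtain ⟨t₁, ht₁, e₁⟩ := heightExec_loop (p := .seq (.push true u) (.push true c)) (c := a)
    (fun i v => if v = a then i else if v = u ∨ v = c then h a - i else h v) (by simp)
    (fun _ => []) 2 (h a) fun i hi => by
      refine ⟨2, le_rfl, ?_⟩
      refine cast (congrArg (fun h' => HeightExec _ _ h' _ _) ?_)
        ((heightExec_push true u _).seq (heightExec_push true c _))
      funext v
      by_cases h1 : v = c
      · subst h1; simp [hac.symm, hcu]; omega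
      · by_cases h2 : v = u
        · subst h2; simp [hau.symm, hcu.symm]; omega
        · by_cases h3 : v = a
          · subst h3; simp [hau, hac]
          · simp [h1, h2, h3]
  obtain ⟨t₂, ht₂, e₂⟩ := heightExec_loop (p := .push true a) (c := u)
    (fun i v => if v = u then i else if v = a then h a - i else if v = c then h a else h v) (by simp)
    (fun _ => []) 1 (h a) fun i hi => by
      refine ⟨1, le_rfl, ?_⟩
      convert heightExec_push true a _ using 1
      funext v
      by_cases h2 : v = u
      · subst h2; simp [hau.symm]
      · by_cases h3 : v = a
        · subst h3; simp [hau]; omega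
        · simp [h2, h3]
  obtain ⟨t₃, ht₃, e₃⟩ := heightExec_loop (p := p) (c := c) (fun i => Function.update h c i)
    (by simp) G T (h a) fun i hi => by simpa using hp i hi
  have hE : ([] : List (Gate Wire)) = (List.range (h a)).reverse.flatMap fun _ => [] := by simp
  rw [← hE] at e₁ e₂
  have j1 : (fun v => if v = a then h a else if v = u ∨ v = c then h a - h a else h v) = h := by
    funext v
    split_ifs with h1 h2
    · rw [h1]
    · rcases h2 with rfl | rfl <;> omega
    · rfl
  have j2 : (fun v => if v = a then 0 else if v = u ∨ v = c then h a - 0 else h v) =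
      fun v => if v = u then h a else if v = a then h a - h a else if v = c then h a else h v := by
    funext v
    by_cases h1 : v = a
    · subst h1; simp [hau]
    · by_cases h2 : v = u
      · subst h2; simp [h1]
      · simp [h1, h2]
  have j3 : (fun v => if v = u then 0 else if v = a then h a - 0 else if v = c then h a else h v) =
      Function.update h c (h a) := by
    funext v
    by_cases h1 : v = c
    · subst h1; simp [hac.symm, hcu]
    · by_cases h2 : v = u
      · subst h2; simp [h1, hu]
      · by_cases h3 : v = a
        · subst h3; simp [h1, h2]
        · simp [h1, h2, h3]
  have j4 : Function.update h c 0 = h := by rw [← hc, Function.update_eq_self]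
  rw [j1, j2] at e₁
  rw [j3] at e₂
  rw [j4] at e₃
  refine ⟨t₁ + t₂ + t₃, ?_, (e₁.seq e₂).seq e₃⟩
  calc t₁ + t₂ + t₃ ≤ (h a * (2 + 2) + 1) + (h a * (1 + 2) + 1) + (h a * (T + 2) + 1) := by omega
    _ = h a * (T + 9) + 3 := by ring

/-- Emitting a list of gates. -/
def Prog.emitAll : List (Gate (List ℕ × List ℕ)) → Prog
  | [] => .skip
  | g :: l => .seq (.emit g) (.emitAll l)

theorem heightExec_emitAll (l : List (Gate (List ℕ × List ℕ))) (h : ℕ → ℕ) :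
    HeightExec (.emitAll l) h h (l.map (Gate.map fun a => (a.1, a.2.map h))) (l.length + 1) := by
  intro s hs
  refine ⟨s, hs, ?_⟩
  have hr : resolve s = fun a => (a.1, a.2.map h) := by
    funext a
    simp [resolve, hs]
  rw [← hr]
  induction l with
  | nil => exact .skip s
  | cons g l ih => exact ((Exec.emit g s).seq ih).congr rfl rfl (by simp; ring)

/-- The gates of a circuit template in the cell `(i, j, k)`. -/
def templateGates (T : List (Gate (List ℕ × List (Fin 3)))) (i j k : ℕ) : List (Gate Wire) :=
  T.map (Gate.map fun a => (a.1, a.2.map ![i, j, k]))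

/-- Circuits that consist of one copy of a fixed template for each cell of a three-dimensional array
are written out in polynomial time. -/
theorem PolyCircuit.loop {n₁ n₂ n₃ : ℕ → ℕ} (h₁ : PolyTimeLength n₁) (h₂ : PolyTimeLength n₂)
    (h₃ : PolyTimeLength n₃) (T : List (Gate (List ℕ × List (Fin 3)))) :
    PolyCircuit fun x => (List.range (n₁ x.length)).reverse.flatMap fun i =>
      (List.range (n₂ x.length)).reverse.flatMap fun j =>
        (List.range (n₃ x.length)).reverse.flatMap fun k => templateGates T i j k := by
  obtain ⟨b₁, hb₁⟩ := h₁.polyBounded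
  obtain ⟨b₂, hb₂⟩ := h₂.polyBounded
  obtain ⟨b₃, hb₃⟩ := h₃.polyBounded
  obtain ⟨p₁, d₁, e₁⟩ := h₁
  obtain ⟨p₂, d₂, e₂⟩ := h₂
  obtain ⟨p₃, d₃, e₃⟩ := h₃
  -- The stacks `3`, `5`, `7` are the three loop counters, and so hold the coordinates of the
  -- current cell.
  let body : List (Gate (List ℕ × List ℕ)) :=
    T.map (Gate.map fun a => (a.1, a.2.map ![3, 5, 7]))
  let B₃ : Polynomial ℕ := b₃ * (Polynomial.C (T.length + 1) + 9) + 3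
  let B₂ : Polynomial ℕ := b₂ * (B₃ + 9) + 3
  let B₁ : Polynomial ℕ := b₁ * (B₂ + 9) + 3
  -- Running `.skip` beside the rest leaves the odd stacks from `3` on empty: these give the
  -- counters `3`, `5`, `7` and the auxiliary stack `9`. Each length is computed on stack `1` of its
  -- own program; following the relocations `v ↦ 2 * v + 1` and `v ↦ 2 * v + 2` outwards, the three
  -- lengths end on the stacks `8`, `18` and `22`. The three copying phases cost `27 * |x| + 6`
  -- steps and `.skip` costs one.
  refine ⟨.seq (.both .skip (.both p₁.mute (.both p₂.mute p₃.mute)))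
    (.forLoop 8 3 9 (.forLoop 18 5 9 (.forLoop 22 7 9 (.emitAll body)))),
    27 * Polynomial.X + 7 + d₁ + d₂ + d₃ + B₁, fun x => ?_⟩
  obtain ⟨s₁, G₁, t₁, a₁, ht₁, l₁⟩ := e₁ x
  obtain ⟨s₂, G₂, t₂, a₂, ht₂, l₂⟩ := e₂ x
  obtain ⟨s₃, G₃, t₃, a₃, ht₃, l₃⟩ := e₃ x
  obtain ⟨s₄, u₄, v₄, a₄⟩ := a₂.mute.both a₃.mute
  obtain ⟨s₅, u₅, v₅, a₅⟩ := a₁.mute.both a₄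
  obtain ⟨s, u, v, a⟩ := (Exec.skip (initMem x)).both a₅
  let h : ℕ → ℕ := fun v => (s v).length
  have hh1 : h 8 = n₁ x.length := by
    simp only [h]; rw [v 3, u₅ 1, l₁]
  have hh2 : h 18 = n₂ x.length := by
    simp only [h]; rw [v 8, v₅ 3, u₄ 1, l₂]
  have hh3 : h 22 = n₃ x.length := by
    simp only [h]; rw [v 10, v₅ 4, v₄ 1, l₃]
  have c3 : h 3 = 0 := by simp only [h]; rw [u 1]; rfl
  have c5 : h 5 = 0 := by simp only [h]; rw [u 2]; rfl
  have c7 : h 7 = 0 := by simp only [h]; rw [u 3]; rfl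
  have c9 : h 9 = 0 := by simp only [h]; rw [u 4]; rfl
  have hbody : ∀ i j k, HeightExec (.emitAll body)
      (Function.update (Function.update (Function.update h 3 i) 5 j) 7 k)
      (Function.update (Function.update (Function.update h 3 i) 5 j) 7 k)
      (templateGates T i j k) (T.length + 1) := by
    intro i j k
    have := heightExec_emitAll body
      (Function.update (Function.update (Function.update h 3 i) 5 j) 7 k)
    convert this using 1
    · simp only [body, templateGates, List.map_map]
      refine List.map_congr_left fun g _ => ?_
      simp only [Function.comp_apply, Gate.map_map]
      congr 1
      funext a
      simp only [Function.comp_apply, List.map_map]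
      congr 1
      refine List.map_congr_left fun r _ => ?_
      fin_cases r <;> simp
    · simp [body]
  have hB₃ : ∀ n, B₃.eval n = b₃.eval n * (T.length + 1 + 9) + 3 := by simp [B₃]
  have hB₂ : ∀ n, B₂.eval n = b₂.eval n * (B₃.eval n + 9) + 3 := by simp [B₂]
  have hB₁ : ∀ n, B₁.eval n = b₁.eval n * (B₂.eval n + 9) + 3 := by simp [B₁]
  obtain ⟨t, ht, ex⟩ := heightExec_forLoop (p := .forLoop 18 5 9 (.forLoop 22 7 9 (.emitAll body)))
    (a := 8) (c := 3) (u := 9) (by decide) (by decide) (by decide) h c3 c9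
    (fun i => (List.range (n₂ x.length)).reverse.flatMap fun j =>
        (List.range (n₃ x.length)).reverse.flatMap fun k => templateGates T i j k)
    (B₂.eval x.length) fun i _ => by
      obtain ⟨t, ht, ex⟩ := heightExec_forLoop (p := .forLoop 22 7 9 (.emitAll body))
        (a := 18) (c := 5) (u := 9) (by decide) (by decide) (by decide) (Function.update h 3 i)
        (by simpa using c5) (by simpa using c9)
        (fun j => (List.range (n₃ x.length)).reverse.flatMap fun k => templateGates T i j k)
        (B₃.eval x.length) fun j _ => by
          obtain ⟨t, ht, ex⟩ := heightExec_forLoop (p := .emitAll body)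
            (a := 22) (c := 7) (u := 9) (by decide) (by decide) (by decide)
            (Function.update (Function.update h 3 i) 5 j)
            (by simpa using c7) (by simpa using c9)
            (fun k => templateGates T i j k) (T.length + 1)
            fun k _ => ⟨_, le_rfl, hbody i j k⟩
          have e : Function.update (Function.update h 3 i) 5 j 22 = n₃ x.length := by
            simpa using hh3
          rw [e] at ht ex
          refine ⟨t, ht.trans ?_, ex⟩
          rw [hB₃]
          gcongr
          exact hb₃ _
      have e : Function.update h 3 i 18 = n₂ x.length := by simpa using hh2
      rw [e] at ht ex
      refine ⟨t, ht.trans ?_, ex⟩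
      rw [hB₂]
      gcongr
      exact hb₂ _
  rw [hh1] at ht ex
  obtain ⟨s', -, hex⟩ := ex s fun _ => rfl
  refine ⟨s', _, a.seq hex, ?_⟩
  have : t ≤ B₁.eval x.length := by
    refine ht.trans ?_
    rw [hB₁]
    gcongr
    exact hb₁ _
  simp only [Polynomial.eval_add, Polynomial.eval_mul, Polynomial.eval_X, Polynomial.eval_ofNat]
  omega

/-! ### Composition of circuits with disjoint wires -/

theorem mem_wires_moveGates {ι W : Type} {src dst : ι → W} {l : List ι} {g : Gate W}
    (hg : g ∈ moveGates src dst l) {w : W} (hw : w ∈ g.wires) :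
    ∃ i ∈ l, w = src i ∨ w = dst i := by
  simp only [moveGates, List.mem_flatMap, List.mem_cons, List.not_mem_nil, or_false] at hg
  obtain ⟨i, hi, rfl | rfl⟩ := hg <;> simp only [Gate.wires, List.mem_cons, List.not_mem_nil,
    or_false] at hw
  · exact ⟨i, hi, hw⟩
  · exact ⟨i, hi, hw.symm⟩

theorem circuitChannel_append_moveGates {W ι κ : Type} [DecidableEq W] [Fintype ι] [DecidableEq ι]
    [Fintype κ] [DecidableEq κ] (G : List (Gate W)) {inp : ι → W} {out dst : κ → W} {l : List κ}
    (hl : l.Nodup) (hmem : ∀ i, i ∈ l) (hinp : Function.Injective inp)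
    (hout : Function.Injective out) (hdst : Function.Injective dst) (V : Set W)
    (hG : ∀ g ∈ G, ∀ w ∈ g.wires, w ∈ V) (hinpV : ∀ i, inp i ∈ V) (houtV : ∀ i, out i ∈ V)
    (hdstV : ∀ i, dst i ∉ V) (ρ : Op ι) :
    circuitChannel (G ++ moveGates out dst l) inp dst ρ = circuitChannel G inp out ρ := by
  rw [circuitChannel_append G _ hinp hout V (Set.range out ∪ Set.range dst) hG ?_ hinpV
    (fun i => Or.inl ⟨i, rfl⟩) (fun i => Or.inr ⟨i, rfl⟩) ?_,
    circuitChannel_moveGates l hl hout hdst (fun i _ j h => hdstV i (h ▸ houtV j))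
    fun i hi => absurd (hmem i) hi]
  · intro g hg w hw
    obtain ⟨i, -, rfl | rfl⟩ := mem_wires_moveGates hg hw
    · exact Or.inl ⟨i, rfl⟩
    · exact Or.inr ⟨i, rfl⟩
  · rintro w hw (h | ⟨i, rfl⟩)
    · exact h
    · exact absurd hw (hdstV i)

/-- The circuits use disjoint wires and the intermediate register is carried across by moves. The
wires to which it is moved are then the only ones that the second circuit shares with what precedes
it, as `circuitChannel_append` demands. -/
theorem circuitChannel_comp {W ι κ μ : Type} [DecidableEq W] [Fintype ι] [DecidableEq ι]
    [Fintype κ] [DecidableEq κ] [Fintype μ] (G G' : List (Gate W)) {inp : ι → W}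
    {out dst : κ → W} {out' : μ → W} {l : List κ} (hl : l.Nodup) (hmem : ∀ i, i ∈ l)
    (hinp : Function.Injective inp) (hout : Function.Injective out)
    (hdst : Function.Injective dst) (V V' : Set W) (hV : ∀ w ∈ V, w ∉ V')
    (hG : ∀ g ∈ G, ∀ w ∈ g.wires, w ∈ V) (hG' : ∀ g ∈ G', ∀ w ∈ g.wires, w ∈ V')
    (hinpV : ∀ i, inp i ∈ V) (houtV : ∀ i, out i ∈ V)
    (hdstV : ∀ i, dst i ∈ V') (houtV' : ∀ i, out' i ∈ V') (ρ : Op ι) :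
    circuitChannel (G ++ moveGates out dst l ++ G') inp out' ρ =
      circuitChannel G' dst out' (circuitChannel G inp out ρ) := by
  have hd : ∀ i, dst i ∉ V := fun i h => hV _ h (hdstV i)
  rw [circuitChannel_append _ G' hinp hdst (V ∪ Set.range dst) V' ?_ hG' (fun i => Or.inl (hinpV i))
    hdstV houtV' ?_, circuitChannel_append_moveGates G hl hmem hinp hout hdst V hG hinpV houtV hd]
  · intro g hg w hw
    rcases List.mem_append.mp hg with hg | hg
    · exact Or.inl (hG g hg w hw)
    · obtain ⟨i, -, rfl | rfl⟩ := mem_wires_moveGates hg hw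
      · exact Or.inl (houtV i)
      · exact Or.inr ⟨i, rfl⟩
  · rintro w (hw | hw) hw'
    · exact absurd hw' (hV w hw)
    · exact hw

/-- The side register sits on input wires of the second circuit from the start and the first circuit
never meets it. This is the situation of a distinguisher whose input has first been processed by
another circuit. -/
theorem circuitChannel_comp_sumElim {W ι κ μ K : Type} [DecidableEq W] [Fintype ι] [DecidableEq ι]
    [Fintype κ] [DecidableEq κ] [Fintype μ] [Fintype K] [DecidableEq K] (G G' : List (Gate W))
    {inp : ι → W} {out dst : κ → W} {side : K → W} {out' : μ → W} {l : List κ} (hl : l.Nodup)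
    (hmem : ∀ i, i ∈ l) (hinp : Function.Injective inp) (hout : Function.Injective out)
    (hdst : Function.Injective (Sum.elim dst side)) (V V' : Set W) (hV : ∀ w ∈ V, w ∉ V')
    (hG : ∀ g ∈ G, ∀ w ∈ g.wires, w ∈ V) (hG' : ∀ g ∈ G', ∀ w ∈ g.wires, w ∈ V')
    (hinpV : ∀ i, inp i ∈ V) (houtV : ∀ i, out i ∈ V)
    (hdstV : ∀ i, dst i ∈ V') (hsideV : ∀ i, side i ∈ V') (houtV' : ∀ i, out' i ∈ V')
    (σ : Op (ι ⊕ K)) :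
    circuitChannel (G ++ moveGates out dst l ++ G') (Sum.elim inp side) out' σ =
      circuitChannel G' (Sum.elim dst side) out' (onFirst K (circuitChannel G inp out) σ) := by
  have hd : ∀ i, dst i ∉ V := fun i h => hV _ h (hdstV i)
  have hs : ∀ i, side i ∉ V := fun i h => hV _ h (hsideV i)
  have hside : Function.Injective side := fun i j h => Sum.inr_injective (@hdst (.inr i) (.inr j) h)
  have hdst' : Function.Injective dst := fun i j h => Sum.inl_injective (@hdst (.inl i) (.inl j) h)
  have hinp' : Function.Injective (Sum.elim inp side) :=
    hinp.sumElim hside fun i k h => hs k (h ▸ hinpV i)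
  have hGm : ∀ g ∈ G ++ moveGates out dst l, ∀ w ∈ g.wires, w ∈ V ∪ Set.range dst := by
    intro g hg w hw
    rcases List.mem_append.mp hg with hg | hg
    · exact Or.inl (hG g hg w hw)
    · obtain ⟨i, -, rfl | rfl⟩ := mem_wires_moveGates hg hw
      · exact Or.inl (houtV i)
      · exact Or.inr ⟨i, rfl⟩
  rw [circuitChannel_append _ G' hinp' hdst (V ∪ Set.range dst ∪ Set.range side) V'
    (fun g hg w hw => Or.inl (hGm g hg w hw)) hG' ?_ ?_ houtV' ?_]
  · rw [circuitChannel_sumElim _ hinp hside (V ∪ Set.range dst) hGm (fun i => Or.inl (hinpV i))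
      (fun i => Or.inr ⟨i, rfl⟩)]
    · congr 2
      funext ρ
      exact circuitChannel_append_moveGates G hl hmem hinp hout hdst' V hG hinpV houtV hd ρ
    · rintro k (h | ⟨i, h⟩)
      · exact hs k h
      · simpa using @hdst (.inl i) (.inr k) h
  · rintro (i | k)
    · exact Or.inl (Or.inl (hinpV i))
    · exact Or.inr ⟨k, rfl⟩
  · rintro (i | k)
    · exact hdstV i
    · exact hsideV k
  · rintro w ((hw | ⟨i, rfl⟩) | ⟨k, rfl⟩) hw'
    · exact absurd hw' (hV w hw)
    · exact ⟨Sum.inl i, rfl⟩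
    · exact ⟨Sum.inr k, rfl⟩

/-! ### Enumerable registers -/

/-- Registers for which a polynomial-time program can write out a fixed sequence of gates for every
qubit. -/
def Register.Enumerable (A : Register) : Prop :=
  ∃ l : ∀ n, List (A.Idx n), (∀ n, (l n).Nodup) ∧ (∀ n i, i ∈ l n) ∧
    ∀ T : List (Gate (List ℕ → List ℕ)), PolyCircuit fun x =>
      (l x.length).flatMap fun i => T.map (Gate.map fun f => renameWire f (A.label x.length i))

theorem Register.Enumerable.polyBounded {A : Register} (hA : A.Enumerable) :
    PolyBounded fun n => Fintype.card (A.Idx n) := by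
  obtain ⟨l, hl, hmem, h⟩ := hA
  -- With a template of a single gate, the length of the circuit is the number of qubits.
  obtain ⟨b, hb⟩ := (h [.had id]).length_le
  refine ⟨b, fun n => ?_⟩
  have := hb (List.replicate n true)
  simp only [List.length_replicate, List.length_flatMap, List.length_map, List.length_cons,
    List.length_nil, zero_add, List.map_const', List.sum_replicate, smul_eq_mul, mul_one] at this
  have hc : (l (List.replicate n true).length).length =
      Fintype.card (A.Idx (List.replicate n true).length) := by
    rw [← List.toFinset_card_of_nodup (hl _), ← Finset.card_univ]
    congr 1
    ext i
    simp [hmem]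
  simp only [List.length_replicate] at hc
  show Fintype.card (A.Idx n) ≤ _
  omega

theorem flatMap_map_inl_append_map_inr {α β γ : Type} (l : List α) (l' : List β)
    (F : α ⊕ β → List γ) : (l.map Sum.inl ++ l'.map Sum.inr).flatMap F =
      (l.flatMap fun i => F (Sum.inl i)) ++ l'.flatMap fun i => F (Sum.inr i) := by
  rw [List.flatMap_append, List.flatMap_map, List.flatMap_map]

theorem nodup_map_inl_append_map_inr {α β : Type} {l : List α} {l' : List β} (h : l.Nodup)
    (h' : l'.Nodup) : (l.map (Sum.inl : α → α ⊕ β) ++ l'.map Sum.inr).Nodup := by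
  refine List.Nodup.append (h.map Sum.inl_injective) (h'.map Sum.inr_injective) ?_
  intro i hi hi'
  obtain ⟨a, -, rfl⟩ := List.mem_map.mp hi
  obtain ⟨b, -, hb⟩ := List.mem_map.mp hi'
  cases hb

theorem mem_map_inl_append_map_inr {α β : Type} {l : List α} {l' : List β} (h : ∀ i, i ∈ l)
    (h' : ∀ i, i ∈ l') (i : α ⊕ β) : i ∈ l.map Sum.inl ++ l'.map Sum.inr := by
  rcases i with i | i
  · exact List.mem_append.mpr (Or.inl (List.mem_map.mpr ⟨i, h i, rfl⟩))
  · exact List.mem_append.mpr (Or.inr (List.mem_map.mpr ⟨i, h' i, rfl⟩))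

theorem Register.Enumerable.sum {A B : Register} (hA : A.Enumerable) (hB : B.Enumerable) :
    (A.sum B).Enumerable := by
  obtain ⟨l, hl, hmem, h⟩ := hA
  obtain ⟨l', hl', hmem', h'⟩ := hB
  refine ⟨fun n => (l n).map Sum.inl ++ (l' n).map Sum.inr,
    fun n => nodup_map_inl_append_map_inr (hl n) (hl' n),
    fun n => mem_map_inl_append_map_inr (hmem n) (hmem' n), fun T => ?_⟩
  have e := (h (T.map (Gate.map fun f => f ∘ List.cons 0))).append
    (h' (T.map (Gate.map fun f => f ∘ List.cons 1)))
  convert e using 2 with x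
  refine (flatMap_map_inl_append_map_inr _ _ _).trans ?_
  simp only [List.map_map]
  congr 1 <;> refine List.flatMap_congr fun i _ => List.map_congr_left fun g _ => ?_ <;>
    simp only [Function.comp_apply, Gate.map_map] <;> rfl

/-- The cells of a three-dimensional array, in descending order. -/
def cellList (n₁ n₂ n₃ : ℕ) : List (Fin n₁ × Fin n₂ × Fin n₃) :=
  (List.finRange n₁).reverse ×ˢ ((List.finRange n₂).reverse ×ˢ (List.finRange n₃).reverse)

theorem cellList_nodup (n₁ n₂ n₃ : ℕ) : (cellList n₁ n₂ n₃).Nodup :=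
  (List.nodup_reverse.mpr (List.nodup_finRange _)).product
    ((List.nodup_reverse.mpr (List.nodup_finRange _)).product
      (List.nodup_reverse.mpr (List.nodup_finRange _)))

theorem mem_cellList (n₁ n₂ n₃ : ℕ) (q : Fin n₁ × Fin n₂ × Fin n₃) : q ∈ cellList n₁ n₂ n₃ := by
  obtain ⟨i, j, k⟩ := q
  simp [cellList, List.mem_product]

theorem flatMap_finRange {β : Type} (n : ℕ) (f : ℕ → List β) :
    (List.finRange n).reverse.flatMap (fun i : Fin n => f i.val) = (List.range n).reverse.flatMap f := by
  rw [← List.map_coe_finRange_eq_range, ← List.map_reverse, List.flatMap_map]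

theorem PolyCircuit.cellLoop {n₁ n₂ n₃ : ℕ → ℕ} (h₁ : PolyTimeLength n₁) (h₂ : PolyTimeLength n₂)
    (h₃ : PolyTimeLength n₃) (T : List (Gate (List ℕ × List (Fin 3)))) :
    PolyCircuit fun x => (cellList (n₁ x.length) (n₂ x.length) (n₃ x.length)).flatMap fun q =>
      templateGates T q.1 q.2.1 q.2.2 := by
  convert PolyCircuit.loop h₁ h₂ h₃ T using 2 with x
  simp only [← flatMap_finRange, cellList, SProd.sprod, List.product, List.flatMap_assoc,
    List.flatMap_map]

theorem PolyTimeLength.succ {f : ℕ → ℕ} (h : PolyTimeLength f) :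
    PolyTimeLength fun n => f n + 1 := by
  obtain ⟨p, b, h⟩ := h
  refine ⟨.seq p (.push true 1), b + 1, fun x => ?_⟩
  obtain ⟨s, G, t, h1, h2, h3⟩ := h x
  refine ⟨_, _, _, h1.seq (.push true 1 s), ?_, ?_⟩
  · simp; omega
  · simp [h3]

theorem polyTimeLength_zero : PolyTimeLength fun _ => 0 :=
  ⟨.skip, 1, fun x => ⟨_, _, _, .skip _, by simp, by simp [initMem]⟩⟩

theorem polyTimeLength_one : PolyTimeLength fun _ => 1 := polyTimeLength_zero.succ

/-- Registers with fewer than three coordinates are covered by dimensions of size `1`, with `idx`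
listing the coordinates that really occur in the label. -/
theorem Register.enumerable_of_cells (A : Register) {n₁ n₂ n₃ : ℕ → ℕ} (h₁ : PolyTimeLength n₁)
    (h₂ : PolyTimeLength n₂) (h₃ : PolyTimeLength n₃)
    (e : ∀ n, Fin (n₁ n) × Fin (n₂ n) × Fin (n₃ n) ≃ A.Idx n) (idx : List (Fin 3))
    (hA : ∀ n q, A.label n (e n q) = ([], idx.map ![q.1.val, q.2.1.val, q.2.2.val])) :
    A.Enumerable := by
  refine ⟨fun n => (cellList (n₁ n) (n₂ n) (n₃ n)).map (e n),
    fun n => (cellList_nodup _ _ _).map (e n).injective,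
    fun n i => List.mem_map.mpr ⟨(e n).symm i, mem_cellList _ _ _ _, by simp⟩, fun T => ?_⟩
  convert PolyCircuit.cellLoop h₁ h₂ h₃ (T.map (Gate.map fun f => (f [], idx))) using 2 with x
  simp only [List.flatMap_map]
  refine List.flatMap_congr fun q _ => ?_
  simp only [templateGates, List.map_map]
  refine List.map_congr_left fun g _ => ?_
  simp only [Function.comp_apply, Gate.map_map, hA]
  rfl

theorem Register.enumerable_ofSize {e : ℕ → ℕ} (he : PolyTimeLength e) :
    (Register.ofSize e).Enumerable :=
  Register.enumerable_of_cells (Register.ofSize e) he polyTimeLength_one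
    polyTimeLength_one (fun _ => (Equiv.prodCongr (Equiv.refl _) (Equiv.prodUnique _ _)).trans (Equiv.prodUnique _ _)) [0] fun _ _ => rfl

/-! ### The registers of the protocol are enumerable -/

namespace PublicCoinProof

variable (I : PublicCoinProof)

theorem enumerable_chalReg : I.chalReg.Enumerable :=
  I.chalReg.enumerable_of_cells I.rounds_polyTime I.chalLen_polyTime polyTimeLength_one
    (fun _ => (Equiv.refl _).prodCongr (Equiv.prodUnique _ _)) [0, 1] fun _ _ => rfl

theorem enumerable_ansReg : I.ansReg.Enumerable :=
  I.ansReg.enumerable_of_cells I.rounds_polyTime.succ I.msgLen_polyTime polyTimeLength_one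
    (fun _ => (Equiv.refl _).prodCongr (Equiv.prodUnique _ _)) [0, 1] fun _ _ => rfl

theorem enumerable_commitReg {N : ℕ → ℕ} (hN : PolyTimeLength N) : (I.commitReg N).Enumerable :=
  (I.commitReg N).enumerable_of_cells I.rounds_polyTime I.msgLen_polyTime hN
    (fun _ => Equiv.refl _) [0, 1, 2] fun _ _ => rfl

end PublicCoinProof

/-! ### Polynomial-time channels -/

theorem renameWire_injective {f : List ℕ → List ℕ} (hf : Function.Injective f) :
    Function.Injective (renameWire f) := fun w w' h => by
  simp only [renameWire, Prod.mk.injEq] at h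
  exact Prod.ext (hf h.1) h.2

theorem tagWire_injective (r : ℕ) : Function.Injective (tagWire r) := fun _ _ h => (tagWire_inj h).2

theorem tag_label_injective (r : ℕ) (A : Register) (n : ℕ) :
    Function.Injective fun i => tagWire r (A.label n i) :=
  (tagWire_injective r).comp (A.label_inj n)

theorem PolyTime.isCPTP {A B : Register}
    {Φ : ∀ x : List Bool, Op (A.Idx x.length) → Op (B.Idx x.length)} (h : PolyTime A B Φ)
    (x : List Bool) : IsCPTP (Φ x) := by
  obtain ⟨G, -, h⟩ := polyTime_iff.mp h
  rw [h]
  exact isCPTP_circuitChannel _ (tag_label_injective 0 A _) _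

/-- Keep the names of tag `r` and put the tag `m` in front of all others. -/
def isolateName (r m : ℕ) (l : List ℕ) : List ℕ := if l.head? = some r then l else m :: l

theorem isolateName_injective {r m : ℕ} (h : m ≠ r) : Function.Injective (isolateName r m) := by
  intro l l' hl
  unfold isolateName at hl
  split_ifs at hl with h1 h2 h2
  · exact hl
  · rw [hl] at h1
    simp [h] at h1
  · rw [← hl] at h2
    simp [h] at h2
  · simpa using hl

/-- Names on the two sides begin with a tag from `{r, m}` and from `{r', m'}` respectively, and
these sets are disjoint. -/
theorem isolateName_ne {r m r' m' : ℕ} (h : r ≠ r') (h1 : m ≠ m') (h2 : r ≠ m') (h3 : m ≠ r')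
    (l l' : List ℕ) : isolateName r m l ≠ isolateName r' m' l' := by
  intro e
  have := congrArg List.head? e
  unfold isolateName at this
  split_ifs at this with a b b <;> simp_all

theorem renameWire_isolateName (r m : ℕ) (w : Wire) :
    renameWire (isolateName r m) (tagWire r w) = tagWire r w := by
  simp [renameWire, isolateName, tagWire]

theorem mem_range_of_mem_map {W W' : Type} {f : W → W'} {G : List (Gate W)} {g : Gate W'}
    (hg : g ∈ G.map (Gate.map f)) {w : W'} (hw : w ∈ g.wires) : w ∈ Set.range f := by
  obtain ⟨g, -, rfl⟩ := List.mem_map.mp hg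
  rw [Gate.wires_map] at hw
  obtain ⟨v, -, rfl⟩ := List.mem_map.mp hw
  exact ⟨v, rfl⟩

/-- The inputs of the first circuit keep the tag `0` and the outputs of the second the tag `1`, as
the definition prescribes; all other wires of the two circuits are hidden behind the tags `2` and
`3`. Enumerability of `B` lets a program write out the moves that connect them. -/
theorem PolyTime.comp {A B C : Register} (hB : B.Enumerable)
    {Φ : ∀ x : List Bool, Op (A.Idx x.length) → Op (B.Idx x.length)}
    {Ψ : ∀ x : List Bool, Op (B.Idx x.length) → Op (C.Idx x.length)} (hΨ : PolyTime B C Ψ)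
    (hΦ : PolyTime A B Φ) : PolyTime A C fun x ρ => Ψ x (Φ x ρ) := by
  obtain ⟨G, hG, hΦ⟩ := polyTime_iff.mp hΦ
  obtain ⟨G', hG', hΨ⟩ := polyTime_iff.mp hΨ
  obtain ⟨l, hl, hmem, hT⟩ := hB
  set f := isolateName 0 2
  set f' := isolateName 1 3
  have hf : Function.Injective (renameWire f) :=
    renameWire_injective (isolateName_injective (by decide))
  have hf' : Function.Injective (renameWire f') :=
    renameWire_injective (isolateName_injective (by decide))
  refine polyTime_iff.mpr ⟨fun x => (G x).map (Gate.map (renameWire f)) ++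
    moveGates (fun i => renameWire f (tagWire 1 (B.label x.length i)))
      (fun i => renameWire f' (tagWire 0 (B.label x.length i))) (l x.length) ++
    (G' x).map (Gate.map (renameWire f')), ?_, fun x => ?_⟩
  · exact ((hG.rename f).append (hT [.cnot (f ∘ List.cons 1) (f' ∘ List.cons 0),
      .cnot (f' ∘ List.cons 0) (f ∘ List.cons 1)])).append (hG'.rename f')
  · funext ρ
    have e1 : (fun i => tagWire 0 (A.label x.length i)) =
        renameWire f ∘ fun i => tagWire 0 (A.label x.length i) :=
      funext fun i => (renameWire_isolateName 0 2 _).symm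
    have e2 : (fun i => tagWire 1 (C.label x.length i)) =
        renameWire f' ∘ fun i => tagWire 1 (C.label x.length i) :=
      funext fun i => (renameWire_isolateName 1 3 _).symm
    have key := circuitChannel_comp ((G x).map (Gate.map (renameWire f)))
      ((G' x).map (Gate.map (renameWire f'))) (hl x.length) (hmem x.length)
      (hf.comp (tag_label_injective 0 A _)) (hf.comp (tag_label_injective 1 B _))
      (hf'.comp (tag_label_injective 0 B _))
      (out' := renameWire f' ∘ fun i => tagWire 1 (C.label x.length i))
      (Set.range (renameWire f)) (Set.range (renameWire f'))
      ?_ (fun g hg w => mem_range_of_mem_map hg) (fun g hg w => mem_range_of_mem_map hg)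
      (fun i => ⟨_, rfl⟩) (fun i => ⟨_, rfl⟩) (fun i => ⟨_, rfl⟩) (fun i => ⟨_, rfl⟩) ρ
    · rw [circuitChannel_map hf _ (tag_label_injective 0 A _),
        circuitChannel_map hf' _ (tag_label_injective 0 B _), ← hΦ, ← hΨ, ← e1, ← e2] at key
      exact key.symm
    · rintro w ⟨v, rfl⟩ ⟨v', hv⟩
      exact isolateName_ne (by decide) (by decide) (by decide) (by decide) v.1 v'.1
        (congrArg Prod.fst hv).symm

/-- Keep the tags `0` and `1` of names, followed by a new tag `0`. -/
def nestName : List ℕ → List ℕ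
  | 0 :: l => 0 :: 0 :: l
  | 1 :: l => 1 :: 0 :: l
  | l => 2 :: l

theorem nestName_injective : Function.Injective nestName := by
  intro l l' h
  unfold nestName at h
  split at h <;> split at h <;> simp_all

theorem nestName_ne (r : ℕ) (hr : r < 2) (l l' : List ℕ) : nestName l ≠ r :: 1 :: l' := by
  unfold nestName
  split <;> simp
  omega

/-- Renaming by `nestName` puts the inputs and outputs of the circuit where the joint registers
expect their left halves. The names beginning with `0, 1` and `1, 1` stay free for the idle
register, which is moved from the former to the latter. -/
theorem PolyTime.onFirst {A B R : Register} (hR : R.Enumerable)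
    {Φ : ∀ x : List Bool, Op (A.Idx x.length) → Op (B.Idx x.length)} (hΦ : PolyTime A B Φ) :
    PolyTime (A.sum R) (B.sum R) fun x => onFirst (R.Idx x.length) (Φ x) := by
  obtain ⟨G, hG, hΦ⟩ := polyTime_iff.mp hΦ
  obtain ⟨l, hl, hmem, hT⟩ := hR
  have hf := renameWire_injective nestName_injective
  refine polyTime_iff.mpr ⟨fun x => (G x).map (Gate.map (renameWire nestName)) ++
    moveGates (fun i => tagWire 0 (tagWire 1 (R.label x.length i)))
      (fun i => tagWire 1 (tagWire 1 (R.label x.length i))) (l x.length), ?_, fun x => ?_⟩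
  · exact (hG.rename nestName).append (hT [.cnot (List.cons 0 ∘ List.cons 1)
      (List.cons 1 ∘ List.cons 1), .cnot (List.cons 1 ∘ List.cons 1) (List.cons 0 ∘ List.cons 1)])
  · funext σ
    set inp := fun i => tagWire 0 (A.label x.length i)
    set out := fun i => tagWire 1 (B.label x.length i)
    set src := fun i => tagWire 0 (tagWire 1 (R.label x.length i))
    set dst := fun i => tagWire 1 (tagWire 1 (R.label x.length i))
    have hinp : Function.Injective inp := tag_label_injective 0 A _
    have hout : Function.Injective out := tag_label_injective 1 B _
    have hsrc : Function.Injective src := (tagWire_injective 0).comp (tag_label_injective 1 R _)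
    have hdst : Function.Injective dst := (tagWire_injective 1).comp (tag_label_injective 1 R _)
    have hne : ∀ w k, renameWire nestName w ≠ src k := fun w k h =>
      nestName_ne 0 (by decide) _ _ (congrArg Prod.fst h)
    have hne' : ∀ w k, renameWire nestName w ≠ dst k := fun w k h =>
      nestName_ne 1 (by decide) _ _ (congrArg Prod.fst h)
    have hsd : ∀ j k, src j ≠ dst k := fun j k h => absurd (tagWire_inj h).1 (by decide)
    have e1 : (fun i => tagWire 0 ((A.sum R).label x.length i)) =
        Sum.elim (renameWire nestName ∘ inp) src := by
      funext i
      rcases i with i | i <;> rfl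
    have e2 : (fun i => tagWire 1 ((B.sum R).label x.length i)) =
        Sum.elim (renameWire nestName ∘ out) dst := by
      funext i
      rcases i with i | i <;> rfl
    have e3 : moveGates src dst (l x.length) = moveGates (Sum.elim (renameWire nestName ∘ out) src)
        (Sum.elim (renameWire nestName ∘ out) dst) ((l x.length).map Sum.inr) := by
      simp [moveGates, List.flatMap_map]
    have i1 : Function.Injective (Sum.elim (renameWire nestName ∘ inp) src) :=
      (hf.comp hinp).sumElim hsrc fun i k => hne _ k
    have i2 : Function.Injective (Sum.elim (renameWire nestName ∘ out) src) :=
      (hf.comp hout).sumElim hsrc fun i k => hne _ k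
    have i3 : Function.Injective (Sum.elim (renameWire nestName ∘ out) dst) :=
      (hf.comp hout).sumElim hdst fun i k => hne' _ k
    have h1 := circuitChannel_sumElim ((G x).map (Gate.map (renameWire nestName)))
      (out := renameWire nestName ∘ out) (hf.comp hinp) hsrc (Set.range (renameWire nestName))
      (fun g hg w => mem_range_of_mem_map hg)
      (fun i => ⟨_, rfl⟩) (fun i => ⟨_, rfl⟩) (fun k ⟨w, h⟩ => hne w k h) σ
    rw [circuitChannel_map hf _ hinp, ← hΦ] at h1
    have h2 : ∀ σ, circuitChannel (moveGates src dst (l x.length))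
        (Sum.elim (renameWire nestName ∘ out) src)
        (Sum.elim (renameWire nestName ∘ out) dst) σ = σ := by
      intro σ
      rw [e3]
      refine circuitChannel_moveGates _ ((hl _).map Sum.inr_injective) i2 i3 ?_ ?_ σ
      · intro i hi j
        obtain ⟨k, -, rfl⟩ := List.mem_map.mp hi
        rcases j with j | j
        · exact (hne' _ k).symm
        · exact (hsd j k).symm
      · rintro (i | i) hi
        · rfl
        · exact absurd (List.mem_map.mpr ⟨i, hmem _ i, rfl⟩) hi
    have h3 := circuitChannel_append ((G x).map (Gate.map (renameWire nestName)))
      (moveGates src dst (l x.length)) i1 i2 (out := Sum.elim (renameWire nestName ∘ out) dst)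
      (Set.range (renameWire nestName) ∪ Set.range src)
      (Set.range (renameWire nestName ∘ out) ∪ Set.range src ∪ Set.range dst)
      (fun g hg w hw => Or.inl (mem_range_of_mem_map hg hw)) ?_ ?_ ?_ ?_ ?_ σ
    · rw [h1, h2] at h3
      refine h3.symm.trans ?_
      rw [← e1, ← e2]
      rfl
    · intro g hg w hw
      obtain ⟨i, -, rfl | rfl⟩ := mem_wires_moveGates hg hw
      · exact Or.inl (Or.inr ⟨i, rfl⟩)
      · exact Or.inr ⟨i, rfl⟩
    · rintro (i | i)
      · exact Or.inl ⟨_, rfl⟩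
      · exact Or.inr ⟨_, rfl⟩
    · rintro (i | i)
      · exact Or.inl (Or.inl ⟨_, rfl⟩)
      · exact Or.inl (Or.inr ⟨_, rfl⟩)
    · rintro (i | i)
      · exact Or.inl (Or.inl ⟨_, rfl⟩)
      · exact Or.inr ⟨_, rfl⟩
    · rintro w hw ((⟨i, rfl⟩ | ⟨i, rfl⟩) | ⟨i, rfl⟩)
      · exact ⟨Sum.inl i, rfl⟩
      · exact ⟨Sum.inr i, rfl⟩
      · rcases hw with ⟨v, hv⟩ | ⟨j, hj⟩
        · exact absurd hv (hne' v i)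
        · exact absurd hj (hsd j i)

theorem polyTime_dephase {A : Register} (hA : A.Enumerable) :
    PolyTime A A fun _ => dephase := by
  obtain ⟨l, hl, hmem, hT⟩ := hA
  refine polyTime_iff.mpr ⟨fun x => copyGates (fun i => tagWire 0 (A.label x.length i))
      (fun i => tagWire 1 (A.label x.length i)) (l x.length), ?_, fun x => ?_⟩
  · convert hT [.cnot (List.cons 0) (List.cons 1)] using 2 with x
    simp [copyGates, List.map_eq_flatMap, Gate.map]
    rfl
  · funext ρ
    refine (circuitChannel_copyGates _ (hl _) (hmem _) ?_ ρ).symm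
    exact (tag_label_injective 0 A _).sumElim (tag_label_injective 1 A _)
      fun i j h => absurd (tagWire_inj h).1 (by decide)

theorem circuitChannel_comp_equiv_out {W ι κ κ' : Type} [DecidableEq W] [Fintype ι] [DecidableEq ι]
    [Fintype κ] [Fintype κ'] (G : List (Gate W)) {inp : ι → W} (hinp : Function.Injective inp)
    (out : κ → W) (e : κ' ≃ κ) (ρ : Op ι) :
    circuitChannel G inp (out ∘ e) ρ = relabel e (circuitChannel G inp out ρ) := by
  ext y y'
  rw [relabel_apply, circuitChannel_apply _ hinp, circuitChannel_apply _ hinp]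
  have h : selectKernel (out ∘ e) y y' = selectKernel out (y ∘ e.symm) (y' ∘ e.symm) := by
    funext Z Z'
    refine selectKernel_congr ?_
    rw [e.forall_congr_left (p := fun j => Z ((out ∘ e) j) = y j),
      e.forall_congr_left (p := fun j => Z' ((out ∘ e) j) = y' j)]
    simp [Set.range_comp]
  rw [h]

/-- Moving every qubit to the output wire with the opposite summand tag already realises the swap;
no computation is involved. -/
theorem polyTime_sumComm {A B : Register} (hA : A.Enumerable) (hB : B.Enumerable) :
    PolyTime (A.sum B) (B.sum A) fun x =>
      relabel (Equiv.sumComm (B.Idx x.length) (A.Idx x.length)) := by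
  have hAB := hA.sum hB
  obtain ⟨l, hl, hmem, hT⟩ := hA
  obtain ⟨l', hl', hmem', hT'⟩ := hB
  let src := fun (x : List Bool) i => tagWire 0 ((A.sum B).label x.length i)
  let dst := fun (x : List Bool) (i : (A.sum B).Idx x.length) => tagWire 1 ((B.sum A).label x.length
    (Equiv.sumComm (A.Idx x.length) (B.Idx x.length) i))
  refine polyTime_iff.mpr ⟨fun x => moveGates (src x) (dst x) ((l x.length).map Sum.inl) ++
    moveGates (src x) (dst x) ((l' x.length).map Sum.inr), ?_, fun x => ?_⟩
  · convert (hT [.cnot (List.cons 0 ∘ List.cons 0) (List.cons 1 ∘ List.cons 1),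
      .cnot (List.cons 1 ∘ List.cons 1) (List.cons 0 ∘ List.cons 0)]).append
      (hT' [.cnot (List.cons 0 ∘ List.cons 1) (List.cons 1 ∘ List.cons 0),
      .cnot (List.cons 1 ∘ List.cons 0) (List.cons 0 ∘ List.cons 1)]) using 2 with x
    have e : ∀ {ι κ : Type} (f : κ → ι) (l : List κ) (src dst : ι → Wire),
        moveGates src dst (l.map f) = moveGates (src ∘ f) (dst ∘ f) l := by
      intro ι κ f l src dst
      simp [moveGates, List.flatMap_map]
    exact congrArg₂ (· ++ ·) (e Sum.inl _ (src x) (dst x)) (e Sum.inr _ (src x) (dst x))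
  · funext ρ
    have hsrc : Function.Injective (src x) := tag_label_injective 0 _ _
    have hdst : Function.Injective (dst x) :=
      (tag_label_injective 1 (B.sum A) _).comp (Equiv.injective _)
    have e : ∀ l l' : List ((A.sum B).Idx x.length), moveGates (src x) (dst x) l ++
        moveGates (src x) (dst x) l' = moveGates (src x) (dst x) (l ++ l') :=
      fun l l' => List.flatMap_append.symm
    have ho : (fun j => tagWire 1 ((B.sum A).label x.length j)) =
        dst x ∘ Equiv.sumComm (B.Idx x.length) (A.Idx x.length) := by
      funext j
      rcases j with j | j <;> rfl
    have key := circuitChannel_comp_equiv_out (moveGates (src x) (dst x)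
      ((l x.length).map Sum.inl ++ (l' x.length).map Sum.inr)) hsrc (dst x)
      (Equiv.sumComm (B.Idx x.length) (A.Idx x.length)) ρ
    refine ((congrArg (fun G => circuitChannel G (src x)
      (fun j => tagWire 1 ((B.sum A).label x.length j)) ρ) (e _ _)).trans ?_).symm
    rw [ho]
    exact key.trans (congrArg _ (circuitChannel_moveGates _
      (nodup_map_inl_append_map_inr (hl _) (hl' _)) hsrc hdst
      (fun i _ j h => absurd (tagWire_inj h).1 (by decide))
      (fun i hi => absurd (mem_map_inl_append_map_inr (hmem _) (hmem' _) i) hi) ρ))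

/-! ### Products of one-qubit operators -/

open Classical in
/-- The operator that applies the one-qubit matrices `m v` to the qubits `v ∈ s`; they may depend on
the input configuration of other qubits. -/
noncomputable def localProd {ι : Type} (s : Finset ι) (m : (ι → Bool) → ι → Bool → Bool → ℂ) :
    Op ι :=
  Matrix.of fun x y => if ∀ v, v ∉ s → x v = y v then ∏ v ∈ s, m y v (x v) (y v) else 0

theorem localProd_apply_of_eq {ι : Type} {s : Finset ι} {m : (ι → Bool) → ι → Bool → Bool → ℂ}
    {x y : ι → Bool} (h : ∀ v, v ∉ s → x v = y v) :
    localProd s m x y = ∏ v ∈ s, m y v (x v) (y v) := if_pos h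

theorem localProd_apply_of_ne {ι : Type} {s : Finset ι} {m : (ι → Bool) → ι → Bool → Bool → ℂ}
    {x y : ι → Bool} (h : ¬ ∀ v, v ∉ s → x v = y v) : localProd s m x y = 0 := if_neg h

theorem localProd_empty {ι : Type} (m : (ι → Bool) → ι → Bool → Bool → ℂ) [DecidableEq (ι → Bool)] :
    localProd ∅ m = 1 := by
  ext x y
  have h : (∀ v, v ∉ (∅ : Finset ι) → x v = y v) ↔ x = y := by simp [funext_iff]
  simp only [localProd, Matrix.of_apply, Matrix.one_apply, Finset.prod_empty, h]

/-- The right factor changes only qubits in `t ⊆ u`, and the matrices depend only on qubits outside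
`u`, so the left factor still sees the matrices determined by the original input. -/
theorem localProd_mul {ι : Type} [Fintype ι] [DecidableEq ι] {s t u : Finset ι}
    (hst : Disjoint s t) (hu : t ⊆ u) {m : (ι → Bool) → ι → Bool → Bool → ℂ}
    (hm : ∀ y y', (∀ v, v ∉ u → y v = y' v) → m y = m y') :
    localProd s m * localProd t m = localProd (s ∪ t) m := by
  ext x z
  -- Only one intermediate configuration contributes: on `s` the right factor has changed nothing
  -- yet, and off `s` the left factor will change nothing any more.
  rw [Matrix.mul_apply, Finset.sum_eq_single fun v => if v ∈ s then z v else x v]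
  · have hs : ∀ v ∈ t, v ∉ s := fun v hv hv' => Finset.disjoint_left.mp hst hv' hv
    have h1 : ∀ v, v ∉ s → x v = if v ∈ s then z v else x v := fun v hv => by simp [hv]
    simp only [localProd, Matrix.of_apply]
    rw [if_pos h1]
    by_cases h : ∀ v, v ∉ s ∪ t → x v = z v
    · have h2 : ∀ v, v ∉ t → (if v ∈ s then z v else x v) = z v := by
        intro v hv
        split_ifs with hv'
        · rfl
        · exact h v (by simp [hv, hv'])
      rw [if_pos h, if_pos h2, Finset.prod_union hst, hm _ z fun v hv => h2 v fun h => hv (hu h)]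
      congr 1
      · exact Finset.prod_congr rfl fun v hv => by rw [if_pos hv]
      · exact Finset.prod_congr rfl fun v hv => by rw [if_neg (hs v hv)]
    · rw [if_neg h, if_neg, mul_zero]
      intro h2
      apply h
      intro v hv
      have := h2 v fun h => hv (Finset.mem_union_right _ h)
      rwa [if_neg fun h => hv (Finset.mem_union_left _ h)] at this
  · intro y _ hy
    simp only [localProd, Matrix.of_apply]
    by_cases h1 : ∀ v, v ∉ s → x v = y v
    · by_cases h2 : ∀ v, v ∉ t → y v = z v
      · refine absurd (funext fun v => ?_) hy
        split_ifs with hv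
        · exact h2 v (Finset.disjoint_left.mp hst hv)
        · exact (h1 v hv).symm
      · rw [if_neg h2, mul_zero]
    · rw [if_neg h1, zero_mul]
  · simp

/-! ### Circuits acting on a register -/

/-- The matrix of a circuit on a finite set of wires. -/
noncomputable def circuitMatrix {ι : Type} [Fintype ι] [DecidableEq ι] : List (Gate ι) → Op ι
  | [] => 1
  | g :: G => circuitMatrix G * Matrix.of g.entry

theorem sum_entry {ι : Type} [Fintype ι] [DecidableEq ι] (g : Gate ι) (y : ι → Bool)
    (φ : (ι → Bool) → ℂ) : ∑ z, φ z * g.entry z y =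
      ∑ s : Bool, φ (Function.update y g.target s) * g.mat y s (y g.target) := by
  have hinj : Function.Injective fun s : Bool => Function.update y g.target s :=
    fun s s' h => by simpa using congrFun h g.target
  rw [← Finset.sum_subset (Finset.subset_univ (Finset.univ.map ⟨_, hinj⟩)), Finset.sum_map]
  · refine Finset.sum_congr rfl fun s _ => ?_
    simp only [Function.Embedding.coeFn_mk]
    rw [Gate.entry_eq, if_pos]
    · simp
    · intro v hv
      rw [Function.update_of_ne hv]
  · intro z _ hz
    rw [Gate.entry_eq, if_neg, mul_zero]
    intro h
    apply hz
    simp only [Finset.mem_map, Finset.mem_univ, true_and, Function.Embedding.coeFn_mk]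
    refine ⟨z g.target, ?_⟩
    funext w
    by_cases hw : w = g.target
    · subst hw; simp
    · rw [Function.update_of_ne hw]
      exact (h w hw).symm

theorem pull_eq_sum_circuitMatrix {ι : Type} [Fintype ι] [DecidableEq ι]
    (Q : (ι → Bool) → (ι → Bool) → ℂ) (G : List (Gate ι)) : ∀ x x', pull G Q x x' =
      ∑ z, ∑ z', circuitMatrix G z x * star (circuitMatrix G z' x') * Q z z' := by
  induction G with
  | nil =>
    intro x x'
    simp [pull, circuitMatrix, Matrix.one_apply, apply_ite star]
  | cons g G ih =>
    intro x x'
    simp only [pull, ih, circuitMatrix, Matrix.mul_apply, Matrix.of_apply, sum_entry, star_sum]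
    simp only [Finset.mul_sum, Finset.sum_mul]
    simp only [Fintype.sum_bool, ← Finset.sum_add_distrib, star_mul']
    refine Finset.sum_congr rfl fun z _ => Finset.sum_congr rfl fun z' _ => ?_
    ring

theorem circuitChannel_id {ι : Type} [Fintype ι] [DecidableEq ι] (G : List (Gate ι)) (ρ : Op ι) :
    circuitChannel G id id ρ = circuitMatrix G * ρ * (circuitMatrix G).conjTranspose := by
  have h : ∀ b : ι → Bool, inputConfig id b = b := fun b =>
    funext fun i => inputConfig_apply Function.injective_id b i
  ext y y'
  rw [circuitChannel_apply _ Function.injective_id]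
  simp only [h, pull_eq_sum_circuitMatrix]
  have e : ∀ z z' : ι → Bool, selectKernel id y y' z z' = if z = y ∧ z' = y' then 1 else 0 :=
    fun z z' => selectKernel_eq_ite (by simp [funext_iff])
  simp only [e, Matrix.mul_apply, Matrix.conjTranspose_apply, mul_ite, mul_one, mul_zero, ite_and,
    Finset.sum_mul]
  simp only [Finset.sum_ite_irrel, Finset.sum_const_zero, Finset.sum_ite_eq', Finset.mem_univ, if_true]
  rw [Finset.sum_comm]
  exact Finset.sum_congr rfl fun b _ => Finset.sum_congr rfl fun b' _ => by ring

open Classical in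
/-- The one-qubit matrix that a layer of controlled Hadamard gates with controls `ctrl` applies. -/
noncomputable def chadMat {ι : Type} (ctrl : ι → ι) (y : ι → Bool) (v : ι) : Bool → Bool → ℂ :=
  if y (ctrl v) = true then hadEntry else fun s s' => if s = s' then 1 else 0

/-- All targets lie in `u` and all controls outside, so no gate disturbs the control of another and
the layer acts as a product of one-qubit matrices. -/
theorem circuitMatrix_chad {ι : Type} [Fintype ι] [DecidableEq ι] {ctrl : ι → ι} {u : Finset ι}
    (hu : ∀ v, ctrl v ∉ u) (l : List ι) : l.Nodup → (∀ v ∈ l, v ∈ u) →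
    circuitMatrix (l.map fun v => Gate.chad (ctrl v) v) = localProd l.toFinset (chadMat ctrl) := by
  have hm : ∀ y y' : ι → Bool, (∀ v, v ∉ u → y v = y' v) → chadMat ctrl y = chadMat ctrl y' := by
    intro y y' h
    funext v
    have : y (ctrl v) = y' (ctrl v) := h _ (hu v)
    simp [chadMat, this]
  induction l with
  | nil => intro _ _; exact (localProd_empty _).symm
  | cons v l ih =>
    intro hl hlu
    have hg : (Matrix.of (Gate.chad (ctrl v) v).entry : Op ι) = localProd {v} (chadMat ctrl) := by
      ext x y
      have hne : ctrl v ≠ v := fun h => hu v (h.symm ▸ hlu v (by simp))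
      simp only [Matrix.of_apply, Gate.entry_eq, localProd, Finset.mem_singleton,
        Finset.prod_singleton, Gate.target]
      simp [Gate.mat, chadMat, hne]
    have h1 : Disjoint l.toFinset {v} := by simpa using (List.nodup_cons.mp hl).1
    have h2 : {v} ⊆ u := Finset.singleton_subset_iff.mpr (hlu v (by simp))
    rw [List.map_cons, circuitMatrix, ih hl.of_cons fun w hw => hlu w (by simp [hw]), hg,
      localProd_mul h1 h2 hm, List.toFinset_cons, Finset.union_comm]
    rfl

/-! ### Conjugate coding -/

theorem hadEntry_comm (s t : Bool) : hadEntry s t = hadEntry t s := by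
  cases s <;> cases t <;> rfl

theorem star_hadEntry (s t : Bool) : star (hadEntry s t) = hadEntry s t := by
  unfold hadEntry
  split_ifs <;> simp

theorem star_conjugateCoding (θ s y : Bool) :
    star (conjugateCoding θ s y) = conjugateCoding θ s y := by
  unfold conjugateCoding
  split_ifs <;> simp [star_hadEntry]

theorem hadEntry_mul_self (s t : Bool) : hadEntry s t * hadEntry s t = 2⁻¹ := by
  have h : ((Real.sqrt 2 : ℝ) : ℂ)⁻¹ * ((Real.sqrt 2 : ℝ) : ℂ)⁻¹ = 2⁻¹ := by
    rw [← mul_inv, ← Complex.ofReal_mul, Real.mul_self_sqrt (by norm_num)]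
    norm_num
  unfold hadEntry
  split_ifs
  · rw [neg_mul_neg, h]
  · exact h

theorem sum_conjugateCoding_mul_self (θ s : Bool) :
    ∑ y, conjugateCoding θ s y * conjugateCoding θ s y = 1 := by
  cases θ
  · cases s <;> simp [conjugateCoding]
  · simp only [conjugateCoding, if_true, hadEntry_mul_self, Fintype.sum_bool]
    norm_num

/-- The amplitudes of a string `z` encoded in the bases `θ`. -/
noncomputable def codeAmp {P : Type} [Fintype P] (θ z p : P → Bool) : ℂ :=
  ∏ q, conjugateCoding (θ q) (z q) (p q)

theorem star_codeAmp {P : Type} [Fintype P] (θ z p : P → Bool) :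
    star (codeAmp θ z p) = codeAmp θ z p := by
  simp [codeAmp, star_prod, star_conjugateCoding]

/-- The matrix elements of a state in the encoding of `z` in the bases `θ`, with the second register
in the state `c`. -/
noncomputable def codeWeight {P C : Type} [Fintype P] [DecidableEq P] (θ z : P → Bool) (c : C → Bool)
    (ρ : Op (P ⊕ C)) : ℂ :=
  ∑ p, ∑ p', codeAmp θ z p * codeAmp θ z p' * ρ (Sum.elim p c) (Sum.elim p' c)

open Classical in
/-- One-qubit projectors: on the encoding of `z` in the bases `θ` in the first register, on the
basis state `c` in the second one. -/
noncomputable def codeMat {P C : Type} (θ z : P → Bool) (c : C → Bool) (_ : P ⊕ C → Bool) :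
    P ⊕ C → Bool → Bool → ℂ :=
  Sum.elim (fun q s t => conjugateCoding (θ q) (z q) s * star (conjugateCoding (θ q) (z q) t))
    (fun q s t => if s = t ∧ s = c q then 1 else 0)

theorem localProd_univ_codeMat {P C : Type} [Fintype P] [Fintype C] [DecidableEq C]
    (θ z : P → Bool) (c : C → Bool) (p p' : P → Bool) (d d' : C → Bool) :
    localProd Finset.univ (codeMat θ z c) (Sum.elim p d) (Sum.elim p' d') =
      codeAmp θ z p * codeAmp θ z p' * if d = c ∧ d' = c then 1 else 0 := by
  simp only [localProd, Matrix.of_apply, Finset.mem_univ, not_true_eq_false, false_imp_iff,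
    implies_true, if_true, Fintype.prod_sum_type, codeMat, Sum.elim_inl, Sum.elim_inr,
    Finset.prod_mul_distrib, star_conjugateCoding, codeAmp]
  congr 1
  by_cases h : d = c ∧ d' = c
  · rw [if_pos h]
    obtain ⟨rfl, rfl⟩ := h
    simp
  · rw [if_neg h]
    have : ∃ q, ¬ (d q = d' q ∧ d q = c q) := by
      by_contra! h'
      exact h ⟨funext fun q => (h' q).2, funext fun q => (h' q).1.symm.trans (h' q).2⟩
    obtain ⟨q, hq⟩ := this
    exact Finset.prod_eq_zero (Finset.mem_univ q) (if_neg hq)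

theorem sum_codeAmp_mul_self {P : Type} [Fintype P] [DecidableEq P] (θ z : P → Bool) :
    ∑ p, codeAmp θ z p * codeAmp θ z p = 1 := by
  simp only [codeAmp, ← Finset.prod_mul_distrib]
  rw [← Fintype.prod_sum fun q s => conjugateCoding (θ q) (z q) s * conjugateCoding (θ q) (z q) s]
  simp only [sum_conjugateCoding_mul_self, Finset.prod_const_one]

/-- On all qubits the operator is the rank-one projector onto a normalised product vector, so the
trace is the expectation of `ρ` in that vector. The amplitudes are real, which is why no conjugates
appear in the weight. -/
theorem trace_localProd_univ_codeMat {P C : Type} [Fintype P] [DecidableEq P] [Fintype C]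
    [DecidableEq C] (θ z : P → Bool) (c : C → Bool) (ρ : Op (P ⊕ C)) :
    (localProd Finset.univ (codeMat θ z c) * ρ * localProd Finset.univ (codeMat θ z c)).trace =
      codeWeight θ z c ρ := by
  have hK : localProd Finset.univ (codeMat θ z c) * localProd Finset.univ (codeMat θ z c) =
      localProd Finset.univ (codeMat θ z c) := by
    ext x y
    obtain ⟨p, d, rfl⟩ : ∃ p d, x = Sum.elim p d := ⟨_, _, (Sum.elim_comp_inl_inr x).symm⟩
    obtain ⟨p', d', rfl⟩ : ∃ p d, y = Sum.elim p d := ⟨_, _, (Sum.elim_comp_inl_inr y).symm⟩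
    simp only [Matrix.mul_apply, sum_sumArrow, localProd_univ_codeMat]
    rw [Finset.sum_comm, Finset.sum_eq_single c]
    · have e : ∀ b, codeAmp θ z p * codeAmp θ z b * (if d = c ∧ c = c then (1 : ℂ) else 0) *
          (codeAmp θ z b * codeAmp θ z p' * if c = c ∧ d' = c then 1 else 0) =
          (codeAmp θ z p * codeAmp θ z p' * if d = c ∧ d' = c then 1 else 0) *
          (codeAmp θ z b * codeAmp θ z b) := by
        intro b
        by_cases h1 : d = c <;> by_cases h2 : d' = c <;> (simp [h1, h2]; try ring)
      refine (Finset.sum_congr rfl fun b _ => e b).trans ?_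
      rw [← Finset.mul_sum, sum_codeAmp_mul_self, mul_one]
    · intro b _ hb
      simp [hb]
    · simp
  rw [Matrix.trace_mul_comm, ← Matrix.mul_assoc, hK]
  simp only [Matrix.trace, Matrix.diag, Matrix.mul_apply, sum_sumArrow, localProd_univ_codeMat,
    codeWeight]
  rw [Finset.sum_comm, Finset.sum_eq_single c, Finset.sum_comm]
  · simp only [true_and, mul_ite, mul_one, mul_zero, ite_mul, zero_mul, Finset.sum_ite_eq',
      Finset.mem_univ, if_true]
    refine Finset.sum_congr rfl fun p _ => Finset.sum_congr rfl fun p' _ => ?_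
    ring
  · intro d _ hd
    simp [hd]
  · simp

/-! ### Sequences of local operations -/

/-- Since the one-qubit matrices do not depend on the configuration, products over disjoint blocks
commute. The successive operations merge into a single one on the union of the blocks, whatever
their order, and the scalars are collected in front. -/
theorem foldl_localProd {ι J : Type} [Fintype ι] [DecidableEq ι] [DecidableEq J]
    {m : (ι → Bool) → ι → Bool → Bool → ℂ} (hm : ∀ y y', m y = m y') (U : J → Finset ι)
    (hU : Pairwise fun i j => Disjoint (U i) (U j)) (p : J → ℂ) (l : List J) (hl : l.Nodup) :
    ∀ ρ : Op ι, l.foldl (fun ρ i => p i • (localProd (U i) m * ρ * localProd (U i) m)) ρ =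
      (l.map p).prod • (localProd (l.toFinset.biUnion U) m * ρ *
        localProd (l.toFinset.biUnion U) m) := by
  induction l with
  | nil =>
    intro ρ
    simp [localProd_empty]
  | cons i l ih =>
    intro ρ
    have hd : Disjoint (U i) (l.toFinset.biUnion U) := by
      rw [Finset.disjoint_biUnion_right]
      intro j hj
      refine hU fun h => (List.nodup_cons.mp hl).1 ?_
      rw [h]
      exact List.mem_toFinset.mp hj
    have hm' : ∀ y y' : ι → Bool, (∀ v, v ∉ Finset.univ → y v = y' v) → m y = m y' :=
      fun y y' _ => hm y y'
    rw [List.foldl_cons, ih hl.of_cons, List.map_cons, List.prod_cons, List.toFinset_cons,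
      Finset.biUnion_insert, ← localProd_mul hd (Finset.subset_univ _) hm',
      Matrix.mul_smul, Matrix.smul_mul, smul_smul, mul_comm (p i)]
    congr 1
    rw [localProd_mul hd (Finset.subset_univ _) hm', Finset.union_comm]
    nth_rewrite 1 [← localProd_mul hd.symm (Finset.subset_univ _) hm']
    rw [Finset.union_comm, ← localProd_mul hd (Finset.subset_univ _) hm']
    simp only [Matrix.mul_assoc]

/-! ### Measuring commitments -/

/-- The layer is block diagonal in the message bits, which only serve as controls. On the block of
`a` it changes from the bases prescribed by `a` to the computational basis; symmetry of the Hadamard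
matrix identifies its entries with coding amplitudes. -/
theorem circuitMatrix_commit {A P : Type} [Fintype A] [DecidableEq A] [Fintype P] [DecidableEq P]
    (ctrl : P → A) {l : List P} (hl : l.Nodup) (hmem : ∀ q, q ∈ l) (a a' : A → Bool)
    (z p : P → Bool) :
    circuitMatrix (l.map fun q => Gate.chad (Sum.inl (ctrl q) : A ⊕ P) (Sum.inr q)) (Sum.elim a z)
      (Sum.elim a' p) = if a = a' then codeAmp (a ∘ ctrl) z p else 0 := by
  -- The values of `ctrl` on message bits are never used as controls; they only have to stay outside
  -- the set of targets.
  have h := circuitMatrix_chad (ctrl := Sum.elim Sum.inl (Sum.inl ∘ ctrl))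
    (u := Finset.univ.image (Sum.inr : P → A ⊕ P)) (by rintro (v | v) <;> simp)
    (l.map Sum.inr) (hl.map Sum.inr_injective) (by simp)
  have hs : (l.map (Sum.inr : P → A ⊕ P)).toFinset = Finset.univ.image Sum.inr := by
    ext v
    simp [hmem]
  rw [List.map_map, hs] at h
  refine (congrFun (congrFun h _) _).trans ?_
  simp only [localProd, Matrix.of_apply]
  by_cases ha : a = a'
  · subst ha
    rw [if_pos (by rintro (v | v) <;> simp), if_pos rfl,
      Finset.prod_image fun _ _ _ _ h => Sum.inr_injective h]
    refine Finset.prod_congr rfl fun q _ => ?_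
    simp only [chadMat, Sum.elim_inl, Sum.elim_inr, Function.comp_apply, conjugateCoding]
    by_cases h1 : a (ctrl q) = true
    · refine (congrFun (congrFun (if_pos h1) _) _).trans ?_
      rw [if_pos h1, hadEntry_comm]
    · refine (congrFun (congrFun (if_neg h1) _) _).trans ?_
      rw [if_neg h1]
      exact if_congr eq_comm rfl rfl
  · rw [if_neg ha, if_neg]
    intro h
    exact ha (funext fun i => h (Sum.inl i) (by simp))

theorem commit_apply {A P : Type} [Fintype A] [DecidableEq A] [Fintype P] [DecidableEq P]
    (ctrl : P → A) {l : List P} (hl : l.Nodup) (hmem : ∀ q, q ∈ l) (ρ : Op (A ⊕ P))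
    (r : A ⊕ P → Bool) :
    circuitChannel (l.map fun q => Gate.chad (Sum.inl (ctrl q) : A ⊕ P) (Sum.inr q)) id id ρ r r =
      ∑ p, ∑ p', codeAmp (r ∘ Sum.inl ∘ ctrl) (r ∘ Sum.inr) p *
        codeAmp (r ∘ Sum.inl ∘ ctrl) (r ∘ Sum.inr) p' *
        ρ (Sum.elim (r ∘ Sum.inl) p) (Sum.elim (r ∘ Sum.inl) p') := by
  obtain ⟨a, z, rfl⟩ : ∃ a z, r = Sum.elim a z := ⟨_, _, (Sum.elim_comp_inl_inr r).symm⟩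
  rw [Sum.elim_comp_inl, Sum.elim_comp_inr, ← Function.comp_assoc, Sum.elim_comp_inl]
  rw [circuitChannel_id]
  simp only [Matrix.mul_apply, Matrix.conjTranspose_apply, sum_sumArrow,
    circuitMatrix_commit ctrl hl hmem, apply_ite star, star_zero, star_codeAmp, ite_mul, zero_mul,
    mul_ite, mul_zero, Finset.sum_ite_irrel, Finset.sum_const_zero, Finset.sum_ite_eq,
    Finset.mem_univ, if_true, Finset.sum_mul]
  rw [Finset.sum_comm]
  exact Finset.sum_congr rfl fun p _ => Finset.sum_congr rfl fun p' _ => by ring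

namespace PublicCoinProof

variable (I : PublicCoinProof) (N : ℕ → ℕ)

/-- The bit of the prover messages to which a qubit of the commitment registers belongs. -/
def commitBit {n : ℕ} (q : (I.commitReg N).Idx n) : I.ansReg.Idx n := (q.1.castSucc, q.2.1)

/-- Measuring the commitment register as in commitments to the messages in the first register. -/
noncomputable def commitChan (n : ℕ) (σ : Op ((I.rrReply N).Idx n)) : Op ((I.rrReply N).Idx n) :=
  Matrix.diagonal fun r => ∑ p, ∑ p',
    codeAmp (r ∘ Sum.inl ∘ I.commitBit N) (r ∘ Sum.inr) p *
      codeAmp (r ∘ Sum.inl ∘ I.commitBit N) (r ∘ Sum.inr) p' *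
        σ (Sum.elim (r ∘ Sum.inl) p) (Sum.elim (r ∘ Sum.inl) p')

variable {N}

theorem enumerable_rrReply (hN : PolyTimeLength N) : (I.rrReply N).Enumerable :=
  I.enumerable_ansReg.sum (I.enumerable_commitReg hN)

theorem enumerable_rrQuery (hN : PolyTimeLength N) : (I.rrQuery N).Enumerable :=
  (I.enumerable_commitReg hN).sum I.enumerable_chalReg

/-- Controlled Hadamard gates rotate the prescribed bases to the computational one, and copying the
joint register to the output wires then measures it, leaving the message bits readable in the
answer. -/
theorem polyTime_commitChan (hN : PolyTimeLength N) :
    PolyTime (I.rrReply N) (I.rrReply N) fun x => I.commitChan N x.length := by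
  obtain ⟨l, hl, hmem, hT⟩  := I.enumerable_rrReply hN
  let G₀ : ∀ x : List Bool, List (Gate ((I.rrReply N).Idx x.length)) := fun x =>
    (cellList (I.rounds x.length) (I.msgLen x.length) (N x.length)).map fun q =>
      Gate.chad (Sum.inl (I.commitBit N q)) (Sum.inr q)
  let inp := fun (x : List Bool) i => tagWire 0 ((I.rrReply N).label x.length i)
  let out := fun (x : List Bool) i => tagWire 1 ((I.rrReply N).label x.length i)
  refine polyTime_iff.mpr ⟨fun x => (G₀ x).map (Gate.map (inp x)) ++
    copyGates (inp x) (out x) (l x.length), ?_, fun x => ?_⟩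
  -- Among the input wires, `[0, 0]` names the messages and `[0, 1]` the commitment qubits. As
  -- `castSucc` keeps the round number, the control of the cell `(i, j, k)` is the message cell `(i,
  -- j)`.
  · convert (PolyCircuit.cellLoop I.rounds_polyTime I.msgLen_polyTime hN
      [.chad ([0, 0], [0, 1]) ([0, 1], [0, 1, 2])]).append
      (hT [.cnot (List.cons 0) (List.cons 1)]) using 2 with x
    · congr 1
      · exact List.map_map.trans List.map_eq_flatMap
      · simp only [copyGates]
        rw [List.map_eq_flatMap]
        rfl
  · funext ρ
    have hinp : Function.Injective (inp x) := tag_label_injective 0 _ _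
    have hout : Function.Injective (out x) := tag_label_injective 1 _ _
    have h := circuitChannel_append ((G₀ x).map (Gate.map (inp x)))
      (copyGates (inp x) (out x) (l x.length)) hinp hinp (out := out x)
      (Set.range (inp x)) Set.univ (fun g hg w => mem_range_of_mem_map hg)
      (fun _ _ _ _ => Set.mem_univ _) (fun i => ⟨i, rfl⟩) (fun _ => Set.mem_univ _)
      (fun _ => Set.mem_univ _) (fun w hw _ => hw) ρ
    have h1 : circuitChannel ((G₀ x).map (Gate.map (inp x))) (inp x) (inp x) =
        circuitChannel (G₀ x) id id :=
      circuitChannel_map hinp (G₀ x) Function.injective_id id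
    rw [h1, circuitChannel_copyGates _ (hl _) (hmem _)
      (hinp.sumElim hout fun i j h => absurd (tagWire_inj h).1 (by decide))] at h
    refine Eq.trans ?_ h.symm
    refine congrArg Matrix.diagonal (funext fun r => ?_)
    exact (commit_apply (I.commitBit N) (cellList_nodup _ _ _) (mem_cellList _ _ _) ρ r).symm

end PublicCoinProof

/-! ### The branches of prover and simulator as projections on disjoint blocks -/

namespace PublicCoinProof

variable (I : PublicCoinProof) (N : ℕ → ℕ)

/-- The qubits of the commitment registers, in the verifier's message. -/
def commitWire {n : ℕ} (q : (I.commitReg N).Idx n) : (I.rrQuery N).Idx n := Sum.inl q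

/-- The qubits of the challenge registers, in the verifier's message. -/
def chalWire {n : ℕ} (q : I.chalReg.Idx n) : (I.rrQuery N).Idx n := Sum.inr q

theorem commitWire_injective (n : ℕ) :
    Function.Injective (I.commitWire N : (I.commitReg N).Idx n → _) := Sum.inl_injective

theorem chalWire_injective (n : ℕ) :
    Function.Injective (I.chalWire N : I.chalReg.Idx n → _) := Sum.inr_injective

/-- The qubits of `Pᵢ`. -/
def commitBlock {n : ℕ} (i : Fin (I.rounds n)) : Finset ((I.rrQuery N).Idx n) :=
  Finset.univ.image fun u : Fin (I.msgLen n) × Fin (N n) => I.commitWire N (i, u)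

/-- The qubits of `Cᵢ`. -/
def chalBlock {n : ℕ} (i : Fin (I.rounds n)) : Finset ((I.rrQuery N).Idx n) :=
  Finset.univ.image fun j : Fin (I.chalLen n) => I.chalWire N (i, j)

theorem commitWire_mem_commitBlock {n : ℕ} (i : Fin (I.rounds n)) (q : (I.commitReg N).Idx n) :
    I.commitWire N q ∈ I.commitBlock N i ↔ q.1 = i := by
  rw [commitBlock, Finset.mem_image]
  constructor
  · rintro ⟨u, -, h⟩
    rw [← I.commitWire_injective N n h]
  · rintro rfl
    exact ⟨q.2, Finset.mem_univ _, rfl⟩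

theorem chalWire_notMem_commitBlock {n : ℕ} (i : Fin (I.rounds n)) (q : I.chalReg.Idx n) :
    I.chalWire N q ∉ I.commitBlock N i := by
  rw [commitBlock, Finset.mem_image]
  rintro ⟨u, -, h⟩
  cases h

theorem chalWire_mem_chalBlock {n : ℕ} (i : Fin (I.rounds n)) (q : I.chalReg.Idx n) :
    I.chalWire N q ∈ I.chalBlock N i ↔ q.1 = i := by
  rw [chalBlock, Finset.mem_image]
  constructor
  · rintro ⟨u, -, h⟩
    rw [← I.chalWire_injective N n h]
  · rintro rfl
    exact ⟨q.2, Finset.mem_univ _, rfl⟩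

theorem commitWire_notMem_chalBlock {n : ℕ} (i : Fin (I.rounds n)) (q : (I.commitReg N).Idx n) :
    I.commitWire N q ∉ I.chalBlock N i := by
  rw [chalBlock, Finset.mem_image]
  rintro ⟨u, -, h⟩
  cases h

/-- The one-qubit projectors on the branch `(a, z, c)`. -/
noncomputable def branchMat {n : ℕ} (a : I.ansReg.Idx n → Bool)
    (z : (I.commitReg N).Idx n → Bool) (c : I.chalReg.Idx n → Bool) :
    ((I.rrQuery N).Idx n → Bool) → (I.rrQuery N).Idx n → Bool → Bool → ℂ :=
  codeMat (a ∘ I.commitBit N) z c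

theorem localProd_mul_branchMat {n : ℕ} {s t : Finset ((I.rrQuery N).Idx n)} (h : Disjoint s t)
    (a : I.ansReg.Idx n → Bool) (z : (I.commitReg N).Idx n → Bool) (c : I.chalReg.Idx n → Bool) :
    localProd s (I.branchMat N a z c) * localProd t (I.branchMat N a z c) =
      localProd (s ∪ t) (I.branchMat N a z c) :=
  localProd_mul h (Finset.subset_univ t) fun _ _ _ => rfl

theorem trace_localProd_univ_branchMat {n : ℕ} (a : I.ansReg.Idx n → Bool)
    (z : (I.commitReg N).Idx n → Bool) (c : I.chalReg.Idx n → Bool)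
    (ρ : Op ((I.rrQuery N).Idx n)) :
    (localProd Finset.univ (I.branchMat N a z c) * ρ *
      localProd Finset.univ (I.branchMat N a z c)).trace = codeWeight (a ∘ I.commitBit N) z c ρ :=
  trace_localProd_univ_codeMat _ _ _ _

/-- The challenge string `c` is arbitrary here. Writing all projectors of a branch through the one
family `branchMat` is what allows them to be multiplied with each other. -/
theorem commitProj_eq {n : ℕ} (a : I.ansReg.Idx n → Bool) (z : (I.commitReg N).Idx n → Bool)
    (c : I.chalReg.Idx n → Bool) (i : Fin (I.rounds n)) :
    I.commitProj N a z i = localProd (I.commitBlock N i) (I.branchMat N a z c) := by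
  ext x y
  have hiff : (∀ v, v ∉ I.commitBlock N i → x v = y v) ↔
      (∀ q : (I.commitReg N).Idx n, q.1 ≠ i → x (Sum.inl q) = y (Sum.inl q)) ∧
        (∀ q : I.chalReg.Idx n, x (Sum.inr q) = y (Sum.inr q)) := by
    constructor
    · intro h
      exact ⟨fun q hq => h _ fun h' => hq ((I.commitWire_mem_commitBlock N i q).mp h'),
        fun q => h _ (I.chalWire_notMem_commitBlock N i q)⟩
    · rintro ⟨h1, h2⟩ (q | q) hq
      · exact h1 q fun h => hq ((I.commitWire_mem_commitBlock N i q).mpr h)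
      · exact h2 q
  by_cases h : ∀ v, v ∉ I.commitBlock N i → x v = y v
  · rw [localProd_apply_of_eq h]
    refine (if_pos (hiff.mp h)).trans ?_
    rw [commitBlock, Finset.prod_image, Fintype.prod_prod_type]
    · rfl
    · intro u _ v _ h
      exact (Prod.ext_iff.mp (I.commitWire_injective N n h)).2
  · rw [localProd_apply_of_ne h]
    exact if_neg fun h' => h (hiff.mpr h')

theorem chalProj_eq {n : ℕ} (a : I.ansReg.Idx n → Bool) (z : (I.commitReg N).Idx n → Bool)
    (c : I.chalReg.Idx n → Bool) (i : Fin (I.rounds n)) :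
    I.chalProj N c i = localProd (I.chalBlock N i) (I.branchMat N a z c) := by
  ext x y
  have e : ∏ v ∈ I.chalBlock N i, I.branchMat N a z c y v (x v) (y v) =
      ∏ j : Fin (I.chalLen n), if x (I.chalWire N (i, j)) = y (I.chalWire N (i, j)) ∧
        x (I.chalWire N (i, j)) = c (i, j) then (1 : ℂ) else 0 := by
    rw [chalBlock, Finset.prod_image]
    · exact Finset.prod_congr rfl fun j _ => if_congr Iff.rfl rfl rfl
    · intro u _ v _ h
      exact (Prod.ext_iff.mp (I.chalWire_injective N n h)).2
  by_cases h : x = y ∧ ∀ j : Fin (I.chalLen n), x (I.chalWire N (i, j)) = c (i, j)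
  · refine (if_pos h).trans ?_
    rw [localProd_apply_of_eq fun v _ => congrFun h.1 v, e]
    exact (Finset.prod_eq_one fun j _ => if_pos ⟨congrFun h.1 _, h.2 j⟩).symm
  · refine (if_neg h).trans ?_
    by_cases h1 : ∀ v, v ∉ I.chalBlock N i → x v = y v
    · rw [localProd_apply_of_eq h1, e]
      have : ∃ j : Fin (I.chalLen n), ¬ (x (I.chalWire N (i, j)) = y (I.chalWire N (i, j)) ∧
          x (I.chalWire N (i, j)) = c (i, j)) := by
        by_contra! h'
        refine h ⟨funext fun v => ?_, fun j => (h' j).2⟩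
        by_cases hv : v ∈ I.chalBlock N i
        · obtain ⟨j, -, rfl⟩ := Finset.mem_image.mp hv
          exact (h' j).1
        · exact h1 v hv
      obtain ⟨j, hj⟩ := this
      exact (Finset.prod_eq_zero (Finset.mem_univ j) (if_neg hj)).symm
    · rw [localProd_apply_of_ne h1]

theorem disjoint_commitBlock {n : ℕ} {i j : Fin (I.rounds n)} (h : i ≠ j) :
    Disjoint (I.commitBlock N i) (I.commitBlock N j) := by
  rw [Finset.disjoint_left]
  rintro (q | q) hi hj
  · exact h (((I.commitWire_mem_commitBlock N i q).mp hi).symm.trans ((I.commitWire_mem_commitBlock N j q).mp hj))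
  · exact I.chalWire_notMem_commitBlock N i q hi

theorem disjoint_chalBlock {n : ℕ} {i j : Fin (I.rounds n)} (h : i ≠ j) :
    Disjoint (I.chalBlock N i) (I.chalBlock N j) := by
  rw [Finset.disjoint_left]
  rintro (q | q) hi hj
  · exact I.commitWire_notMem_chalBlock N i q hi
  · exact h (((I.chalWire_mem_chalBlock N i q).mp hi).symm.trans ((I.chalWire_mem_chalBlock N j q).mp hj))

theorem disjoint_commitBlock_chalBlock {n : ℕ} (i j : Fin (I.rounds n)) :
    Disjoint (I.commitBlock N i) (I.chalBlock N j) := by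
  rw [Finset.disjoint_left]
  rintro (q | q) hi hj
  · exact I.commitWire_notMem_chalBlock N j q hj
  · exact I.chalWire_notMem_commitBlock N i q hi

theorem biUnion_blocks (n : ℕ) : (List.finRange (I.rounds n)).toFinset.biUnion
    (fun i => I.chalBlock N i ∪ I.commitBlock N i) = Finset.univ := by
  ext v
  simp only [Finset.mem_biUnion, List.mem_toFinset, List.mem_finRange, true_and, Finset.mem_univ,
    iff_true, Finset.mem_union]
  rcases v with q | q
  · exact ⟨q.1, Or.inr ((I.commitWire_mem_commitBlock N _ q).mpr rfl)⟩
  · exact ⟨q.1, Or.inl ((I.chalWire_mem_chalBlock N _ q).mpr rfl)⟩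

/-- On a fixed branch the adaptivity of the prover has disappeared: every basis is given by `a` and
every conditional probability is a number. The projectors combine to the rank-one projector of the
branch, and the probabilities multiply to that of the transcript with challenges `c`. -/
theorem trace_rrBranch (x w : List Bool) (a : I.ansReg.Idx x.length → Bool)
    (z : (I.commitReg N).Idx x.length → Bool) (c : I.chalReg.Idx x.length → Bool)
    (ρ : Op ((I.rrQuery N).Idx x.length)) :
    (I.rrBranch N x w a z c ρ).trace =
      (I.transcriptProb x w a c : ℂ) * codeWeight (a ∘ I.commitBit N) z c ρ := by
  -- Within a round, the commitment and the challenge measurements act on disjoint qubits and are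
  -- merged into one block.
  have hstep : (fun (ρ : Op ((I.rrQuery N).Idx x.length)) i =>
      (I.nextProb x w a c i.succ : ℂ) •
        (I.chalProj N c i * (I.commitProj N a z i * ρ * I.commitProj N a z i) * I.chalProj N c i)) =
      fun ρ i => (I.nextProb x w a c i.succ : ℂ) •
        (localProd (I.chalBlock N i ∪ I.commitBlock N i) (I.branchMat N a z c) * ρ *
          localProd (I.chalBlock N i ∪ I.commitBlock N i) (I.branchMat N a z c)) := by
    funext ρ i
    rw [I.commitProj_eq N a z c, I.chalProj_eq N a z c]
    nth_rewrite 1 [← I.localProd_mul_branchMat N (I.disjoint_commitBlock_chalBlock N i i).symm]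
    rw [Finset.union_comm, ← I.localProd_mul_branchMat N (I.disjoint_commitBlock_chalBlock N i i)]
    simp only [Matrix.mul_assoc]
  have h := foldl_localProd (fun _ _ => rfl) (m := I.branchMat N a z c)
    (fun i : Fin (I.rounds x.length) => I.chalBlock N i ∪ I.commitBlock N i) (fun i j hij => by
      refine Finset.disjoint_union_left.mpr ⟨Finset.disjoint_union_right.mpr
        ⟨I.disjoint_chalBlock N hij, (I.disjoint_commitBlock_chalBlock N j i).symm⟩,
        Finset.disjoint_union_right.mpr
        ⟨I.disjoint_commitBlock_chalBlock N i j, I.disjoint_commitBlock N hij⟩⟩)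
    (fun i => (I.nextProb x w a c i.succ : ℂ)) (List.finRange (I.rounds x.length))
    (List.nodup_finRange _) ((I.nextProb x w a c 0 : ℂ) • ρ)
  rw [← hstep, biUnion_blocks] at h
  refine (congrArg Matrix.trace h).trans ?_
  rw [Matrix.trace_smul, Matrix.mul_smul, Matrix.smul_mul, Matrix.trace_smul,
    trace_localProd_univ_branchMat, transcriptProb, Fin.prod_univ_succ, ← List.ofFn_eq_map,
    List.prod_ofFn, smul_eq_mul, smul_eq_mul]
  push_cast
  ring

/-- The grouped order of the simulator covers the same disjoint blocks as the alternating order of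
the prover, hence yields the same weight. Only the scalar differs, being the output probability of
`S`. -/
theorem trace_rrSimBranch
    (S : ∀ x : List Bool, Op (I.chalReg.Idx x.length) → Op (I.ansReg.Idx x.length))
    (x : List Bool) (a : I.ansReg.Idx x.length → Bool)
    (z : (I.commitReg N).Idx x.length → Bool) (c : I.chalReg.Idx x.length → Bool)
    (ρ : Op ((I.rrQuery N).Idx x.length)) :
    (I.rrSimBranch N S x a z c ρ).trace =
      I.simProb S x a c * codeWeight (a ∘ I.commitBit N) z c ρ := by
  have h := fun (ρ : Op ((I.rrQuery N).Idx x.length)) =>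
    foldl_localProd (fun _ _ => rfl) (m := I.branchMat N a z c)
    (fun i : Fin (I.rounds x.length) => I.commitBlock N i)
    (fun i j hij => I.disjoint_commitBlock N hij)
    (fun _ => 1) (List.finRange (I.rounds x.length)) (List.nodup_finRange _) ρ
  have h' := fun (ρ : Op ((I.rrQuery N).Idx x.length)) =>
    foldl_localProd (fun _ _ => rfl) (m := I.branchMat N a z c)
    (fun i : Fin (I.rounds x.length) => I.chalBlock N i)
    (fun i j hij => I.disjoint_chalBlock N hij)
    (fun _ => 1) (List.finRange (I.rounds x.length)) (List.nodup_finRange _) ρ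
  simp only [one_smul, ← I.commitProj_eq, ← I.chalProj_eq, List.map_const', List.prod_replicate,
    one_pow] at h h'
  refine (congrArg Matrix.trace ((congrArg (fun σ => (List.finRange (I.rounds x.length)).foldl
    (fun ρ i => I.commitProj N a z i * ρ * I.commitProj N a z i)
    (I.simProb S x a c • σ)) (h' ρ)).trans (h _))).trans ?_
  have hd : Disjoint ((List.finRange (I.rounds x.length)).toFinset.biUnion fun i =>
      I.commitBlock N i) ((List.finRange (I.rounds x.length)).toFinset.biUnion fun i =>
      I.chalBlock N i) := by
    simp only [Finset.disjoint_biUnion_left, Finset.disjoint_biUnion_right]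
    exact fun i _ j _ => I.disjoint_commitBlock_chalBlock N _ _
  have hU : ((List.finRange (I.rounds x.length)).toFinset.biUnion fun i =>
      I.commitBlock N i) ∪ ((List.finRange (I.rounds x.length)).toFinset.biUnion fun i =>
      I.chalBlock N i) = Finset.univ := by
    rw [← I.biUnion_blocks N x.length, Finset.union_comm]
    ext v
    simp only [Finset.mem_union, Finset.mem_biUnion]
    grind
  rw [Matrix.mul_smul, Matrix.smul_mul, Matrix.trace_smul, smul_eq_mul,
    ← trace_localProd_univ_branchMat, ← hU]
  nth_rewrite 2 [Finset.union_comm]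
  rw [← I.localProd_mul_branchMat N hd, ← I.localProd_mul_branchMat N hd.symm]
  simp only [Matrix.mul_assoc]

end PublicCoinProof

/-! ### Prover and simulator as one channel with two oracles -/

namespace PublicCoinProof

variable (I : PublicCoinProof) {N : ℕ → ℕ}

/-- The channel that answers the query in the challenge registers by the oracle `O` and then measures
the commitment registers. -/
noncomputable def answerAndCommit (N : ℕ → ℕ) {n : ℕ} (O : Op (I.chalReg.Idx n) → Op (I.ansReg.Idx n))
    (ρ : Op ((I.rrQuery N).Idx n)) : Op ((I.rrReply N).Idx n) :=
  I.commitChan N n (onFirst ((I.commitReg N).Idx n) O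
    (relabel (Equiv.sumComm (I.chalReg.Idx n) ((I.commitReg N).Idx n)) ρ))

/-- An oracle that measures its query sees only the diagonal blocks of the challenge register, so
each `c` contributes the weight of the commitment register on that block. -/
theorem answerAndCommit_eq {n : ℕ} (p : (I.ansReg.Idx n → Bool) → (I.chalReg.Idx n → Bool) → ℂ)
    (ρ : Op ((I.rrQuery N).Idx n)) :
    I.answerAndCommit N (fun ρ => Matrix.diagonal fun a => ∑ c, ρ c c * p a c) ρ =
      Matrix.diagonal fun r => ∑ c, p (r ∘ Sum.inl) c *
        codeWeight ((r ∘ Sum.inl) ∘ I.commitBit N) (r ∘ Sum.inr) c ρ := by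
  refine congrArg Matrix.diagonal (funext fun r => ?_)
  simp only [codeWeight, Finset.mul_sum]
  refine Eq.trans (Finset.sum_congr rfl fun z _ => Eq.trans
    (Finset.sum_congr rfl fun z' _ => ?_) Finset.sum_comm) Finset.sum_comm
  have e : ∀ (c : I.chalReg.Idx n → Bool) (z : (I.commitReg N).Idx n → Bool),
      Sum.elim c z ∘ (Equiv.sumComm (I.chalReg.Idx n) ((I.commitReg N).Idx n)).symm =
        Sum.elim z c := by
    intro c z
    funext i
    rcases i with i | i <;> rfl
  have h : onFirst ((I.commitReg N).Idx n)
      (fun ρ => Matrix.diagonal fun a => ∑ c, ρ c c * p a c)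
      (relabel (Equiv.sumComm (I.chalReg.Idx n) ((I.commitReg N).Idx n)) ρ)
      (Sum.elim (r ∘ Sum.inl) z) (Sum.elim (r ∘ Sum.inl) z') =
      ∑ c, ρ (Sum.elim z c) (Sum.elim z' c) * p (r ∘ Sum.inl) c := by
    simp only [onFirst, Matrix.of_apply, Sum.elim_comp_inl, Sum.elim_comp_inr,
      Matrix.diagonal_apply_eq]
    exact Finset.sum_congr rfl fun c _ => congrArg (· * _) (congrArg₂ ρ (e c z) (e c z'))
  refine (congrArg _ h).trans ?_
  rw [Finset.mul_sum]
  refine Finset.sum_congr rfl fun c _ => ?_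
  have hr : ∀ u v w : ℂ, u * (v * w) = w * (u * v) := fun u v w => by ring
  exact hr _ _ _

/-- This is the heart of the argument: although the honest prover commits before it learns the next
challenge, its channel is that of a prover who reads all challenges first and commits afterwards. -/
theorem rrProver_eq (x w : List Bool) :
    I.rrProver N x w = I.answerAndCommit N (I.realOracle x w) := by
  funext ρ
  refine Eq.trans ?_ (I.answerAndCommit_eq (fun a c => (I.transcriptProb x w a c : ℂ)) ρ).symm
  exact congrArg Matrix.diagonal (funext fun r => Finset.sum_congr rfl fun c _ =>
    I.trace_rrBranch N x w _ _ c ρ)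

theorem rrSimulator_eq (S : ∀ x : List Bool, Op (I.chalReg.Idx x.length) → Op (I.ansReg.Idx x.length))
    (x w : List Bool) :
    I.rrSimulator N S x = I.answerAndCommit N (I.simOracle S x w) := by
  funext ρ
  refine Eq.trans ?_ (I.answerAndCommit_eq (fun a c => I.simProb S x a c) ρ).symm
  exact congrArg Matrix.diagonal (funext fun r => Finset.sum_congr rfl fun c _ =>
    I.trace_rrSimBranch N S x _ _ c ρ)

/-- Measuring the query and the output means dephasing before and after `S`; a circuit channel is
linear, so on a dephased query it averages over basis states. The private input `[]` is a dummy, as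
the oracle ignores it. -/
theorem polyTime_simOracle
    {S : ∀ x : List Bool, Op (I.chalReg.Idx x.length) → Op (I.ansReg.Idx x.length)}
    (hS : PolyTime I.chalReg I.ansReg S) :
    PolyTime I.chalReg I.ansReg fun x => I.simOracle S x [] := by
  have h := (polyTime_dephase I.enumerable_ansReg).comp I.enumerable_ansReg
    (hS.comp I.enumerable_chalReg (polyTime_dephase I.enumerable_chalReg))
  convert h using 3 with x ρ
  refine congrArg Matrix.diagonal (funext fun a => ?_)
  obtain ⟨G, -, hG⟩ := polyTime_iff.mp hS
  simp only [simProb, hG, circuitChannel_apply _ (tag_label_injective 0 I.chalReg _)]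
  refine Finset.sum_congr rfl fun c _ => ?_
  rw [Finset.sum_eq_single c, Finset.sum_eq_single c, Finset.sum_eq_single c]
  · simp [basisState, dephase]
  · intro b _ hb
    simp [dephase, Matrix.diagonal_apply_ne _ hb.symm]
  · simp
  · intro b _ hb
    simp [basisState, hb]
  · simp
  · intro b _ hb
    simp [basisState, hb]
  · simp

theorem PolyTime.answerAndCommit (hN : PolyTimeLength N)
    {O : ∀ x : List Bool, Op (I.chalReg.Idx x.length) → Op (I.ansReg.Idx x.length)}
    (hO : PolyTime I.chalReg I.ansReg O) :
    PolyTime (I.rrQuery N) (I.rrReply N) fun x => I.answerAndCommit N (O x) :=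
  (I.polyTime_commitChan hN).comp (I.enumerable_rrReply hN)
    ((hO.onFirst (I.enumerable_commitReg hN)).comp
      (I.enumerable_chalReg.sum (I.enumerable_commitReg hN))
      (polyTime_sumComm (I.enumerable_commitReg hN) I.enumerable_chalReg))

theorem polyTime_rrSimulator (hN : PolyTimeLength N)
    {S : ∀ x : List Bool, Op (I.chalReg.Idx x.length) → Op (I.ansReg.Idx x.length)}
    (hS : PolyTime I.chalReg I.ansReg S) :
    PolyTime (I.rrQuery N) (I.rrReply N) (I.rrSimulator N S) := by
  convert PolyTime.answerAndCommit I hN (I.polyTime_simOracle hS) using 1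
  funext x
  exact I.rrSimulator_eq S x []

end PublicCoinProof

/-! ### Indistinguishability is preserved by composition -/

theorem onFirst_comp {ι κ μ : Type} (K : Type) (Φ : Op ι → Op κ) (Ψ : Op κ → Op μ)
    (σ : Op (ι ⊕ K)) : onFirst K (fun ρ => Ψ (Φ ρ)) σ = onFirst K Ψ (onFirst K Φ σ) := by
  ext x y
  simp only [onFirst, Matrix.of_apply, Sum.elim_comp_inl, Sum.elim_comp_inr]
  rfl

theorem onFirst_onFirst {ι κ : Type} (R K : Type) (Φ : Op ι → Op κ) (σ : Op ((ι ⊕ R) ⊕ K)) :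
    onFirst K (onFirst R Φ) σ = relabel (Equiv.sumAssoc κ R K)
      (onFirst (R ⊕ K) Φ (relabel (Equiv.sumAssoc ι R K).symm σ)) := by
  have e : ∀ (a : ι → Bool) (r : R → Bool) (k : K → Bool),
      Sum.elim a (Sum.elim r k) ∘ (Equiv.sumAssoc ι R K) = Sum.elim (Sum.elim a r) k := by
    intro a r k
    funext i
    rcases i with (i | i) | i <;> rfl
  have e' : ∀ x : (κ ⊕ R) ⊕ K → Bool, (x ∘ (Equiv.sumAssoc κ R K).symm) ∘ Sum.inr =
      Sum.elim (x ∘ Sum.inl ∘ Sum.inr) (x ∘ Sum.inr) := by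
    intro x
    funext i
    rcases i with i | i <;> rfl
  ext x y
  simp only [onFirst, relabel_apply, Matrix.of_apply, Equiv.symm_symm, e', e]
  rfl

theorem CompIndist.symm {A B : Register} {J : Set (List Bool × List Bool)}
    {Φ Ψ : ChannelFamily A B} (h : CompIndist J Φ Ψ) : CompIndist J Ψ Φ := by
  intro b
  obtain ⟨ε, hε, h⟩ := h b
  refine ⟨ε, hε, fun x w hxw K _ _ hK D hD σ hσ => ?_⟩
  rw [abs_sub_comm]
  exact h x w hxw K hK D hD σ hσ

theorem StatIndist.symm {A B : Register} {J : Set (List Bool × List Bool)}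
    {Φ Ψ : ChannelFamily A B} (h : StatIndist J Φ Ψ) : StatIndist J Ψ Φ := by
  obtain ⟨ε, hε, h⟩ := h
  refine ⟨ε, hε, fun x w hxw K _ _ D hD σ hσ => ?_⟩
  rw [abs_sub_comm]
  exact h x w hxw K D hD σ hσ

/-- Distinguishers may use any joint state of the input and the side register, so a channel applied
beforehand only replaces one admissible state by another. It need not be efficient. -/
theorem CompIndist.precomp {A B C : Register} {J : Set (List Bool × List Bool)}
    {Φ Ψ : ChannelFamily B C} (h : CompIndist J Φ Ψ)
    {Θ : ∀ x : List Bool, Op (A.Idx x.length) → Op (B.Idx x.length)} (hΘ : ∀ x, IsCPTP (Θ x)) :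
    CompIndist (A := A) (B := C) J (fun x w ρ => Φ x w (Θ x ρ)) (fun x w ρ => Ψ x w (Θ x ρ)) := by
  intro b
  obtain ⟨ε, hε, h⟩ := h b
  refine ⟨ε, hε, fun x w hxw K _ _ hK D hD σ hσ => ?_⟩
  rw [onFirst_comp, onFirst_comp]
  exact h x w hxw K hK D hD _ (((hΘ x).onFirst K).isDensity hσ)

theorem StatIndist.precomp {A B C : Register} {J : Set (List Bool × List Bool)}
    {Φ Ψ : ChannelFamily B C} (h : StatIndist J Φ Ψ)
    {Θ : ∀ x : List Bool, Op (A.Idx x.length) → Op (B.Idx x.length)} (hΘ : ∀ x, IsCPTP (Θ x)) :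
    StatIndist (A := A) (B := C) J (fun x w ρ => Φ x w (Θ x ρ)) (fun x w ρ => Ψ x w (Θ x ρ)) := by
  obtain ⟨ε, hε, h⟩ := h
  refine ⟨ε, hε, fun x w hxw K _ _ D hD σ hσ => ?_⟩
  rw [onFirst_comp, onFirst_comp]
  exact h x w hxw K D hD _ (((hΘ x).onFirst K).isDensity hσ)

theorem StatIndist.postcomp {A B C : Register} {J : Set (List Bool × List Bool)}
    {Φ Ψ : ChannelFamily A B} (h : StatIndist J Φ Ψ)
    {Θ : ∀ x : List Bool, Op (B.Idx x.length) → Op (C.Idx x.length)} (hΘ : ∀ x, IsCPTP (Θ x)) :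
    StatIndist (A := A) (B := C) J (fun x w ρ => Θ x (Φ x w ρ)) (fun x w ρ => Θ x (Ψ x w ρ)) := by
  obtain ⟨ε, hε, h⟩ := h
  refine ⟨ε, hε, fun x w hxw K _ _ D hD σ hσ => ?_⟩
  rw [onFirst_comp K (Φ x w), onFirst_comp K (Ψ x w)]
  exact h x w hxw K (fun τ => D (onFirst K (Θ x) τ)) (hD.comp ((hΘ x).onFirst K)) σ hσ

/-- The idle register becomes part of the distinguisher's side register, which in the statistical
case is unrestricted in size. -/
theorem StatIndist.onFirst {A B : Register} {J : Set (List Bool × List Bool)}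
    {Φ Ψ : ChannelFamily A B} (h : StatIndist J Φ Ψ) (R : Register) :
    StatIndist (A := A.sum R) (B := B.sum R) J (fun x w => onFirst (R.Idx x.length) (Φ x w))
      (fun x w => onFirst (R.Idx x.length) (Ψ x w)) := by
  obtain ⟨ε, hε, h⟩ := h
  refine ⟨ε, hε, fun x w hxw K _ _ D hD σ hσ => ?_⟩
  have := h x w hxw (R.Idx x.length ⊕ K)
    (fun τ => D (relabel (Equiv.sumAssoc (B.Idx x.length) (R.Idx x.length) K) τ))
    (hD.comp (isCPTP_relabel (Equiv.sumAssoc (B.Idx x.length) (R.Idx x.length) K)))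
    (relabel (Equiv.sumAssoc (A.Idx x.length) (R.Idx x.length) K).symm σ)
    ((isCPTP_relabel _).isDensity hσ)
  exact le_of_eq_of_le (congrArg₂ (fun ρ τ : Op ((B.sum R).Idx x.length ⊕ K) =>
    |(D ρ (fun _ => true) (fun _ => true)).re - (D τ (fun _ => true) (fun _ => true)).re|)
    (onFirst_onFirst _ K (Φ x w) σ) (onFirst_onFirst _ K (Ψ x w) σ)) this

theorem CompIndist.onFirst {A B : Register} {J : Set (List Bool × List Bool)}
    {Φ Ψ : ChannelFamily A B} (h : CompIndist J Φ Ψ) {R : Register}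
    (hR : PolyBounded fun n => Fintype.card (R.Idx n)) :
    CompIndist (A := A.sum R) (B := B.sum R) J (fun x w => onFirst (R.Idx x.length) (Φ x w))
      (fun x w => onFirst (R.Idx x.length) (Ψ x w)) := by
  intro b
  obtain ⟨b', hb'⟩ := hR
  -- The idle register `R`, of at most `b'` qubits, is added to the side register.
  obtain ⟨ε, hε, h⟩ := h (b' + b)
  refine ⟨ε, hε, fun x w hxw K _ _ hK D hD σ hσ => ?_⟩
  let e := Equiv.sumAssoc (B.Idx x.length) (R.Idx x.length) K
  have hprob : ∀ τ, MeasCircuit.prob ⟨D.gates, D.input ∘ e.symm,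
      D.input_inj.comp e.symm.injective, D.output⟩ τ = D.prob (relabel e τ) := fun τ =>
    congrArg (fun ρ : Op Unit => (ρ (fun _ => true) (fun _ => true)).re)
      (circuitChannel_comp_equiv D.gates D.input_inj _ e.symm τ)
  have := h x w hxw (R.Idx x.length ⊕ K) ?_ ⟨D.gates, D.input ∘ e.symm,
    D.input_inj.comp e.symm.injective, D.output⟩ ?_
    (relabel (Equiv.sumAssoc (A.Idx x.length) (R.Idx x.length) K).symm σ)
    ((isCPTP_relabel _).isDensity hσ)
  · rw [hprob, hprob] at this
    exact le_of_eq_of_le (congrArg₂ (fun ρ τ : Op ((B.sum R).Idx x.length ⊕ K) =>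
      |D.prob ρ - D.prob τ|) (onFirst_onFirst _ K (Φ x w) σ) (onFirst_onFirst _ K (Ψ x w) σ)) this
  · rw [Fintype.card_sum, Polynomial.eval_add]
    exact Nat.add_le_add (hb' _) hK
  · rw [Polynomial.eval_add]
    exact hD.trans (Nat.le_add_left _ _)

theorem length_moveGates {ι W : Type} (src dst : ι → W) (l : List ι) :
    (moveGates src dst l).length = 2 * l.length := by
  simp [moveGates, mul_comm]

/-- The circuit and the distinguisher are put on disjoint wires by prefixing their names with `0`
and `1`. The moves between them cost two gates per transferred qubit. -/
theorem MeasCircuit.exists_prob_comp {ι κ K : Type} [Fintype ι] [DecidableEq ι] [Fintype κ]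
    [DecidableEq κ] [Fintype K] [DecidableEq K] (G : List (Gate Wire)) {inp : ι → Wire}
    {out : κ → Wire} (hinp : Function.Injective inp) (hout : Function.Injective out)
    (D : MeasCircuit (κ ⊕ K)) :
    ∃ D' : MeasCircuit (ι ⊕ K),
      D'.gates.length = G.length + 2 * Fintype.card κ + D.gates.length ∧
      ∀ τ, D'.prob τ = D.prob (onFirst K (circuitChannel G inp out) τ) := by
  let f := renameWire (List.cons 0)
  let f' := renameWire (List.cons 1)
  have hf : Function.Injective f := renameWire_injective (List.cons_injective)
  have hf' : Function.Injective f' := renameWire_injective (List.cons_injective)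
  have hff' : ∀ w w', f w ≠ f' w' := fun w w' h => by
    simpa using (List.cons.inj (congrArg Prod.fst h)).1
  refine ⟨⟨G.map (Gate.map f) ++ moveGates (f ∘ out) (f' ∘ D.input ∘ Sum.inl)
    Finset.univ.toList ++ D.gates.map (Gate.map f'), Sum.elim (f ∘ inp) (f' ∘ D.input ∘ Sum.inr),
    (hf.comp hinp).sumElim ((hf'.comp D.input_inj).comp Sum.inr_injective)
      fun i k => hff' _ _, f' D.output⟩, ?_, fun τ => ?_⟩
  · simp [length_moveGates, add_assoc]
  · have e : Sum.elim (f' ∘ D.input ∘ Sum.inl) (f' ∘ D.input ∘ Sum.inr) = f' ∘ D.input := by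
      funext i
      rcases i with i | i <;> rfl
    have h := circuitChannel_comp_sumElim (G.map (Gate.map f)) (D.gates.map (Gate.map f'))
      (side := f' ∘ D.input ∘ Sum.inr) (out' := f' ∘ fun _ : Unit => D.output)
      (dst := f' ∘ D.input ∘ Sum.inl)
      (Finset.nodup_toList (Finset.univ : Finset κ)) (fun i => by simp) (hf.comp hinp)
      (hf.comp hout) (by rw [e]; exact hf'.comp D.input_inj) (Set.range f) (Set.range f')
      (by rintro w ⟨v, rfl⟩ ⟨v', h⟩; exact hff' _ _ h.symm)
      (fun g hg w => mem_range_of_mem_map hg) (fun g hg w => mem_range_of_mem_map hg)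
      (fun i => ⟨_, rfl⟩) (fun i => ⟨_, rfl⟩) (fun i => ⟨_, rfl⟩) (fun i => ⟨_, rfl⟩)
      (fun i => ⟨_, rfl⟩) τ
    rw [e, circuitChannel_map hf _ hinp, circuitChannel_map hf' _ D.input_inj] at h
    exact congrArg (fun ρ : Op Unit => (ρ (fun _ => true) (fun _ => true)).re) h

theorem CompIndist.postcomp {A B C : Register} {J : Set (List Bool × List Bool)}
    {Φ Ψ : ChannelFamily A B} (h : CompIndist J Φ Ψ)
    (hC : PolyBounded fun n => Fintype.card (C.Idx n))
    {Θ : ∀ x : List Bool, Op (B.Idx x.length) → Op (C.Idx x.length)} (hΘ : PolyTime B C Θ) :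
    CompIndist (A := A) (B := C) J (fun x w ρ => Θ x (Φ x w ρ)) (fun x w ρ => Θ x (Ψ x w ρ)) := by
  intro b
  obtain ⟨b₁, hb₁⟩ := hC
  obtain ⟨G, hG, hΘ⟩ := polyTime_iff.mp hΘ
  obtain ⟨b₂, hb₂⟩ := hG.length_le
  -- The new distinguisher consists of the circuit for `Θ`, two gates per qubit of `C`, and the old
  -- distinguisher.
  obtain ⟨ε, hε, h⟩ := h (b₂ + 2 * b₁ + b)
  refine ⟨ε, hε, fun x w hxw K _ _ hK D hD σ hσ => ?_⟩
  obtain ⟨D', hD', hprob⟩ := D.exists_prob_comp (G x) (tag_label_injective 0 B x.length)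
    (tag_label_injective 1 C x.length)
  rw [onFirst_comp K (Φ x w), onFirst_comp K (Ψ x w), hΘ, ← hprob, ← hprob]
  have h1 : Fintype.card (C.Idx x.length) ≤ _ := hb₁ x.length
  have h2 := hb₂ x
  simp only [Polynomial.eval_add, Polynomial.eval_mul, Polynomial.eval_ofNat] at h
  exact h x w hxw K (by omega) D' (by omega) σ hσ

/-! ### Zero-knowledge of the compressed protocol -/

namespace PublicCoinProof

variable (I : PublicCoinProof) {N : ℕ → ℕ}

/-- The distinguisher against the two oracles holds the commitment register in its side register
during the query and performs the commitment measurements itself afterwards. -/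
theorem compIndist_rrProver (hN : PolyTimeLength N)
    {S : ∀ x : List Bool, Op (I.chalReg.Idx x.length) → Op (I.ansReg.Idx x.length)}
    (hS : I.IsSpecialCompSimulator S) :
    CompIndist (I.RR N).instances (I.RR N).prover (fun x _ => I.rrSimulator N S x) := by
  have h := (((hS.2.symm.onFirst (I.enumerable_commitReg hN).polyBounded).precomp
    fun x => isCPTP_relabel (Equiv.sumComm (I.chalReg.Idx x.length)
      ((I.commitReg N).Idx x.length)))).postcomp (A := I.rrQuery N) (C := I.rrReply N)
    (I.enumerable_rrReply hN).polyBounded (I.polyTime_commitChan hN)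
  have e₁ : I.rrProver N = fun x w => I.answerAndCommit N (I.realOracle x w) :=
    funext₂ I.rrProver_eq
  have e₂ : (fun x _ => I.rrSimulator N S x : ChannelFamily (I.rrQuery N) (I.rrReply N)) =
      fun x w => I.answerAndCommit N (I.simOracle S x w) := funext₂ (I.rrSimulator_eq S)
  show CompIndist _ (I.rrProver N) (fun x _ => I.rrSimulator N S x)
  rw [e₁, e₂]
  exact h

theorem statIndist_rrProver (hN : PolyTimeLength N)
    {S : ∀ x : List Bool, Op (I.chalReg.Idx x.length) → Op (I.ansReg.Idx x.length)}
    (hS : I.IsSpecialStatSimulator S) :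
    StatIndist (I.RR N).instances (I.RR N).prover (fun x _ => I.rrSimulator N S x) := by
  have h := (((hS.2.symm.onFirst (I.commitReg N)).precomp
    fun x => isCPTP_relabel (Equiv.sumComm (I.chalReg.Idx x.length)
      ((I.commitReg N).Idx x.length)))).postcomp (A := I.rrQuery N) (C := I.rrReply N)
    (I.polyTime_commitChan hN).isCPTP
  have e₁ : I.rrProver N = fun x w => I.answerAndCommit N (I.realOracle x w) :=
    funext₂ I.rrProver_eq
  have e₂ : (fun x _ => I.rrSimulator N S x : ChannelFamily (I.rrQuery N) (I.rrReply N)) =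
      fun x w => I.answerAndCommit N (I.simOracle S x w) := funext₂ (I.rrSimulator_eq S)
  show StatIndist _ (I.rrProver N) (fun x _ => I.rrSimulator N S x)
  rw [e₁, e₂]
  exact h

end PublicCoinProof

/-! ### From the prover's channel to the interaction with a malicious verifier -/

namespace TwoMessageProof

variable {T : TwoMessageProof} {e e' o : ℕ → ℕ}

/-- The private memory has to be carried past the answer and into the second action, so the program
must be able to enumerate its qubits; hence `PolyTimeLength e'` and not only a polynomial bound. -/
theorem Verifier.polyTime_interact {V : T.Verifier e e' o} (hV : V.IsPolyTime)
    (hQ : T.fromVerifier.Enumerable) (hR : T.fromProver.Enumerable) (he' : PolyTimeLength e')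
    {S : ∀ x : List Bool, Op (T.fromVerifier.Idx x.length) → Op (T.fromProver.Idx x.length)}
    (hS : PolyTime T.fromVerifier T.fromProver S) :
    PolyTime (Register.ofSize e) (Register.ofSize o) fun x => V.interact (fun x _ => S x) x [] :=
  hV.2.comp (hR.sum (Register.enumerable_ofSize he'))
    ((hS.onFirst (Register.enumerable_ofSize he')).comp
      (hQ.sum (Register.enumerable_ofSize he')) hV.1)

/-- The memory plays the idle register, the first action prepares the joint state, and the second
action is part of the distinguisher. -/
theorem Verifier.compIndist_interact {V : T.Verifier e e' o} (hV : V.IsPolyTime)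
    (he' : PolyTimeLength e') (ho : PolyBounded o) {J : Set (List Bool × List Bool)}
    {P Q : ChannelFamily T.fromVerifier T.fromProver} (h : CompIndist J P Q) :
    CompIndist J (V.interact P) (V.interact Q) :=
  ((h.onFirst (Register.enumerable_ofSize he').polyBounded).precomp hV.1.isCPTP).postcomp
    (ho.imp fun _ h n => (Fintype.card_fin (o n)).le.trans (h n)) hV.2

theorem Verifier.statIndist_interact {V : T.Verifier e e' o} (hV : V.IsChannel)
    {J : Set (List Bool × List Bool)} {P Q : ChannelFamily T.fromVerifier T.fromProver}
    (h : StatIndist J P Q) : StatIndist J (V.interact P) (V.interact Q) :=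
  ((h.onFirst (Register.ofSize e')).precomp fun x => (hV x).1).postcomp fun x => (hV x).2

theorem Verifier.IsPolyTime.isChannel {V : T.Verifier e e' o} (hV : V.IsPolyTime) :
    V.IsChannel := fun x => ⟨hV.1.isCPTP x, hV.2.isCPTP x⟩

end TwoMessageProof

theorem mainTheorem4 (I : PublicCoinProof) (N : ℕ → ℕ) (hN : PolyTimeLength N) :
    (I.IsSpecialHVCZK → (I.RR N).IsCompQZK) ∧
    (I.IsSpecialHVSZK → (I.RR N).IsStatQZK) ∧
    (∀ S, I.IsSpecialCompSimulator S →
      PolyTime (I.rrQuery N) (I.rrReply N) (I.rrSimulator N S) ∧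
        CompIndist (I.RR N).instances (I.RR N).prover (fun x _ => I.rrSimulator N S x)) ∧
    (∀ S, I.IsSpecialStatSimulator S →
      PolyTime (I.rrQuery N) (I.rrReply N) (I.rrSimulator N S) ∧
        StatIndist (I.RR N).instances (I.RR N).prover (fun x _ => I.rrSimulator N S x)) := by
  have hQ := I.enumerable_rrQuery hN
  have hR := I.enumerable_rrReply hN
  refine ⟨?_, ?_, fun S hS => ⟨I.polyTime_rrSimulator hN hS.1, I.compIndist_rrProver hN hS⟩,
    fun S hS => ⟨I.polyTime_rrSimulator hN hS.1, I.statIndist_rrProver hN hS⟩⟩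
  · rintro ⟨S, hS⟩ e e' o - he' ho V hV
    -- The simulator is the interaction of the verifier with the prover-side simulator, which is the
    -- same for all verifiers.
    exact ⟨_, TwoMessageProof.Verifier.polyTime_interact hV hQ hR he' (I.polyTime_rrSimulator hN hS.1),
      TwoMessageProof.Verifier.compIndist_interact hV he' ho (I.compIndist_rrProver hN hS)⟩
  · rintro ⟨S, hS⟩
    refine ⟨fun e e' o V hV => ⟨I.rrSimulator N S, I.polyTime_rrSimulator hN hS.1,
      TwoMessageProof.Verifier.statIndist_interact hV (I.statIndist_rrProver hN hS)⟩,
      fun e e' o _ he' _ V hV => ⟨_, TwoMessageProof.Verifier.polyTime_interact hV hQ hR he'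
        (I.polyTime_rrSimulator hN hS.1), TwoMessageProof.Verifier.statIndist_interact
        hV.isChannel (I.statIndist_rrProver hN hS)⟩⟩
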